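/- Let $\mathbb K$ be $\mathbb R$ or $\mathbb C$ (smooth, respectively holomorphic, category). Let $G$ be a semisimple Lie group over $\mathbb K$ with a $|2|$-grading $\mathfrak g=\mathfrak g_{-2}\oplus\mathfrak g_{-1}\oplus\mathfrak g_0\oplus\mathfrak g_1\oplus\mathfrak g_2$ of its Lie algebra ($[\mathfrak g_i,\mathfrak g_j]\subseteq\mathfrak g_{i+j}$, $\mathfrak g_0$ contains no simple ideal of $\mathfrak g$, and $\mathfrak g_1$ generates $\mathfrak g_1\oplus\mathfrak g_2$). Put $\mathfrak g^i=\bigoplus_{j\ge i}\mathfrak g_j$, $\mathfrak p=\mathfrak g^0$, $\mathfrak g_-=\mathfrak g_{-2}\oplus\mathfrak g_{-1}\cong\mathfrak g/\mathfrak p$, and let $P\subset G$ be the subgroup preserving the filtration $(\mathfrak g^i)$, a Lie subgroup with Lie algebra $\mathfrak p$. Let $C_j=\bigwedge^j\mathfrak g_-^*\otimes\mathfrak g$, let $\partial$ be the Lie algebra cohomology differential of $\mathfrak g_-$ with values in $\mathfrak g$, and let $\partial^*:C_{j+1}\to C_j$ $(j=1,2)$ be $$(\partial^*\psi)(x_1,\dots,x_j)=\sum_l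 [z^l,\psi(x_1,\dots,x_j,z_l)]-\tfrac12\sum_l\sum_{i}\psi(x_1,\dots,[z^l,x_i]_-,\dots,x_j,z_l),$$ where $(z_l)$ is a basis of $\mathfrak g_-$, $(z^l)$ is the basis of $\mathfrak g^1$ dual to it for the Killing form, and $[\cdot,\cdot]_-$ is the $\mathfrak g_-$-component. Let $H^2=\ker(\partial^*|_{C_2})/\operatorname{im}(\partial^*|_{C_3})$, on which $P$ acts through its action on $\operatorname{gr}(\mathfrak g)\cong\mathfrak g$. Let $\omega$ be a Cartan connection of type $(G,P)$ on a principal $P$-bundle $\mathcal P\to M$, with curvature function $\kappa:\mathcal P\to C_2$, $\kappa(u)(x,y)=[x,y]-\omega_u([\omega^{-1}(x),\omega^{-1}(y)])$, and let $\kappa_l$ be its component of homogeneity $l$ (mapping $\mathfrak g_i\times\mathfrak g_j$ to $\mathfrak g_{i+j+l}$). Assume that $\omega$ is normal, i.e. $\partial^*\kappa=0$. Then: 1. $\kappa_l=0$ for $l<0$. 2. The homogeneity-zero component satisfies $\partial^*\kappa_0=0$ and $\partial\kappa_0=0$, and $u\mapsto[\kappa_0(u)]\in H^2$ is a smooth $P$-equivariant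 function, i.e. a section of the second cohomology bundle $H^2(\operatorname{gr}T,\operatorname{gr}\mathcal A)=\mathcal P\times_PH^2$. 3. More generally, if $\kappa_j=0$ on $\mathcal P$ for all $j<l$, then the lowest component $\kappa_l$ satisfies $\partial^*\kappa_l=0$ and $\partial\kappa_l=0$, and $[\kappa_l]$ is a section of the second cohomology bundle. 4. The harmonic curvature obstructs flatness: $[\kappa(u)]=0$ in $H^2$ for all $u\in\mathcal P$ if and only if $\omega$ is flat (its curvature form $d\omega+\frac12[\omega,\omega]$ vanishes). -/

import Mathlib

set_option maxSynthPendingDepth 3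

open scoped Manifold ContDiff

noncomputable section

namespace CartanGeom

/-! ### `|2|`-graded Lie algebras and their cochains -/

section Algebra

variable {𝕜 : Type*} [Field 𝕜] {𝔤 : Type*} [LieRing 𝔤] [LieAlgebra 𝕜 𝔤]

variable (𝕜 𝔤) in
/-- A `|2|`-grading `𝔤 = 𝔤₋₂ ⊕ 𝔤₋₁ ⊕ 𝔤₀ ⊕ 𝔤₁ ⊕ 𝔤₂` of a Lie algebra: the bracket is compatible with
the degrees, `𝔤₀` contains no simple ideal of `𝔤`, and `𝔤₁` generates `𝔤¹ = 𝔤₁ ⊕ 𝔤₂`. -/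
structure TwoGrading where
  piece : ℤ → Submodule 𝕜 𝔤
  isInternal : DirectSum.IsInternal piece
  piece_eq_bot : ∀ i : ℤ, 2 < |i| → piece i = ⊥
  lie_mem : ∀ {i j : ℤ} {x y : 𝔤}, x ∈ piece i → y ∈ piece j → ⁅x, y⁆ ∈ piece (i + j)
  no_simple : ∀ J : LieIdeal 𝕜 𝔤, LieAlgebra.IsSimple 𝕜 J → ¬ J.toSubmodule ≤ piece 0
  generated : (LieSubalgebra.lieSpan 𝕜 𝔤 (piece 1 : Set 𝔤)).toSubmodule = ⨆ j ≥ (1 : ℤ), piece j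

namespace TwoGrading

variable (gr : TwoGrading 𝕜 𝔤)

/-- The projection `𝔤 → 𝔤ᵢ ⊆ 𝔤` along the other graded pieces. -/
def proj (i : ℤ) : 𝔤 →ₗ[𝕜] 𝔤 :=
  (gr.piece i).subtype ∘ₗ DirectSum.component 𝕜 ℤ (fun j ↦ gr.piece j) i ∘ₗ
    (LinearEquiv.ofBijective (DirectSum.coeLinearMap gr.piece) gr.isInternal).symm.toLinearMap

/-- The filtration `𝔤ⁱ = ⨁_{j ≥ i} 𝔤ⱼ`; in particular `filt 0 = 𝔭`. -/
def filt (i : ℤ) : Submodule 𝕜 𝔤 := ⨆ j ≥ i, gr.piece j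

lemma proj_mem (i : ℤ) (x : 𝔤) : gr.proj i x ∈ gr.piece i := by
  simp [proj]

/-- The negative subalgebra `𝔤₋ = 𝔤₋₂ ⊕ 𝔤₋₁`. It is the model `gr(𝔤/𝔭)` of `gr(T)`. -/
def neg : LieSubalgebra 𝕜 𝔤 where
  __ := ⨆ j : {j : ℤ // j < 0}, gr.piece j
  lie_mem' := by
    intro x y hx hy
    simp only [AddSubsemigroup.mem_carrier, AddSubmonoid.mem_toSubsemigroup,
      Submodule.mem_toAddSubmonoid] at hx hy ⊢
    induction hx using Submodule.iSup_induction' with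
    | zero => simp
    | add a b _ _ ha hb => rw [add_lie]; exact add_mem ha hb
    | mem i a ha =>
      induction hy using Submodule.iSup_induction' with
      | zero => simp
      | add c d _ _ hc hd => rw [lie_add]; exact add_mem hc hd
      | mem j c hc =>
        exact Submodule.mem_iSup_of_mem
          (p := fun j : {j : ℤ // j < 0} ↦ gr.piece j) ⟨i + j, add_neg i.2 j.2⟩ (gr.lie_mem ha hc)

lemma piece_le_neg {i : ℤ} (hi : i < 0) : gr.piece i ≤ gr.neg.toSubmodule :=
  le_iSup (fun j : {j : ℤ // j < 0} ↦ gr.piece j) ⟨i, hi⟩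

/-- The projection `X ↦ X₋` of `𝔤` onto `𝔤₋` along `𝔭`. -/
def negProj : 𝔤 →ₗ[𝕜] gr.neg :=
  LinearMap.codRestrict gr.neg.toSubmodule (gr.proj (-2) + gr.proj (-1)) fun x ↦
    add_mem (gr.piece_le_neg (by norm_num) (gr.proj_mem (-2) x))
      (gr.piece_le_neg (by norm_num) (gr.proj_mem (-1) x))

/-- `C₁ = 𝔤₋^* ⊗ 𝔤`. -/
abbrev C1 := LieModule.Cohomology.oneCochain 𝕜 gr.neg 𝔤

/-- `C₂ = ⋀² 𝔤₋^* ⊗ 𝔤`. -/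
abbrev C2 := LieModule.Cohomology.twoCochain 𝕜 gr.neg 𝔤

/-- `C₃ = ⋀³ 𝔤₋^* ⊗ 𝔤`, the alternating trilinear maps. -/
def C3 : Submodule 𝕜 (gr.neg →ₗ[𝕜] gr.neg →ₗ[𝕜] gr.neg →ₗ[𝕜] 𝔤) where
  carrier := {c | ∀ x y, c x x y = 0 ∧ c x y y = 0}
  add_mem' {a b} ha hb x y := by simp [ha x y, hb x y]
  zero_mem' := by simp
  smul_mem' t {c} hc x y := by simp [hc x y]

/-- The Lie algebra differential `∂` on `C₂ = ⋀² 𝔤₋^* ⊗ 𝔤` (with values in trilinear maps). -/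
abbrev diff : gr.C2 →ₗ[𝕜] gr.neg →ₗ[𝕜] gr.neg →ₗ[𝕜] gr.neg →ₗ[𝕜] 𝔤 :=
  LieModule.Cohomology.d₂₃ 𝕜 gr.neg 𝔤

/-- Bilinear maps `𝔤₋ × 𝔤₋ → 𝔤` transported along a linear endomorphism of `𝔤₋` in the arguments and
one of `𝔤` in the values: `(x, y) ↦ b (ψ (a x, a' y))`. -/
def transport (a a' : gr.neg →ₗ[𝕜] gr.neg) (b : 𝔤 →ₗ[𝕜] 𝔤)
    (ψ : gr.neg →ₗ[𝕜] gr.neg →ₗ[𝕜] 𝔤) : gr.neg →ₗ[𝕜] gr.neg →ₗ[𝕜] 𝔤 :=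
  (ψ.compl₁₂ a a').compr₂ b

/-- The homogeneity `l` component `ψ_l` of a cochain `ψ ∈ C₂`: the part of `ψ` mapping
`𝔤ᵢ × 𝔤ⱼ` to `𝔤_{i+j+l}`. -/
def homComp (l : ℤ) (ψ : gr.C2) : gr.C2 where
  val := ∑ i ∈ Finset.Icc (-2 : ℤ) (-1), ∑ j ∈ Finset.Icc (-2 : ℤ) (-1),
    gr.transport (gr.negProj ∘ₗ gr.proj i ∘ₗ gr.neg.toSubmodule.subtype)
      (gr.negProj ∘ₗ gr.proj j ∘ₗ gr.neg.toSubmodule.subtype) (gr.proj (i + j + l)) ψ.1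
  property := by
    have h : Finset.Icc (-2 : ℤ) (-1) = {-2, -1} := by decide
    intro x
    have key := LieModule.Cohomology.twoCochain_skew ψ
    simp only [h, transport, LinearMap.sum_apply]
    rw [Finset.sum_pair (by norm_num), Finset.sum_pair (by norm_num),
      Finset.sum_pair (by norm_num)]
    simp only [LinearMap.compr₂_apply, LinearMap.compl₁₂_apply,
      LieModule.Cohomology.twoCochain_val_apply, LieModule.Cohomology.twoCochain_alt, map_zero]
    rw [← key ((gr.negProj ∘ₗ gr.proj (-2) ∘ₗ gr.neg.toSubmodule.subtype) x)]
    rw [map_neg, show (-2 + -1 + l : ℤ) = -1 + -2 + l by ring]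
    abel

section Codifferential

variable [CharZero 𝕜] [FiniteDimensional 𝕜 𝔤] [LieAlgebra.IsSemisimple 𝕜 𝔤]

/-- The elements `z^l ∈ 𝔤¹` dual, for the Killing form, to the basis `z_l` of `𝔤₋`: `z^l` is the
element of `𝔤` with `B (z^l, y) = (l-th coordinate of y₋)` for all `y ∈ 𝔤`. -/
def dualElt (l : Fin (Module.finrank 𝕜 gr.neg)) : 𝔤 :=
  ((killingForm 𝕜 𝔤).toDual (LieAlgebra.IsKilling.killingForm_nondegenerate 𝕜 𝔤)).symm
    ((Module.finBasis 𝕜 gr.neg).coord l ∘ₗ gr.negProj)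

/-- `∂^* : C₂ → C₁`,
`(∂^* ψ)(x) = ∑_l [z^l, ψ(x, z_l)] - ½ ψ([z^l, x]₋, z_l)`,
where `z_l` is a basis of `𝔤₋` and `z^l ∈ 𝔤¹` the dual basis (the choice is immaterial). -/
def codiff2 : gr.C2 →ₗ[𝕜] gr.C1 :=
  LinearMap.mk₂ 𝕜 (fun ψ x ↦ ∑ l,
      (⁅gr.dualElt l, ψ x (Module.finBasis 𝕜 gr.neg l)⁆
        - (2⁻¹ : 𝕜) • ψ (gr.negProj ⁅gr.dualElt l, (x : 𝔤)⁆) (Module.finBasis 𝕜 gr.neg l)))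
    (fun ψ φ x ↦ by
      rw [← Finset.sum_add_distrib]
      refine Finset.sum_congr rfl fun l _ ↦ ?_
      simp only [LieModule.Cohomology.add_apply_apply, lie_add, smul_add]
      abel)
    (fun c ψ x ↦ by
      simp only [Finset.smul_sum]
      refine Finset.sum_congr rfl fun l _ ↦ ?_
      simp only [LieModule.Cohomology.smul_apply_apply, lie_smul, smul_sub, smul_comm c (2⁻¹ : 𝕜)])
    (fun ψ x y ↦ by
      rw [← Finset.sum_add_distrib]
      refine Finset.sum_congr rfl fun l _ ↦ ?_
      simp only [map_add, LinearMap.add_apply, lie_add, smul_add, AddMemClass.coe_add]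
      abel)
    (fun c ψ x ↦ by
      simp only [Finset.smul_sum]
      refine Finset.sum_congr rfl fun l _ ↦ ?_
      simp only [map_smul, LinearMap.smul_apply, lie_smul, SetLike.val_smul, smul_sub,
        smul_comm c (2⁻¹ : 𝕜)])

/-- `∂^* : C₃ → C₂`,
`(∂^* ψ)(x, y) = ∑_l [z^l, ψ(x, y, z_l)] - ½ ψ([z^l, x]₋, y, z_l) - ½ ψ(x, [z^l, y]₋, z_l)`. -/
def codiff3 : gr.C3 →ₗ[𝕜] gr.C2 where
  toFun ψ :=
    { val := LinearMap.mk₂ 𝕜 (fun x y ↦ ∑ l,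
          (⁅gr.dualElt l, ψ.1 x y (Module.finBasis 𝕜 gr.neg l)⁆
            - (2⁻¹ : 𝕜) • ψ.1 (gr.negProj ⁅gr.dualElt l, (x : 𝔤)⁆) y (Module.finBasis 𝕜 gr.neg l)
            - (2⁻¹ : 𝕜) • ψ.1 x (gr.negProj ⁅gr.dualElt l, (y : 𝔤)⁆) (Module.finBasis 𝕜 gr.neg l)))
        (fun x x' y ↦ by
          rw [← Finset.sum_add_distrib]
          refine Finset.sum_congr rfl fun l _ ↦ ?_
          simp only [map_add, LinearMap.add_apply, lie_add, smul_add, AddMemClass.coe_add]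
          abel)
        (fun c x y ↦ by
          simp only [Finset.smul_sum]
          refine Finset.sum_congr rfl fun l _ ↦ ?_
          simp only [map_smul, LinearMap.smul_apply, lie_smul, SetLike.val_smul, smul_sub,
            smul_comm c (2⁻¹ : 𝕜)])
        (fun x y y' ↦ by
          rw [← Finset.sum_add_distrib]
          refine Finset.sum_congr rfl fun l _ ↦ ?_
          simp only [map_add, LinearMap.add_apply, lie_add, smul_add, AddMemClass.coe_add]
          abel)
        (fun c x y ↦ by
          simp only [Finset.smul_sum]
          refine Finset.sum_congr rfl fun l _ ↦ ?_
          simp only [map_smul, LinearMap.smul_apply, lie_smul, SetLike.val_smul, smul_sub,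
            smul_comm c (2⁻¹ : 𝕜)])
      property := fun x ↦ by
        rw [LinearMap.mk₂_apply]
        refine Finset.sum_eq_zero fun l _ ↦ ?_
        have h : ∀ a b z, ψ.1 a b z + ψ.1 b a z = 0 := fun a b z ↦ by
          have := (ψ.2 (a + b) z).1
          simpa [(ψ.2 a z).1, (ψ.2 b z).1] using this
        rw [(ψ.2 x _).1, lie_zero, zero_sub, ← neg_add', ← smul_add, h, smul_zero, neg_zero] }
  map_add' ψ φ := by
    ext x y
    simp only [Submodule.coe_add, LinearMap.add_apply, LinearMap.mk₂_apply, lie_add, smul_add]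
    rw [← Finset.sum_add_distrib]
    refine Finset.sum_congr rfl fun l _ ↦ ?_
    abel
  map_smul' c ψ := by
    ext x y
    simp only [SetLike.val_smul, LinearMap.smul_apply, LinearMap.mk₂_apply, lie_smul,
      RingHom.id_apply, Finset.smul_sum, smul_sub, smul_comm c (2⁻¹ : 𝕜)]

/-- The second cohomology `H² = ker (∂^* : C₂ → C₁) / im (∂^* : C₃ → C₂)`. -/
abbrev H2 := LinearMap.ker gr.codiff2 ⧸
  (LinearMap.range gr.codiff3).submoduleOf (LinearMap.ker gr.codiff2)

/-- The class in `H²` of a `∂^*`-closed element of `C₂`. -/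
def toH2 (ψ : gr.C2) (h : gr.codiff2 ψ = 0) : gr.H2 :=
  Submodule.Quotient.mk ⟨ψ, LinearMap.mem_ker.2 h⟩

end Codifferential
end TwoGrading
end Algebra

/-! ### Cartan connections of type `(G, P)` -/

section Geometry

set_option linter.unusedSectionVars false

/-- A family of continuous linear maps on a finite-dimensional space is smooth if it is so
pointwise. -/
lemma contMDiffAt_of_clm_apply {𝕜 : Type*} [RCLike 𝕜] {EX EY : Type*} [NormedAddCommGroup EX]
    [NormedSpace 𝕜 EX] [NormedAddCommGroup EY] [NormedSpace 𝕜 EY] [FiniteDimensional 𝕜 EY]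
    {F : Type*} [NormedAddCommGroup F] [NormedSpace 𝕜 F]
    {X : Type*} [TopologicalSpace X] [ChartedSpace EX X] {f : X → EY →L[𝕜] F} {x : X}
    (h : ∀ v, ContMDiffAt 𝓘(𝕜, EX) 𝓘(𝕜, F) ∞ (fun y ↦ f y v) x) :
    ContMDiffAt 𝓘(𝕜, EX) 𝓘(𝕜, EY →L[𝕜] F) ∞ f x := by
  let e₁ : EY ≃L[𝕜] Fin (Module.finrank 𝕜 EY) → 𝕜 :=
    ContinuousLinearEquiv.ofFinrankEq (Module.finrank_fin_fun 𝕜).symm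
  let e₂ := (e₁.arrowCongr (1 : F ≃L[𝕜] F)).trans (ContinuousLinearEquiv.piRing (Fin _))
  have : f = e₂.symm ∘ (fun y ↦ e₂ (f y)) := by ext1 y; simp
  rw [this]
  refine e₂.symm.toContinuousLinearMap.contMDiff.contMDiffAt.comp x (contMDiffAt_pi_space.2 fun i ↦ ?_)
  exact h (e₁.symm (Pi.single i 1))

variable {𝕜 : Type*} [RCLike 𝕜]
  {EG : Type*} [NormedAddCommGroup EG] [NormedSpace 𝕜 EG] [FiniteDimensional 𝕜 EG] [CompleteSpace EG]
  {G : Type*} [TopologicalSpace G] [ChartedSpace EG G] [Group G] [LieGroup 𝓘(𝕜, EG) ∞ G]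

instance instLEInftyMinSmoothness : ENat.LEInfty (minSmoothness 𝕜 3) :=
  ⟨by rw [minSmoothness_of_isRCLikeNormedField]; exact ENat.LEInfty.out⟩

instance instFiniteDimensionalGroupLieAlgebra :
    FiniteDimensional 𝕜 (GroupLieAlgebra 𝓘(𝕜, EG) G) :=
  inferInstanceAs (FiniteDimensional 𝕜 EG)

variable (𝕜) in
/-- The adjoint action `Ad g = T₁(h ↦ g h g⁻¹)` of `G` on its Lie algebra `𝔤 = T₁G`. -/
def Ad (g : G) : GroupLieAlgebra 𝓘(𝕜, EG) G →ₗ[𝕜] GroupLieAlgebra 𝓘(𝕜, EG) G :=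
  (mfderiv 𝓘(𝕜, EG) 𝓘(𝕜, EG) (fun h : G ↦ g * h * g⁻¹) 1).toLinearMap

variable {EP : Type*} [NormedAddCommGroup EP] [NormedSpace 𝕜 EP]
  {EB : Type*} [NormedAddCommGroup EB] [NormedSpace 𝕜 EB] [FiniteDimensional 𝕜 EB] [CompleteSpace EB]
  {EM : Type*} [NormedAddCommGroup EM] [NormedSpace 𝕜 EM]

variable (EP) in
/-- `P ⊆ G` is the parabolic subgroup of the `|2|`-graded Lie algebra `𝔤` of `G`: the subgroup of all
elements whose adjoint action preserves the filtration `𝔤ⁱ`. The given manifold structure on `P`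
(with the subspace topology) makes it an immersed, hence embedded, Lie subgroup of `G`, with
Lie algebra `𝔭 = 𝔤⁰`. -/
structure IsParabolic (gr : TwoGrading 𝕜 (GroupLieAlgebra 𝓘(𝕜, EG) G)) (P : Subgroup G)
    [ChartedSpace EP P] : Prop where
  mem_iff : ∀ g : G, g ∈ P ↔ ∀ i : ℤ, (gr.filt i).map (Ad 𝕜 g) = gr.filt i
  contMDiff_val : ContMDiff 𝓘(𝕜, EP) 𝓘(𝕜, EG) ∞ (Subtype.val : P → G)
  injective_mfderiv :
    Function.Injective (mfderiv 𝓘(𝕜, EP) 𝓘(𝕜, EG) (Subtype.val : P → G) 1)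
  range_mfderiv : ∀ A : GroupLieAlgebra 𝓘(𝕜, EG) G, A ∈ gr.filt 0 ↔
    ∃ a : GroupLieAlgebra 𝓘(𝕜, EP) P, mfderiv 𝓘(𝕜, EP) 𝓘(𝕜, EG) (Subtype.val : P → G) 1 a = A

variable (𝕜 EP EB EM) in
/-- A smooth principal bundle `B → M` with structure group `P` acting on the right. -/
structure PrincipalBundle (P : Type*) [TopologicalSpace P] [ChartedSpace EP P] [Group P]
    (B : Type*) [TopologicalSpace B] [ChartedSpace EB B]
    (M : Type*) [TopologicalSpace M] [ChartedSpace EM M] where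
  π : B → M
  act : B → P → B
  act_one : ∀ u, act u 1 = u
  π_act : ∀ u p, π (act u p) = π u
  act_mul : ∀ u p q, act u (p * q) = act (act u p) q
  contMDiff_π : ContMDiff 𝓘(𝕜, EB) 𝓘(𝕜, EM) ∞ π
  contMDiff_act : ContMDiff (𝓘(𝕜, EB).prod 𝓘(𝕜, EP)) 𝓘(𝕜, EB) ∞ (fun z : B × P ↦ act z.1 z.2)
  locally_trivial : ∀ x : M, ∃ (U : Set M) (e : OpenPartialHomeomorph B (M × P)),
    x ∈ U ∧ e.source = π ⁻¹' U ∧ e.target = U ×ˢ Set.univ ∧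
    ContMDiffOn 𝓘(𝕜, EB) (𝓘(𝕜, EM).prod 𝓘(𝕜, EP)) ∞ e e.source ∧
    ContMDiffOn (𝓘(𝕜, EM).prod 𝓘(𝕜, EP)) 𝓘(𝕜, EB) ∞ e.symm e.target ∧
    (∀ u ∈ e.source, (e u).1 = π u) ∧
    ∀ u ∈ e.source, ∀ p : P, e (act u p) = ((e u).1, (e u).2 * p)

variable {P : Subgroup G} [ChartedSpace EP P]
  {B : Type*} [TopologicalSpace B] [ChartedSpace EB B] [IsManifold 𝓘(𝕜, EB) ∞ B]
  {M : Type*} [TopologicalSpace M] [ChartedSpace EM M]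

variable (EG) in
/-- A Cartan connection of type `(G, P)` on a principal `P`-bundle `B → M`: a smooth `𝔤`-valued
one-form `ω` on `B` which is `P`-equivariant, reproduces the generators of the fundamental vector
fields, and restricts to an isomorphism `T_u B ≅ 𝔤` for every `u`. -/
structure CartanConnection (bdl : PrincipalBundle 𝕜 EP EB EM P B M) where
  form : ∀ u : B, TangentSpace 𝓘(𝕜, EB) u ≃L[𝕜] GroupLieAlgebra 𝓘(𝕜, EG) G
  contMDiff_form : ContMDiff (M' := EG) (𝓘(𝕜, EB).tangent) 𝓘(𝕜, EG) ∞
    (fun v : TangentBundle 𝓘(𝕜, EB) B ↦ form v.1 v.2)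
  equivariant : ∀ (u : B) (p : P) (v : TangentSpace 𝓘(𝕜, EB) u),
    form (bdl.act u p) (mfderiv 𝓘(𝕜, EB) 𝓘(𝕜, EB) (fun w ↦ bdl.act w p) u v) =
      Ad 𝕜 (p⁻¹ : P).1 (form u v)
  fundamental : ∀ (u : B) (a : GroupLieAlgebra 𝓘(𝕜, EP) P),
    form (bdl.act u 1) (mfderiv 𝓘(𝕜, EP) 𝓘(𝕜, EB) (fun p : P ↦ bdl.act u p) 1 a) =
      mfderiv 𝓘(𝕜, EP) 𝓘(𝕜, EG) (Subtype.val : P → G) 1 a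

namespace CartanConnection

variable {bdl : PrincipalBundle 𝕜 EP EB EM P B M} (c : CartanConnection EG bdl)

/-- The vector field `ω⁻¹(A)` on `B`. -/
def constField (A : GroupLieAlgebra 𝓘(𝕜, EG) G) (u : B) : TangentSpace 𝓘(𝕜, EB) u :=
  (c.form u).symm A

/-- The constant vector fields `ω⁻¹(A)` are smooth. -/
lemma contMDiff_constField (A : GroupLieAlgebra 𝓘(𝕜, EG) G) :
    ContMDiff 𝓘(𝕜, EB) 𝓘(𝕜, EB).tangent ∞
      (fun w ↦ (⟨w, c.constField A w⟩ : TangentBundle 𝓘(𝕜, EB) B)) := by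
  intro u
  let t := trivializationAt EB (TangentSpace 𝓘(𝕜, EB) : B → Type _) u
  have hu : u ∈ t.baseSet := FiberBundle.mem_baseSet_trivializationAt' u
  have hmem : ∀ᶠ x in nhds u, x ∈ t.baseSet := t.open_baseSet.mem_nhds hu
  let g : B → (EB →L[𝕜] EG) := fun x ↦
    ((c.form x).toContinuousLinearMap.comp (t.symmL 𝕜 x) : EB →L[𝕜] GroupLieAlgebra 𝓘(𝕜, EG) G)
  have hg : ContMDiffAt 𝓘(𝕜, EB) 𝓘(𝕜, EB →L[𝕜] EG) ∞ g u := by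
    refine contMDiffAt_of_clm_apply fun v ↦ ?_
    have h1 : ContMDiffAt 𝓘(𝕜, EB) 𝓘(𝕜, EB).tangent ∞
        (fun x ↦ (⟨x, t.symm x v⟩ : TangentBundle 𝓘(𝕜, EB) B)) u := by
      refine (Bundle.contMDiffAt_section u).2 ?_
      refine (contMDiffAt_const (c := v)).congr_of_eventuallyEq ?_
      filter_upwards [hmem] with x hx
      exact congrArg Prod.snd (t.apply_mk_symm hx v)
    refine ((c.contMDiff_form _).comp u h1).congr_of_eventuallyEq ?_
    filter_upwards [hmem] with x hx
    exact congrArg (c.form x) (t.symmL_apply (R := 𝕜) hx v)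
  let e : ∀ x, x ∈ t.baseSet → EB ≃L[𝕜] EG := fun x hx ↦
    ((t.continuousLinearEquivAt 𝕜 x hx).symm.trans (c.form x) :
      EB ≃L[𝕜] GroupLieAlgebra 𝓘(𝕜, EG) G)
  have hge : ∀ x (hx : x ∈ t.baseSet), g x = (e x hx : EB →L[𝕜] EG) := fun x hx ↦ by
    ext v
    exact congrArg (c.form x) (congrFun (t.symm_continuousLinearEquivAt_eq (R := 𝕜) hx) v).symm
  refine (Bundle.contMDiffAt_section u).2 ?_
  have hinv : ContMDiffAt 𝓘(𝕜, EB) 𝓘(𝕜, EG →L[𝕜] EB) ∞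
      (fun x ↦ ContinuousLinearMap.inverse (g x)) u := by
    have h2 : ContDiffAt 𝕜 ∞ (ContinuousLinearMap.inverse : (EB →L[𝕜] EG) → _) (g u) := by
      rw [hge u hu]; exact contDiffAt_map_inverse _
    exact h2.contMDiffAt.comp u hg
  have happ : ContMDiffAt 𝓘(𝕜, EB) 𝓘(𝕜, EB) ∞
      (fun x ↦ ContinuousLinearMap.inverse (g x) (A : EG)) u :=
    hinv.clm_apply contMDiffAt_const
  refine happ.congr_of_eventuallyEq ?_
  filter_upwards [hmem] with x hx
  rw [hge x hx, ContinuousLinearMap.inverse_equiv]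
  exact (congrFun (t.continuousLinearEquivAt_apply 𝕜 x hx) _).symm

lemma mdifferentiableAt_constField (A : GroupLieAlgebra 𝓘(𝕜, EG) G) (u : B) :
    MDifferentiableAt 𝓘(𝕜, EB) 𝓘(𝕜, EB).tangent
      (fun w ↦ (⟨w, c.constField A w⟩ : TangentBundle 𝓘(𝕜, EB) B)) u :=
  (c.contMDiff_constField A).mdifferentiableAt (by simp)

lemma constField_add (A A' : GroupLieAlgebra 𝓘(𝕜, EG) G) :
    c.constField (A + A') = c.constField A + c.constField A' := by
  ext u; exact map_add (c.form u).symm A A'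

lemma constField_smul (r : 𝕜) (A : GroupLieAlgebra 𝓘(𝕜, EG) G) :
    c.constField (r • A) = r • c.constField A := by
  ext u; exact map_smul (c.form u).symm r A

/-- The curvature form `K = dω + ½[ω, ω]`, read in the parallelization of `TB` given by `ω`:
`K_u(A, A') = [A, A'] - ω_u([ω⁻¹(A), ω⁻¹(A')])` for `A, A' ∈ 𝔤`. -/
def curvatureForm (u : B) : GroupLieAlgebra 𝓘(𝕜, EG) G →ₗ[𝕜] GroupLieAlgebra 𝓘(𝕜, EG) G →ₗ[𝕜]
      GroupLieAlgebra 𝓘(𝕜, EG) G :=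
  LinearMap.mk₂ 𝕜 (fun A A' ↦ ⁅A, A'⁆ -
      c.form u (VectorField.mlieBracket 𝓘(𝕜, EB) (c.constField A) (c.constField A') u))
    (fun A₁ A₂ A' ↦ by
      rw [constField_add, VectorField.mlieBracket_add_left (c.mdifferentiableAt_constField A₁ u)
        (c.mdifferentiableAt_constField A₂ u), map_add, add_lie]
      abel)
    (fun r A A' ↦ by
      rw [constField_smul, VectorField.mlieBracket_const_smul_left
        (c.mdifferentiableAt_constField A u), map_smul, smul_lie, smul_sub])
    (fun A A₁ A₂ ↦ by
      rw [constField_add, VectorField.mlieBracket_add_right (c.mdifferentiableAt_constField A₁ u)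
        (c.mdifferentiableAt_constField A₂ u), map_add, lie_add]
      abel)
    (fun r A A' ↦ by
      rw [constField_smul, VectorField.mlieBracket_const_smul_right
        (c.mdifferentiableAt_constField A' u), map_smul, lie_smul, smul_sub])

/-- The Cartan connection is flat if its curvature form vanishes identically. -/
def IsFlat : Prop := ∀ u : B, c.curvatureForm u = 0

variable (gr : TwoGrading 𝕜 (GroupLieAlgebra 𝓘(𝕜, EG) G))

/-- The curvature function `κ : B → ⋀² 𝔤₋^* ⊗ 𝔤`. The curvature form is horizontal, so `κ` is
the `P`-equivariant function corresponding to the section `κ` of `⋀² T^* ⊗ 𝒜`, where `T` is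
identified with `B ×_P 𝔤/𝔭` and `𝔤/𝔭` with `𝔤₋`. -/
def curvature (u : B) : gr.C2 where
  val := (c.curvatureForm u).compl₁₂ gr.neg.toSubmodule.subtype gr.neg.toSubmodule.subtype
  property x := by
    change ⁅(x : GroupLieAlgebra 𝓘(𝕜, EG) G), (x : GroupLieAlgebra 𝓘(𝕜, EG) G)⁆ - _ = 0
    rw [VectorField.mlieBracket_self]
    simp

variable [LieAlgebra.IsSemisimple 𝕜 (GroupLieAlgebra 𝓘(𝕜, EG) G)]

/-- Normality: `∂^* κ = 0`. -/
def IsNormal : Prop := ∀ u : B, gr.codiff2 (c.curvature gr u) = 0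

/-- The homogeneity `l` component `κ_l` of the curvature function. -/
def curvatureComp (l : ℤ) (u : B) : gr.C2 := gr.homComp l (c.curvature gr u)

end CartanConnection

/-! ### The second cohomology bundle -/

variable (gr : TwoGrading 𝕜 (GroupLieAlgebra 𝓘(𝕜, EG) G))

/-- The action of `g ∈ P` on `gr(𝔤) ≅ 𝔤` induced by `Ad g`. -/
def grAd (g : G) : GroupLieAlgebra 𝓘(𝕜, EG) G →ₗ[𝕜] GroupLieAlgebra 𝓘(𝕜, EG) G :=
  ∑ i ∈ Finset.Icc (-2 : ℤ) 2, gr.proj i ∘ₗ Ad 𝕜 g ∘ₗ gr.proj i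

/-- The action of `g ∈ P` on `C₂ = ⋀² gr(𝔤/𝔭)^* ⊗ gr(𝔤)`:
`(g • ψ)(x, y) = g (ψ (g⁻¹ x, g⁻¹ y))`. -/
def grAct (g : G) (ψ : gr.C2) : gr.C2 where
  val := gr.transport (gr.negProj ∘ₗ grAd gr g⁻¹ ∘ₗ gr.neg.toSubmodule.subtype)
    (gr.negProj ∘ₗ grAd gr g⁻¹ ∘ₗ gr.neg.toSubmodule.subtype) (grAd gr g) ψ.1
  property x := by
    simp [TwoGrading.transport]

variable [LieAlgebra.IsSemisimple 𝕜 (GroupLieAlgebra 𝓘(𝕜, EG) G)]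

/-- `s : B → H²` is (the function corresponding to) a smooth section of the second cohomology bundle
`H²(gr T, gr 𝒜) = B ×_P H²`: it is smooth and `s (u p) = p⁻¹ • s u`, where `P` acts on classes
through representatives. -/
structure IsSectionH2 (bdl : PrincipalBundle 𝕜 EP EB EM P B M) (s : B → gr.H2) : Prop where
  smooth : ∀ f : gr.H2 →ₗ[𝕜] 𝕜, ContMDiff 𝓘(𝕜, EB) 𝓘(𝕜, 𝕜) ∞ (fun u ↦ f (s u))
  equivariant : ∀ (u : B) (p : P) (ψ : gr.C2) (h : gr.codiff2 ψ = 0), s u = gr.toH2 ψ h →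
    ∃ h' : gr.codiff2 (grAct gr (p⁻¹ : P).1 ψ) = 0,
      s (bdl.act u p) = gr.toH2 (grAct gr (p⁻¹ : P).1 ψ) h'

end Geometry

end CartanGeom

end

/-! All claims except flatness come from counting degrees, equivariance and the Bianchi identity.
Two arguments from `𝔤₋` have total degree at most `-2` and `𝔤` stops at degree `-2`, so nothing of
negative homogeneity exists. Three arguments have total degree at most `-3`, so `∂` kills every
component of homogeneity `≤ 0`. Since `∂^*` respects homogeneity, normality passes to each `κ_l`
(`codiff2_curvatureComp`).

For `l > 0` the Jacobi identity for the fields `ω⁻¹(X)` gives `bianchi`: `∂κ` is a term quadratic in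
`κ` plus first derivatives of `κ`. If `κ` has homogeneity `≥ l`, the quadratic term has homogeneity
`≥ 2l`. A derivative of `κ(y, z)` along `ω⁻¹(x)` stays in the filtration step of `κ(y, z)`, while
the component of `∂κ` of homogeneity `l` lies lower by the negative degree of `x`. Hence `∂κ_l = 0`
(`diff_curvatureComp`). Restriction to `𝔤₋` is legitimate because the curvature is horizontal, which
follows from a general formula for brackets with generators of an action (`mlieBracket_of_action`).
On a lowest component, `P` acts only through the graded parts of `Ad`, which gives the section of
the cohomology bundle.

For flatness, suppose `κ = ∂^*φ` at every point. For a positive Hermitian form on cochains the image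
of `∂^*` is orthogonal to the kernel of `∂` (`sum_codiff3_eq_zero`), and distinct homogeneities are
orthogonal. The lowest component of `κ` is a cocycle and a component of a `∂^*`-image, so it
vanishes; induction on the homogeneity finishes.

The Hermitian form needs a conjugate-linear anti-automorphism of `𝔤` that is positive for the
Killing form and reverses the grading, that is, minus a Cartan involution adapted to the grading. It
is obtained from a minimal vector. Semisimple brackets are rigid, because the Casimir element
contracts `H²(𝔤, 𝔤)`. So the orbit of the bracket under maps commuting with the grading derivation,
at fixed modulus of the discriminant, is closed and has an element of least norm
(`exists_isMinOn_normSq`). There the adjoint of a homogeneous derivation is again a derivation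
(`infAct_adjoint_eq_zero`), hence inner, and `x ↦ (ad x)^†` defines the anti-automorphism
(`exists_transposition`). -/

noncomputable section
set_option linter.unusedSectionVars false
namespace CartanGeom

/-! ### Canonical tensors and vanishing of `H²(𝔤, 𝔤)` -/

section Tensor

variable {K : Type*} [CommRing K] {U U' W : Type*} [AddCommGroup U] [Module K U] [AddCommGroup U']
  [Module K U'] [AddCommGroup W] [Module K W] {ι ι' : Type*} [Fintype ι] [Fintype ι']

/-- The tensor `∑ bᵢ^* ⊗ T bᵢ` representing a linear map `T` does not depend on the basis. -/
lemma sum_coord_apply_eq (b : Module.Basis ι K U) (b' : Module.Basis ι' K U') (T : U →ₗ[K] U')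
    (γ : (U →ₗ[K] K) →ₗ[K] U' →ₗ[K] W) :
    ∑ i, γ (b.coord i) (T (b i)) = ∑ j, γ (b'.coord j ∘ₗ T) (b' j) := by
  classical
  have h1 : ∀ i, T (b i) = ∑ j, b'.coord j (T (b i)) • b' j := fun i ↦ by
    simp
  have h2 : ∀ j, b'.coord j ∘ₗ T = ∑ i, b'.coord j (T (b i)) • b.coord i := fun j ↦ by
    refine b.ext fun i ↦ ?_
    simp [Finsupp.single_apply]
  calc ∑ i, γ (b.coord i) (T (b i)) = ∑ i, ∑ j, b'.coord j (T (b i)) • γ (b.coord i) (b' j) := by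
        refine Finset.sum_congr rfl fun i _ ↦ ?_
        conv_lhs => rw [h1 i]
        simp only [map_sum, map_smul]
    _ = _ := by
        rw [Finset.sum_comm]
        refine Finset.sum_congr rfl fun j _ ↦ ?_
        conv_rhs => rw [h2 j]
        simp only [map_sum, map_smul, LinearMap.sum_apply, LinearMap.smul_apply]

lemma trace_eq_sum_coord (b : Module.Basis ι K U) (T : U →ₗ[K] U) :
    LinearMap.trace K U T = ∑ i, b.coord i (T (b i)) := by
  classical
  rw [LinearMap.trace_eq_matrix_trace K b, Matrix.trace]
  simp [LinearMap.toMatrix_apply]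

end Tensor

/-! ### Infinitesimal rigidity by the Casimir homotopy -/

section Deformation

variable {K V : Type*} [Field K] [AddCommGroup V] [Module K V]

/-- The trace form `(x, y) ↦ tr (ad x ∘ ad y)` of a bilinear operation. -/
def trForm (br : V →ₗ[K] V →ₗ[K] V) : V →ₗ[K] V →ₗ[K] K :=
  LinearMap.mk₂ K (fun x y ↦ LinearMap.trace K V (br x ∘ₗ br y))
    (fun x x' y ↦ by simp [LinearMap.add_comp]) (fun c x y ↦ by simp [LinearMap.smul_comp])
    (fun x y y' ↦ by simp [LinearMap.comp_add]) (fun c x y ↦ by simp [LinearMap.comp_smul])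

lemma trForm_apply (br : V →ₗ[K] V →ₗ[K] V) (x y : V) :
    trForm br x y = LinearMap.trace K V (br x ∘ₗ br y) := rfl

/-- For a derivation, `br (D x)` is the commutator of `D` with `br x`. The sum of the two sides is
therefore the trace of the commutator of `D` with `br x ∘ br y`. -/
lemma trForm_derivation {br : V →ₗ[K] V →ₗ[K] V} {D : V →ₗ[K] V}
    (hD : ∀ x y, D (br x y) = br (D x) y + br x (D y)) (x y : V) :
    trForm br (D x) y = - trForm br x (D y) := by
  have h : ∀ x, br (D x) = D * br x - br x * D := fun x ↦ by
    ext y; simp [hD]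
  rw [eq_neg_iff_add_eq_zero, trForm_apply, trForm_apply, ← map_add, h, h]
  have : (D * br x - br x * D) ∘ₗ br y + br x ∘ₗ (D * br y - br y * D) =
      D * (br x * br y) - (br x * br y) * D := by
    simp only [← Module.End.mul_eq_comp]; noncomm_ring
  rw [this, map_sub, LinearMap.trace_mul_comm, sub_self]

lemma trForm_symm (br : V →ₗ[K] V →ₗ[K] V) (x y : V) : trForm br x y = trForm br y x :=
  LinearMap.trace_mul_comm K (br x) (br y)

/-- A bracket whose trace form is nondegenerate is infinitesimally rigid: `H²(𝔤, 𝔤) = 0`. The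
primitive of a cocycle inherits every infinitesimal symmetry. -/
theorem exists_primitive_of_cocycle [FiniteDimensional K V] {br : V →ₗ[K] V →ₗ[K] V} (alt : ∀ x, br x x = 0)
    (jac : ∀ x y z, br x (br y z) = br (br x y) z + br y (br x z))
    (nd : ∀ x, (∀ y, trForm br x y = 0) → x = 0)
    {w : V →ₗ[K] V →ₗ[K] V} (walt : ∀ x, w x x = 0)
    (hw : ∀ x y z, br x (w y z) - w (br x y) z - br y (w x z)
      + (w x (br y z) - br (w x y) z - w y (br x z)) = 0) :
    ∃ s : V →ₗ[K] V, (∀ x y, w x y = s (br x y) - br (s x) y - br x (s y)) ∧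
      ∀ D : V →ₗ[K] V, (∀ x y, D (br x y) = br (D x) y + br x (D y)) →
        (∀ x y, D (w x y) = w (D x) y + w x (D y)) → D ∘ₗ s = s ∘ₗ D := by
  have skew : ∀ {f : V →ₗ[K] V →ₗ[K] V}, (∀ x, f x x = 0) → ∀ x y, f x y = - f y x :=
    fun {f} hf x y ↦ by
      have := hf (x + y)
      simp only [map_add, LinearMap.add_apply, hf, zero_add, add_zero] at this
      rw [eq_neg_iff_add_eq_zero, add_comm]; exact this
  let b := Module.finBasis K V
  have inj : Function.Injective (trForm br) := by
    rw [injective_iff_map_eq_zero]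
    exact fun x hx ↦ nd x fun y ↦ by rw [hx]; rfl
  let e : V ≃ₗ[K] Module.Dual K V :=
    LinearEquiv.ofInjectiveOfFinrankEq (trForm br) inj Subspace.dual_finrank_eq.symm
  have he : ∀ f y, trForm br (e.symm f) y = f y := fun f y ↦
    congrArg (fun g : Module.Dual K V ↦ g y) (e.apply_symm_apply f)
  have sharp : ∀ D : V →ₗ[K] V, (∀ x y, D (br x y) = br (D x) y + br x (D y)) →
      ∀ f : Module.Dual K V, D (e.symm f) = - e.symm (f ∘ₗ D) := fun D hD f ↦ by
    apply inj
    ext y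
    rw [trForm_derivation hD, he, map_neg, LinearMap.neg_apply, he]; rfl
  -- The canonical tensor `∑ bⁱ ⊗ bᵢ`, with `bⁱ` dual to `bᵢ` for the trace form, is killed by every
  -- derivation, since derivations are skew for that form.
  have inv : ∀ D : V →ₗ[K] V, (∀ x y, D (br x y) = br (D x) y + br x (D y)) →
      ∀ γ : V →ₗ[K] V →ₗ[K] V,
        ∑ i, (γ (D (e.symm (b.coord i))) (b i) + γ (e.symm (b.coord i)) (D (b i))) = 0 := by
    intro D hD γ
    have := sum_coord_apply_eq b b D (γ ∘ₗ e.symm.toLinearMap)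
    simp only [LinearMap.comp_apply, LinearEquiv.coe_coe] at this
    rw [Finset.sum_add_distrib, this, ← Finset.sum_add_distrib]
    exact Finset.sum_eq_zero fun i _ ↦ by rw [sharp D hD]; simp
  have jac' : ∀ a x y, br a (br x y) = br (br a x) y + br x (br a y) := jac
  -- The Casimir element of the trace form of the adjoint representation acts on that representation
  -- as the identity: pairing with `y` turns the sum into the trace defining `trForm br v y`.
  have cas : ∀ v, ∑ i, br (b i) (br (e.symm (b.coord i)) v) = v := by
    intro v
    apply inj
    ext y
    rw [trForm_apply br v y, trace_eq_sum_coord b, map_sum, LinearMap.sum_apply]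
    refine Finset.sum_congr rfl fun i _ ↦ ?_
    rw [trForm_derivation (jac' (b i)), skew alt _ v, map_neg, LinearMap.neg_apply, neg_neg,
      trForm_derivation (jac' v), he, skew alt (b i) y]
    simp
  -- the contracting homotopy
  let h : V →ₗ[K] V := ∑ i, br (b i) ∘ₗ w (e.symm (b.coord i))
  have hh : ∀ x, h x = ∑ i, br (b i) (w (e.symm (b.coord i)) x) := fun x ↦ by simp [h]
  refine ⟨-h, fun y z ↦ ?_, fun D hD hDw ↦ ?_⟩
  -- The cocycle identity at `(bⁱ, y, z)`, acted on by `bᵢ` and summed. Its first term is the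
  -- Casimir applied to `w y z`. The others recombine into the coboundary of `h` by invariance of
  -- the tensor (`k2`) and the Jacobi identity (`k3`).
  · have k1 : ∑ i, br (b i) (br (e.symm (b.coord i)) (w y z)
        - w (br (e.symm (b.coord i)) y) z - br y (w (e.symm (b.coord i)) z)
        + (w (e.symm (b.coord i)) (br y z) - br (w (e.symm (b.coord i)) y) z
          - w y (br (e.symm (b.coord i)) z))) = 0 :=
      Finset.sum_eq_zero fun i _ ↦ by rw [hw, map_zero]
    have k2 : ∀ y z, ∑ i, (br (b i) (w (br y (e.symm (b.coord i))) z)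
        + br (br y (b i)) (w (e.symm (b.coord i)) z)) = 0 := fun y z ↦
      inv (br y) (jac' y) (br.flip ∘ₗ w.flip z)
    have k3 : ∀ y z, br y (h z) = ∑ i, (br (br y (b i)) (w (e.symm (b.coord i)) z)
        + br (b i) (br y (w (e.symm (b.coord i)) z))) := fun y z ↦ by
      rw [hh, map_sum]; exact Finset.sum_congr rfl fun i _ ↦ jac _ _ _
    have k6 : br y (h z) - br z (h y) - h (br y z) = w y z := by
      have k7 : br y (h z) - br z (h y) - h (br y z) - w y z = 0 - 0 - 0 := by
        rw [k3, k3, hh]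
        conv_lhs => rw [← cas (w y z)]
        refine Eq.trans ?_ (congrArg₂ HSub.hSub (congrArg₂ HSub.hSub (k2 y z) (k2 z y)) k1)
        simp only [← Finset.sum_sub_distrib]
        refine Finset.sum_congr rfl fun i _ ↦ ?_
        rw [skew alt (e.symm (b.coord i)) y, skew alt (e.symm (b.coord i)) z,
          skew alt (w (e.symm (b.coord i)) y) z, skew walt y (-_)]
        simp only [map_neg, map_sub, map_add, LinearMap.neg_apply]
        abel
      rw [sub_zero, sub_zero, sub_eq_zero] at k7
      exact k7
    rw [← k6, skew alt ((-h) y)]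
    simp only [LinearMap.neg_apply, map_neg]
    abel
  · ext x
    -- A symmetry of `br` and `w` also kills the canonical tensor, so it commutes with `h`, which is
    -- built from these three alone.
    have k := inv D hD (br.flip ∘ₗ w.flip x)
    simp only [LinearMap.comp_apply, LinearMap.flip_apply] at k
    simp only [LinearMap.comp_apply, LinearMap.neg_apply, map_neg, hh, map_sum, hD, hDw]
    rw [← sub_eq_zero, neg_sub_neg, ← Finset.sum_sub_distrib, ← neg_eq_zero, ← k,
      ← Finset.sum_neg_distrib]
    refine Finset.sum_congr rfl fun i _ ↦ ?_
    simp only [map_add]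
    abel

end Deformation

/-! ### Rigidity of semisimple brackets -/

section Rigidity

open NormedSpace Filter Topology

variable {𝕜 : Type*} [RCLike 𝕜] {V : Type*} [NormedAddCommGroup V] [NormedSpace 𝕜 V]
  [FiniteDimensional 𝕜 V]

variable (𝕜 V) in
/-- Bilinear operations on a normed space. -/
abbrev BilOp := V →L[𝕜] V →L[𝕜] V

/-- Isomorphism of bilinear operations by linear maps commuting with `E`. -/
def IsoBy (E : V →L[𝕜] V) (φ ψ : BilOp 𝕜 V) : Prop :=
  ∃ A : V ≃ₗ[𝕜] V, (∀ x, A (E x) = E (A x)) ∧ ∀ x y, A (φ x y) = ψ (A x) (A y)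

/-- A Lie bracket for which `E` is a derivation. -/
structure IsBracket (E : V →L[𝕜] V) (φ : BilOp 𝕜 V) : Prop where
  alt : ∀ x, φ x x = 0
  jac : ∀ x y z, φ x (φ y z) = φ (φ x y) z + φ y (φ x z)
  der : ∀ x y, E (φ x y) = φ (E x) y + φ x (E y)

omit [FiniteDimensional 𝕜 V] in
lemma IsoBy.symm {E : V →L[𝕜] V} {φ ψ : BilOp 𝕜 V} (h : IsoBy E φ ψ) : IsoBy E ψ φ := by
  obtain ⟨A, h1, h2⟩ := h
  refine ⟨A.symm, fun x ↦ A.injective ?_, fun x y ↦ A.injective ?_⟩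
  · simp [h1]
  · simp [h2]

omit [FiniteDimensional 𝕜 V] in
lemma IsoBy.trans {E : V →L[𝕜] V} {φ ψ χ : BilOp 𝕜 V} (h : IsoBy E φ ψ) (h' : IsoBy E ψ χ) :
    IsoBy E φ χ := by
  obtain ⟨A, h1, h2⟩ := h
  obtain ⟨A', h1', h2'⟩ := h'
  exact ⟨A.trans A', fun x ↦ by simp [h1, h1'], fun x y ↦ by simp [h2, h2']⟩

omit [FiniteDimensional 𝕜 V] in
lemma IsBracket.of_isoBy {E : V →L[𝕜] V} {φ ψ : BilOp 𝕜 V} (hφ : IsBracket E φ)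
    (h : IsoBy E φ ψ) : IsBracket E ψ := by
  obtain ⟨A, h1, h2⟩ := h
  refine ⟨fun x ↦ ?_, fun x y z ↦ ?_, fun x y ↦ ?_⟩
  · obtain ⟨x, rfl⟩ := A.surjective x
    rw [← h2, hφ.alt, map_zero]
  · obtain ⟨x, rfl⟩ := A.surjective x
    obtain ⟨y, rfl⟩ := A.surjective y
    obtain ⟨z, rfl⟩ := A.surjective z
    simp only [← h2, ← map_add, hφ.jac x y z]
  · obtain ⟨x, rfl⟩ := A.surjective x
    obtain ⟨y, rfl⟩ := A.surjective y
    simp only [← h2, ← h1, ← map_add, hφ.der x y]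

/-- The action of `exp s` on bilinear operations. -/
def twist (φ : BilOp 𝕜 V) (s : V →L[𝕜] V) : BilOp 𝕜 V :=
  (ContinuousLinearMap.compL 𝕜 V V V (exp s)) ∘L (φ.bilinearComp (exp (-s)) (exp (-s)))

omit [FiniteDimensional 𝕜 V] in
lemma twist_apply (φ : BilOp 𝕜 V) (s : V →L[𝕜] V) (x y : V) :
    twist φ s x y = exp s (φ (exp (-s) x) (exp (-s) y)) := rfl

lemma exp_mul_exp_neg (s : V →L[𝕜] V) : exp s * exp (-s) = 1 := by
  let := NormedAlgebra.restrictScalars ℚ 𝕜 (V →L[𝕜] V)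
  have := FiniteDimensional.complete 𝕜 (V →L[𝕜] V)
  rw [← exp_add_of_commute (Commute.neg_right (Commute.refl s)), add_neg_cancel, exp_zero]

/-- `exp s` as a linear automorphism. -/
def expEquiv (s : V →L[𝕜] V) : V ≃ₗ[𝕜] V :=
  LinearEquiv.ofLinearMap (exp s : V →L[𝕜] V) (exp (-s) : V →L[𝕜] V)
    (LinearMap.ext fun x ↦ congrArg (fun f : V →L[𝕜] V ↦ f x) (exp_mul_exp_neg s))
    (LinearMap.ext fun x ↦ congrArg (fun f : V →L[𝕜] V ↦ f x) (by
      simpa using exp_mul_exp_neg (-s)))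

lemma isoBy_twist {E : V →L[𝕜] V} (φ : BilOp 𝕜 V) {s : V →L[𝕜] V} (hs : Commute E s) :
    IsoBy E φ (twist φ s) := by
  refine ⟨expEquiv s, fun x ↦ ?_, fun x y ↦ ?_⟩
  · exact congrArg (fun f : V →L[𝕜] V ↦ f x) hs.exp_right.eq.symm
  · rw [twist_apply]
    have h : ∀ x, exp (-s) (expEquiv s x) = x := (expEquiv s).symm_apply_apply
    rw [h, h]; rfl

lemma contDiffAt_twist (φ : BilOp 𝕜 V) (s : V →L[𝕜] V) : ContDiffAt 𝕜 1 (twist φ) s := by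
  have := FiniteDimensional.complete 𝕜 (V →L[𝕜] V)
  have hexp : ∀ s, ContDiffAt 𝕜 1 (fun s : V →L[𝕜] V ↦ exp s) s := fun s ↦
    (exp_analytic (𝕂 := 𝕜) s).contDiffAt
  have h : ContDiff 𝕜 1 (fun s : V →L[𝕜] V ↦ exp s) := contDiff_iff_contDiffAt.2 hexp
  have h' : ContDiff 𝕜 1 (fun s : V →L[𝕜] V ↦ exp (-s)) := h.comp contDiff_neg
  refine ContDiff.contDiffAt (contDiff_clm_apply_iff.2 fun x ↦ contDiff_clm_apply_iff.2 fun y ↦ ?_)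
  simp only [twist_apply]
  have h1 : ContDiff 𝕜 1 (fun s : V →L[𝕜] V ↦ φ (exp (-s) x)) :=
    φ.contDiff.comp (h'.clm_apply contDiff_const)
  exact h.clm_apply (h1.clm_apply (h'.clm_apply contDiff_const))

/-- The derivative of the action of `exp s` at `s = 0`. -/
lemma hasDerivAt_twist (φ : BilOp 𝕜 V) (s : V →L[𝕜] V) (x y : V) :
    HasDerivAt (fun t : 𝕜 ↦ twist φ (t • s) x y) (s (φ x y) - φ (s x) y - φ x (s y)) 0 := by
  have := FiniteDimensional.complete 𝕜 (V →L[𝕜] V)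
  have h0 : HasFDerivAt (fun s : V →L[𝕜] V ↦ exp s) (1 : (V →L[𝕜] V) →L[𝕜] _) ((0 : 𝕜) • s) := by
    rw [zero_smul]; exact hasFDerivAt_exp_zero
  have h1 : HasDerivAt (fun t : 𝕜 ↦ exp (t • s)) s 0 := by
    have := h0.comp_hasDerivAt (0 : 𝕜) ((hasDerivAt_id (0 : 𝕜)).smul_const s)
    simpa [Function.comp_def] using this
  have h2 : HasDerivAt (fun t : 𝕜 ↦ exp (-(t • s))) (-s) 0 := by
    have h0' : HasFDerivAt (fun s : V →L[𝕜] V ↦ exp s) (1 : (V →L[𝕜] V) →L[𝕜] _)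
      ((0 : 𝕜) • (-s)) := by rw [zero_smul]; exact hasFDerivAt_exp_zero
    have := h0'.comp_hasDerivAt (0 : 𝕜) ((hasDerivAt_id (0 : 𝕜)).smul_const (-s))
    simpa [Function.comp_def] using this
  have h3 := h2.clm_apply (hasDerivAt_const (0 : 𝕜) x)
  have h4 := h2.clm_apply (hasDerivAt_const (0 : 𝕜) y)
  have h5 := h1.clm_apply ((φ.hasFDerivAt.comp_hasDerivAt (0 : 𝕜) h3).clm_apply h4)
  refine h5.congr_deriv ?_
  simp
  abel

/-- The linearised Jacobi identity, evaluated on basis vectors. -/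
def jacLin {ι : Type*} [Fintype ι] (b : Module.Basis ι 𝕜 V) (φ ψ : BilOp 𝕜 V) :
    BilOp 𝕜 V →L[𝕜] ι → ι → ι → V :=
  LinearMap.toContinuousLinearMap
    { toFun w i j k := φ (b i) (w (b j) (b k)) - φ (w (b i) (b j)) (b k) - φ (b j) (w (b i) (b k))
        + (w (b i) (ψ (b j) (b k)) - w (ψ (b i) (b j)) (b k) - w (b j) (ψ (b i) (b k)))
      map_add' w w' := by ext i j k; simp; abel
      map_smul' c w := by ext i j k; simp [smul_sub] }

lemma continuous_jacLin {ι : Type*} [Fintype ι] (b : Module.Basis ι 𝕜 V) :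
    Continuous (fun p : BilOp 𝕜 V × BilOp 𝕜 V ↦ jacLin b p.1 p.2) := by
  refine continuous_clm_apply.2 fun w ↦ ?_
  refine continuous_pi fun i ↦ continuous_pi fun j ↦ continuous_pi fun k ↦ ?_
  change Continuous fun p : BilOp 𝕜 V × BilOp 𝕜 V ↦
    p.1 (b i) (w (b j) (b k)) - p.1 (w (b i) (b j)) (b k) - p.1 (b j) (w (b i) (b k))
        + (w (b i) (p.2 (b j) (b k)) - w (p.2 (b i) (b j)) (b k) - w (b j) (p.2 (b i) (b k)))
  fun_prop

/-- The expression is linear in each of `x`, `y`, `z`, so the basis vectors can be replaced by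
arbitrary vectors one slot at a time. -/
lemma jacLin_eq_zero {ι : Type*} [Fintype ι] (b : Module.Basis ι 𝕜 V) {φ ψ w : BilOp 𝕜 V}
    (h : jacLin b φ ψ w = 0) (x y z : V) :
    φ x (w y z) - φ (w x y) z - φ y (w x z)
      + (w x (ψ y z) - w (ψ x y) z - w y (ψ x z)) = 0 := by
  have key : ∀ i j k, φ (b i) (w (b j) (b k)) - φ (w (b i) (b j)) (b k) - φ (b j) (w (b i) (b k))
        + (w (b i) (ψ (b j) (b k)) - w (ψ (b i) (b j)) (b k) - w (b j) (ψ (b i) (b k))) = 0 :=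
    fun i j k ↦ congrFun (congrFun (congrFun h i) j) k
  have h1 : ∀ i j z, φ (b i) (w (b j) z) - φ (w (b i) (b j)) z - φ (b j) (w (b i) z)
        + (w (b i) (ψ (b j) z) - w (ψ (b i) (b j)) z - w (b j) (ψ (b i) z)) = 0 := fun i j z ↦ by
    have : (φ (b i) ∘L w (b j) - φ (w (b i) (b j)) - φ (b j) ∘L w (b i)
        + (w (b i) ∘L ψ (b j) - w (ψ (b i) (b j)) - w (b j) ∘L ψ (b i))).toLinearMap = 0 :=
      b.ext (key i j)
    exact congrArg (fun f : V →ₗ[𝕜] V ↦ f z) this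
  have h2 : ∀ i y z, φ (b i) (w y z) - φ (w (b i) y) z - φ y (w (b i) z)
        + (w (b i) (ψ y z) - w (ψ (b i) y) z - w y (ψ (b i) z)) = 0 := fun i y z ↦ by
    have : (φ (b i) ∘L w.flip z - φ.flip z ∘L w (b i) - φ.flip (w (b i) z)
        + (w (b i) ∘L ψ.flip z - w.flip z ∘L ψ (b i) - w.flip (ψ (b i) z))).toLinearMap = 0 :=
      b.ext fun j ↦ h1 i j z
    exact congrArg (fun f : V →ₗ[𝕜] V ↦ f y) this
  have : (φ.flip (w y z) - φ.flip z ∘L w.flip y - φ y ∘L w.flip z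
      + (w.flip (ψ y z) - w.flip z ∘L ψ.flip y - w y ∘L ψ.flip z)).toLinearMap = 0 :=
    b.ext fun i ↦ h2 i y z
  exact congrArg (fun f : V →ₗ[𝕜] V ↦ f x) this

/-- A transversal slice `W` to the orbit of a bilinear operation under the linear automorphisms
commuting with `E`. -/
lemma exists_slice (E : V →L[𝕜] V) (φ₀ : BilOp 𝕜 V) :
    ∃ W : Submodule 𝕜 (BilOp 𝕜 V),
      (∀ s : V →L[𝕜] V, Commute E s → ∀ w ∈ W,
        (∀ x y, w x y = s (φ₀ x y) - φ₀ (s x) y - φ₀ x (s y)) → w = 0) ∧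
      ∀ p : BilOp 𝕜 V → BilOp 𝕜 V → Prop, (∀ᶠ q in 𝓝 (φ₀, φ₀), p q.1 q.2) →
        ∀ᶠ φ in 𝓝 φ₀, ∃ s : V →L[𝕜] V, Commute E s ∧ φ - twist φ₀ s ∈ W ∧ p φ (twist φ₀ s) := by
  -- `X` is the Lie algebra of the group of automorphisms commuting with `E`, `δ` is the derivative
  -- of its orbit map at the identity, and `W` below is any complement of the tangent space to the
  -- orbit.
  let X : Submodule 𝕜 (V →L[𝕜] V) :=
    { carrier := {s | Commute E s}
      add_mem' := fun h h' ↦ h.add_right h'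
      zero_mem' := Commute.zero_right E
      smul_mem' := fun c s h ↦ h.smul_right c }
  let δ : X →L[𝕜] BilOp 𝕜 V := (fderiv 𝕜 (twist φ₀) 0) ∘L X.subtypeL
  have hδ : ∀ (s : X) (x y : V), δ s x y = s.1 (φ₀ x y) - φ₀ (s.1 x) y - φ₀ x (s.1 y) := by
    intro s x y
    have h1 : HasFDerivAt (twist φ₀) (fderiv 𝕜 (twist φ₀) 0) ((0 : 𝕜) • s.1) := by
      rw [zero_smul]
      exact ((contDiffAt_twist φ₀ 0).differentiableAt (by simp)).hasFDerivAt
    have h2 := h1.comp_hasDerivAt (0 : 𝕜) ((hasDerivAt_id (0 : 𝕜)).smul_const s.1)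
    have h3 := (h2.clm_apply (hasDerivAt_const (0 : 𝕜) x)).clm_apply (hasDerivAt_const (0 : 𝕜) y)
    have h4 := h3.unique (hasDerivAt_twist φ₀ s.1 x y)
    simpa [δ] using h4
  obtain ⟨W, hW⟩ := Submodule.exists_isCompl (LinearMap.range δ.toLinearMap)
  refine ⟨W, fun s hs w hwW hw ↦ ?_, fun p hp ↦ ?_⟩
  · have : w ∈ LinearMap.range δ.toLinearMap ⊓ W :=
      ⟨⟨⟨s, hs⟩, by ext x y; exact (hδ ⟨s, hs⟩ x y).trans (hw x y).symm⟩, hwW⟩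
    rwa [hW.inf_eq_bot, Submodule.mem_bot] at this
  -- The derivative of `f` at `0` is onto, so `f` maps neighbourhoods of `0` onto neighbourhoods of
  -- `φ₀`. Every `φ` near `φ₀` is thus `twist φ₀ s + w` with `s` and `w` small, and open conditions
  -- on pairs of operations near `(φ₀, φ₀)` hold for `(φ, twist φ₀ s)`.
  let f : X × W → BilOp 𝕜 V := fun p ↦ twist φ₀ p.1.1 + p.2.1
  have hf0 : f 0 = φ₀ := by
    ext x y
    simp [f, twist_apply, exp_zero]
  have hf : HasStrictFDerivAt f (δ.coprod W.subtypeL) 0 := by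
    have h1 : HasStrictFDerivAt (twist φ₀) (fderiv 𝕜 (twist φ₀) 0)
        ((X.subtypeL ∘L ContinuousLinearMap.fst 𝕜 X W) (0 : X × W)) := by
      rw [map_zero]
      exact (contDiffAt_twist φ₀ 0).hasStrictFDerivAt (by simp)
    have h2 := (h1.comp (0 : X × W)
      (X.subtypeL ∘L ContinuousLinearMap.fst 𝕜 X W).hasStrictFDerivAt).add
      (W.subtypeL ∘L ContinuousLinearMap.snd 𝕜 X W).hasStrictFDerivAt
    exact h2.congr_fderiv (ContinuousLinearMap.ext fun p ↦ rfl)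
  have surj : (δ.coprod W.subtypeL).range = ⊤ := by
    rw [eq_top_iff]
    intro w _
    obtain ⟨u, hu, v, hv, rfl⟩ := Submodule.mem_sup.1 (hW.sup_eq_top ▸ Submodule.mem_top : w ∈ _)
    obtain ⟨s, rfl⟩ := hu
    exact ⟨(s, ⟨v, hv⟩), by simp⟩
  have := FiniteDimensional.complete 𝕜 X
  have := FiniteDimensional.complete 𝕜 W
  have := FiniteDimensional.complete 𝕜 (BilOp 𝕜 V)
  have hmap := hf.map_nhds_eq_of_surj surj
  rw [hf0] at hmap
  rw [← hmap, eventually_map]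
  have hcont : Tendsto (fun p : X × W ↦ (f p, twist φ₀ p.1.1)) (𝓝 0) (𝓝 (φ₀, φ₀)) := by
    have h1 : ContinuousAt f 0 := hf.continuousAt
    have h2 : ContinuousAt (fun p : X × W ↦ f p - p.2.1) 0 :=
      h1.sub (by fun_prop)
    have h3 := h1.prodMk h2
    rw [ContinuousAt] at h3
    simpa [hf0, f] using h3
  filter_upwards [hcont.eventually hp] with q hq
  exact ⟨q.1.1, q.1.2, by simp [f], hq⟩

/-- Lie brackets with nondegenerate trace form are rigid: all nearby brackets are isomorphic. -/
theorem IsBracket.eventually_isoBy {E : V →L[𝕜] V} {φ₀ : BilOp 𝕜 V} (h₀ : IsBracket E φ₀)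
    (nd : ∀ x, (∀ y, trForm φ₀.toLinearMap₁₂ x y = 0) → x = 0) :
    ∀ᶠ φ in 𝓝 φ₀, IsBracket E φ → IsoBy E φ₀ φ := by
  let b := Module.finBasis 𝕜 V
  obtain ⟨W, hW, hslice⟩ := exists_slice E φ₀
  let Y : Submodule 𝕜 (BilOp 𝕜 V) :=
    { carrier := {w | (∀ x, w x x = 0) ∧ ∀ x y, E (w x y) = w (E x) y + w x (E y)}
      add_mem' := fun h h' ↦ ⟨fun x ↦ by simp [h.1, h'.1], fun x y ↦ by simp [h.2, h'.2]; abel⟩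
      zero_mem' := by simp
      smul_mem' := fun c s h ↦ ⟨fun x ↦ by simp [h.1], fun x y ↦ by simp [h.2]⟩ }
  -- the linearised Jacobi identity is injective on the slice
  let J : BilOp 𝕜 V × BilOp 𝕜 V → ((W ⊓ Y : Submodule 𝕜 (BilOp 𝕜 V)) →L[𝕜] _) := fun p ↦
    jacLin b p.1 p.2 ∘L (W ⊓ Y).subtypeL
  have hJ0 : Function.Injective (J (φ₀, φ₀)) := by
    rw [injective_iff_map_eq_zero]
    rintro ⟨w, hwW, hwY⟩ hw
    have hw' : ∀ x y z, φ₀ x (w y z) - w (φ₀ x y) z - φ₀ y (w x z)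
        + (w x (φ₀ y z) - φ₀ (w x y) z - w y (φ₀ x z)) = 0 := fun x y z ↦ by
      rw [← jacLin_eq_zero b (show jacLin b φ₀ φ₀ w = 0 from hw) x y z]
      abel
    -- A cocycle in `W` that commutes with `E` has a primitive that commutes with `E`. It is
    -- therefore tangent to the orbit and vanishes by transversality.
    obtain ⟨s, hs, hs'⟩ := exists_primitive_of_cocycle (br := φ₀.toLinearMap₁₂) h₀.alt h₀.jac nd
      (w := w.toLinearMap₁₂) hwY.1 hw'
    have hsE := hs' E.toLinearMap h₀.der hwY.2
    refine Subtype.ext (hW (LinearMap.toContinuousLinearMap s) ?_ w hwW hs)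
    ext x
    exact congrArg (fun f : V →ₗ[𝕜] V ↦ f x) hsE
  have hJc : Continuous J := continuous_clm_apply.2 fun w ↦
    (continuous_jacLin b).clm_apply continuous_const
  have hev : ∀ᶠ p in 𝓝 (φ₀, φ₀), Function.Injective (J p) :=
    hJc.continuousAt.eventually_mem (ContinuousLinearMap.isOpen_injective.mem_nhds hJ0)
  filter_upwards [hslice (fun φ ψ ↦ Function.Injective (J (φ, ψ))) hev] with φ hex hφ
  obtain ⟨s, hs, hsW, hinj⟩ := hex
  have hψ : IsBracket E (twist φ₀ s) := h₀.of_isoBy (isoBy_twist φ₀ hs)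
  have hwY : φ - twist φ₀ s ∈ Y :=
    ⟨fun x ↦ by simp [hφ.alt, hψ.alt], fun x y ↦ by simp [hφ.der, hψ.der]; abel⟩
  -- For two brackets `φ`, `ψ` and `w = φ - ψ`, the expression `jacLin φ ψ w` is exactly the
  -- difference of their Jacobi expressions, without remainder: `φ(x, w(y, z)) + w(x, ψ(y, z))`
  -- telescopes. Both satisfy Jacobi, so injectivity, an open condition on the pair, gives `w = 0`.
  have : (⟨φ - twist φ₀ s, hsW, hwY⟩ : (W ⊓ Y : Submodule 𝕜 (BilOp 𝕜 V))) = 0 := by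
    apply hinj
    rw [map_zero]
    ext i j k
    have e1 := hφ.jac (b i) (b j) (b k)
    have e2 := hψ.jac (b i) (b j) (b k)
    change φ (b i) ((φ - twist φ₀ s) (b j) (b k)) - φ ((φ - twist φ₀ s) (b i) (b j)) (b k)
      - φ (b j) ((φ - twist φ₀ s) (b i) (b k)) + ((φ - twist φ₀ s) (b i) (twist φ₀ s (b j) (b k))
      - (φ - twist φ₀ s) (twist φ₀ s (b i) (b j)) (b k)
      - (φ - twist φ₀ s) (b j) (twist φ₀ s (b i) (b k))) = (0 : V)
    simp only [sub_apply, map_sub, e1, e2]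
    abel
  rw [sub_eq_zero.1 (congrArg Subtype.val this)]
  exact isoBy_twist φ₀ hs

end Rigidity

/-! ### Minimal vectors in the orbit of a semisimple bracket -/

section Minimal

open NormedSpace Filter Topology

/-! ### The discriminant and closedness of orbits -/

section Discriminant

variable {𝕜 : Type*} [RCLike 𝕜] {V : Type*} [NormedAddCommGroup V] [NormedSpace 𝕜 V]
  [FiniteDimensional 𝕜 V]

/-- The discriminant of the trace form of a bilinear operation. -/
def disc (φ : BilOp 𝕜 V) : 𝕜 :=
  (LinearMap.BilinForm.toMatrix (Module.finBasis 𝕜 V) (trForm φ.toLinearMap₁₂)).det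

lemma continuous_disc : Continuous (disc : BilOp 𝕜 V → 𝕜) := by
  refine Continuous.matrix_det (continuous_matrix fun i j ↦ ?_)
  simp only [LinearMap.BilinForm.toMatrix_apply, trForm_apply]
  let tr : (V →L[𝕜] V) →L[𝕜] 𝕜 :=
    LinearMap.toContinuousLinearMap (LinearMap.trace 𝕜 V ∘ₗ ContinuousLinearMap.coeLM 𝕜)
  let b := Module.finBasis 𝕜 V
  have h : Continuous fun φ : BilOp 𝕜 V ↦ tr (φ (b i) ∘L φ (b j)) :=
    tr.continuous.comp ((ContinuousLinearMap.apply 𝕜 _ (b i)).continuous.clm_comp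
      (ContinuousLinearMap.apply 𝕜 _ (b j)).continuous)
  exact h

lemma nondegenerate_of_disc_ne_zero {φ : BilOp 𝕜 V} (h : disc φ ≠ 0) (x : V)
    (hx : ∀ y, trForm φ.toLinearMap₁₂ x y = 0) : x = 0 :=
  ((LinearMap.BilinForm.nondegenerate_iff_det_ne_zero _).2 h).1 x hx

lemma disc_ne_zero {φ : BilOp 𝕜 V} (h : ∀ x, (∀ y, trForm φ.toLinearMap₁₂ x y = 0) → x = 0) :
    disc φ ≠ 0 :=
  (LinearMap.BilinForm.nondegenerate_iff_det_ne_zero _).1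
    ⟨h, fun y hy ↦ h y fun x ↦ by rw [trForm_symm, hy]⟩

omit [FiniteDimensional 𝕜 V] in
lemma trForm_map {φ ψ : BilOp 𝕜 V} (A : V ≃ₗ[𝕜] V) (hA : ∀ x y, A (φ x y) = ψ (A x) (A y))
    (x y : V) : trForm ψ.toLinearMap₁₂ (A x) (A y) = trForm φ.toLinearMap₁₂ x y := by
  rw [trForm_apply, trForm_apply, 
    ← LinearMap.trace_conj' (φ.toLinearMap₁₂ x ∘ₗ φ.toLinearMap₁₂ y) A]
  congr 1
  ext z
  simp [LinearEquiv.conj_apply, hA]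

/-- The trace form of `φ` is the pullback of that of `ψ` along `A`, so its Gram determinant changes
by `det A ^ 2`. Automorphisms of determinant one thus keep the discriminant. -/
lemma disc_map {φ ψ : BilOp 𝕜 V} (A : V ≃ₗ[𝕜] V) (hA : ∀ x y, A (φ x y) = ψ (A x) (A y)) :
    disc φ = LinearMap.det A.toLinearMap ^ 2 * disc ψ := by
  have : trForm φ.toLinearMap₁₂ =
      LinearMap.BilinForm.comp (trForm ψ.toLinearMap₁₂) A.toLinearMap A.toLinearMap := by
    ext x y
    exact (trForm_map A hA x y).symm
  rw [disc, this, LinearMap.BilinForm.toMatrix_comp (Module.finBasis 𝕜 V), Matrix.det_mul,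
    Matrix.det_mul, Matrix.det_transpose, LinearMap.det_toMatrix, disc]
  ring

/-- The orbit of a bracket under the linear automorphisms commuting with `E` which preserve the
modulus of the discriminant. -/
def orbitSet (E : V →L[𝕜] V) (φ : BilOp 𝕜 V) : Set (BilOp 𝕜 V) :=
  {ψ | IsoBy E φ ψ ∧ ‖disc ψ‖ = ‖disc φ‖}

/-- A limit of the orbit is again a bracket with the same modulus of discriminant, so its trace form
is nondegenerate and it is rigid. Orbit elements close to it are then isomorphic to it. Fixing the
modulus is essential: scalar automorphisms would otherwise drive brackets to zero. -/
lemma isClosed_orbitSet {E : V →L[𝕜] V} {φ : BilOp 𝕜 V} (hφ : IsBracket E φ)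
    (hd : disc φ ≠ 0) : IsClosed (orbitSet E φ) := by
  rw [← closure_subset_iff_isClosed]
  intro ψ hψ
  have hL : IsClosed {ψ : BilOp 𝕜 V | IsBracket E ψ ∧ ‖disc ψ‖ = ‖disc φ‖} := by
    have h1 : {ψ : BilOp 𝕜 V | IsBracket E ψ ∧ ‖disc ψ‖ = ‖disc φ‖} =
        {ψ | ∀ x, ψ x x = 0} ∩ {ψ | ∀ x y z, ψ x (ψ y z) = ψ (ψ x y) z + ψ y (ψ x z)} ∩
          {ψ | ∀ x y, E (ψ x y) = ψ (E x) y + ψ x (E y)} ∩ {ψ | ‖disc ψ‖ = ‖disc φ‖} := by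
      ext ψ
      exact ⟨fun h ↦ ⟨⟨⟨h.1.alt, h.1.jac⟩, h.1.der⟩, h.2⟩,
        fun h ↦ ⟨⟨h.1.1.1, h.1.1.2, h.1.2⟩, h.2⟩⟩
    rw [h1]
    refine ((IsClosed.inter ?_ ?_).inter ?_).inter
      (isClosed_eq continuous_disc.norm continuous_const)
    · simp only [Set.ofPred_forall]
      exact isClosed_iInter fun x ↦ isClosed_eq (by fun_prop) continuous_const
    · simp only [Set.ofPred_forall]
      exact isClosed_iInter fun x ↦ isClosed_iInter fun y ↦ isClosed_iInter fun z ↦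
        isClosed_eq (by fun_prop) (by fun_prop)
    · simp only [Set.ofPred_forall]
      exact isClosed_iInter fun x ↦ isClosed_iInter fun y ↦ isClosed_eq (by fun_prop) (by fun_prop)
  have hsub : orbitSet E φ ⊆ {ψ : BilOp 𝕜 V | IsBracket E ψ ∧ ‖disc ψ‖ = ‖disc φ‖} :=
    fun χ hχ ↦ ⟨hφ.of_isoBy hχ.1, hχ.2⟩
  obtain ⟨hψ1, hψ2⟩ := closure_minimal hsub hL hψ
  have hd' : disc ψ ≠ 0 := by
    rw [← norm_ne_zero_iff, hψ2]; exact norm_ne_zero_iff.2 hd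
  have hev := hψ1.eventually_isoBy (nondegenerate_of_disc_ne_zero hd')
  obtain ⟨χ, hχ, hχ'⟩ := ((mem_closure_iff_frequently.1 hψ).and_eventually hev).exists
  exact ⟨hχ.1.trans (hχ' (hφ.of_isoBy hχ.1)).symm, hψ2⟩

end Discriminant

variable {𝕜 : Type*} [RCLike 𝕜] {V : Type*} [NormedAddCommGroup V] [InnerProductSpace 𝕜 V]
  [FiniteDimensional 𝕜 V] [CompleteSpace V]

local notation "⟪" x ", " y "⟫" => inner 𝕜 x y

variable (𝕜 V) in
/-- The norm squared of a bilinear operation in an orthonormal basis. -/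
def normSq (φ : BilOp 𝕜 V) : ℝ :=
  ∑ i, ∑ j, ‖φ (stdOrthonormalBasis 𝕜 V i) (stdOrthonormalBasis 𝕜 V j)‖ ^ 2

/-- A bilinear operation is determined by its values on basis pairs, so `normSq` is coercive and
attains its minimum on the closed orbit. -/
lemma exists_isMinOn_normSq {E : V →L[𝕜] V} {φ : BilOp 𝕜 V} (hφ : IsBracket E φ)
    (hd : disc φ ≠ 0) : ∃ ψ ∈ orbitSet E φ, IsMinOn (normSq 𝕜 V) (orbitSet E φ) ψ := by
  let b := stdOrthonormalBasis 𝕜 V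
  have hcont : Continuous (normSq 𝕜 V) := by unfold normSq; fun_prop
  have hφ' : φ ∈ orbitSet E φ := ⟨⟨LinearEquiv.refl 𝕜 V, fun _ ↦ rfl, fun _ _ ↦ rfl⟩, rfl⟩
  refine hcont.continuousOn.exists_isMinOn' (isClosed_orbitSet hφ hd) hφ' ?_
  refine Eventually.filter_mono inf_le_left ?_
  let Λ : BilOp 𝕜 V →ₗ[𝕜] (Fin (Module.finrank 𝕜 V) → Fin (Module.finrank 𝕜 V) → V) :=
    { toFun φ i j := φ (b i) (b j)
      map_add' _ _ := rfl
      map_smul' _ _ := rfl }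
  have hΛ : LinearMap.ker Λ = ⊥ := by
    rw [LinearMap.ker_eq_bot']
    intro ψ hψ
    have h1 : ∀ i, (ψ (b i)).toLinearMap = 0 := fun i ↦
      b.toBasis.ext fun j ↦ by
        rw [OrthonormalBasis.coe_toBasis]
        exact congrFun (congrFun hψ i) j
    have h2 : ∀ y, (ψ.flip y).toLinearMap = 0 := fun y ↦
      b.toBasis.ext fun i ↦ by simpa using congrArg (fun f : V →ₗ[𝕜] V ↦ f y) (h1 i)
    ext x y
    exact congrArg (fun f : V →ₗ[𝕜] V ↦ f x) (h2 y)
  have := FiniteDimensional.proper 𝕜 (Fin (Module.finrank 𝕜 V) → Fin (Module.finrank 𝕜 V) → V)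
  have ht := tendsto_norm_cocompact_atTop.comp
    (LinearMap.isClosedEmbedding_of_injective hΛ).tendsto_cocompact
  have hpos : ∀ ψ : BilOp 𝕜 V, 0 ≤ normSq 𝕜 V ψ := fun ψ ↦ by unfold normSq; positivity
  -- If `normSq ψ < normSq φ`, every entry of `ψ` is bounded by `√(normSq φ)`, which fails outside a
  -- compact set.
  filter_upwards [ht.eventually_gt_atTop (Real.sqrt (normSq 𝕜 V φ))] with ψ hψ
  by_contra! hlt
  refine absurd hψ (not_lt.2 ?_)
  refine (pi_norm_le_iff_of_nonneg (Real.sqrt_nonneg _)).2 fun i ↦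
    (pi_norm_le_iff_of_nonneg (Real.sqrt_nonneg _)).2 fun j ↦ Real.le_sqrt_of_sq_le ?_
  refine le_trans ?_ hlt.le
  refine le_trans ?_ (Finset.single_le_sum (f := fun i ↦ ∑ j, ‖ψ (b i) (b j)‖ ^ 2)
    (fun _ _ ↦ by positivity) (Finset.mem_univ i))
  exact Finset.single_le_sum (f := fun j ↦ ‖ψ (b i) (b j)‖ ^ 2)
    (fun _ _ ↦ by positivity) (Finset.mem_univ j)

/-- `det (exp s) = 1` if `s` is symmetric of trace zero. -/
lemma det_exp_eq_one {s : V →L[𝕜] V} (hs : s.toLinearMap.IsSymmetric)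
    (htr : LinearMap.trace 𝕜 V s.toLinearMap = 0) :
    LinearMap.det (exp s : V →L[𝕜] V).toLinearMap = 1 := by
  have := FiniteDimensional.complete 𝕜 (V →L[𝕜] V)
  let b := hs.eigenvectorBasis rfl
  let μ : Fin (Module.finrank 𝕜 V) → 𝕜 := fun i ↦ hs.eigenvalues rfl i
  have hb : ∀ i, s (b i) = μ i • b i := hs.apply_eigenvectorBasis rfl
  have hpow : ∀ i (n : ℕ), (s ^ n) (b i) = μ i ^ n • b i := fun i n ↦ by
    induction n with
    | zero => simp
    | succ n ih => rw [pow_succ, mul_apply_eq_comp, hb, map_smul, ih, smul_smul, pow_succ']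
  have hexp : ∀ i, exp s (b i) = exp (μ i) • b i := fun i ↦ by
    have h1 := (exp_series_hasSum_exp' (𝕂 := 𝕜) s).mapL (ContinuousLinearMap.apply 𝕜 V (b i))
    have h2 := (exp_series_hasSum_exp' (𝕂 := 𝕜) (μ i)).smul_const (b i)
    refine h1.unique (h2.congr_fun ?_)
    intro n
    simp [hpow, smul_smul]
  have htr' : ∑ i, μ i = 0 := by
    rw [← htr, LinearMap.trace_eq_sum_inner s.toLinearMap b]
    refine Finset.sum_congr rfl fun i _ ↦ ?_
    change _ = ⟪b i, s (b i)⟫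
    rw [hb, inner_smul_right, inner_self_eq_norm_sq_to_K, b.norm_eq_one]
    simp
  have hmat : LinearMap.toMatrix b.toBasis b.toBasis (exp s : V →L[𝕜] V).toLinearMap =
      Matrix.diagonal fun i ↦ exp (μ i) := by
    ext i j
    rw [LinearMap.toMatrix_apply, OrthonormalBasis.coe_toBasis, ContinuousLinearMap.coe_coe, hexp]
    by_cases h : i = j
    · simp [h]
    · simp [h]
  let _ : NormedAlgebra ℚ 𝕜 := NormedAlgebra.restrictScalars ℚ 𝕜 𝕜
  rw [← LinearMap.det_toMatrix b.toBasis, hmat, Matrix.det_diagonal, ← exp_sum, htr', exp_zero]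

/-- The infinitesimal action of `𝔤𝔩(V)` on bilinear operations. -/
def infAct (D : V →L[𝕜] V) (φ : BilOp 𝕜 V) : BilOp 𝕜 V :=
  (ContinuousLinearMap.compL 𝕜 V V V D) ∘L φ - φ.bilinearComp D (ContinuousLinearMap.id 𝕜 V)
    - φ.bilinearComp (ContinuousLinearMap.id 𝕜 V) D

lemma infAct_apply (D : V →L[𝕜] V) (φ : BilOp 𝕜 V) (x y : V) :
    infAct D φ x y = D (φ x y) - φ (D x) y - φ x (D y) := rfl

/-- The inner product of bilinear operations. -/
def ip (φ ψ : BilOp 𝕜 V) : 𝕜 :=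
  ∑ i, ∑ j, ⟪φ (stdOrthonormalBasis 𝕜 V i) (stdOrthonormalBasis 𝕜 V j),
    ψ (stdOrthonormalBasis 𝕜 V i) (stdOrthonormalBasis 𝕜 V j)⟫

/-- Both sides are traces, of `D ∘ a^* ∘ c` and `a^* ∘ c ∘ D`, so they agree by cyclicity. -/
lemma sum_inner_adjoint {ι : Type*} [Fintype ι] (b : OrthonormalBasis ι 𝕜 V) (D a c : V →L[𝕜] V) :
    ∑ i, ⟪a (D.adjoint (b i)), c (b i)⟫ = ∑ i, ⟪a (b i), c (D (b i))⟫ := by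
  have h1 := LinearMap.trace_eq_sum_inner (D.toLinearMap * (a.adjoint ∘L c).toLinearMap) b
  have h2 := LinearMap.trace_eq_sum_inner ((a.adjoint ∘L c).toLinearMap * D.toLinearMap) b
  rw [LinearMap.trace_mul_comm, h2] at h1
  refine Eq.trans ?_ (h1.symm.trans ?_)
  · refine Finset.sum_congr rfl fun i _ ↦ ?_
    change _ = ⟪b i, D (a.adjoint (c (b i)))⟫
    rw [← ContinuousLinearMap.adjoint_inner_left D, ContinuousLinearMap.adjoint_inner_right]
  · refine Finset.sum_congr rfl fun i _ ↦ ?_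
    change ⟪b i, a.adjoint (c (D (b i)))⟫ = _
    rw [ContinuousLinearMap.adjoint_inner_right]

lemma ip_infAct (D : V →L[𝕜] V) (φ ψ : BilOp 𝕜 V) :
    ip (infAct D.adjoint φ) ψ = ip φ (infAct D ψ) := by
  simp only [ip, infAct_apply, inner_sub_left, inner_sub_right, Finset.sum_sub_distrib]
  congr 1
  · congr 1
    · simp only [ContinuousLinearMap.adjoint_inner_left]
    · rw [Finset.sum_comm]
      conv_rhs => rw [Finset.sum_comm]
      refine Finset.sum_congr rfl fun j _ ↦ ?_
      exact sum_inner_adjoint (stdOrthonormalBasis 𝕜 V) D (φ.flip _) (ψ.flip _)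
  · refine Finset.sum_congr rfl fun i _ ↦ ?_
    exact sum_inner_adjoint (stdOrthonormalBasis 𝕜 V) D (φ _) (ψ _)

/-- First variation at a minimal vector. -/
lemma re_ip_infAct_eq_zero {E : V →L[𝕜] V} {φ₀ φ : BilOp 𝕜 V} (hφ : φ ∈ orbitSet E φ₀)
    (hmin : IsMinOn (normSq 𝕜 V) (orbitSet E φ₀) φ) {s : V →L[𝕜] V} (hE : Commute E s)
    (hs : s.toLinearMap.IsSymmetric) (htr : LinearMap.trace 𝕜 V s.toLinearMap = 0) :
    RCLike.re (ip φ (infAct s φ)) = 0 := by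
  let b := stdOrthonormalBasis 𝕜 V
  -- The curve `t ↦ exp (t s) · φ` stays in the orbit: `s` commutes with `E`, and `exp (t s)` has
  -- determinant one because `s` is symmetric of trace zero.
  have hmem : ∀ t : ℝ, twist φ ((t : 𝕜) • s) ∈ orbitSet E φ₀ := fun t ↦ by
    have hiso := isoBy_twist (E := E) φ (hE.smul_right (t : 𝕜))
    refine ⟨hφ.1.trans hiso, ?_⟩
    have hsym : ((t : 𝕜) • s).toLinearMap.IsSymmetric := fun x y ↦ by
      change ⟪(t : 𝕜) • s x, y⟫ = ⟪x, (t : 𝕜) • s y⟫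
      rw [inner_smul_left, inner_smul_right, RCLike.conj_ofReal]
      exact congrArg _ (hs x y)
    have hdet := det_exp_eq_one hsym (by
      rw [ContinuousLinearMap.toLinearMap_smul, map_smul, htr, smul_zero])
    have h := disc_map (φ := φ) (ψ := twist φ ((t : 𝕜) • s)) (expEquiv ((t : 𝕜) • s)) fun x y ↦ by
      rw [twist_apply]
      have h : ∀ x, exp (-((t : 𝕜) • s)) (expEquiv ((t : 𝕜) • s) x) = x :=
        (expEquiv ((t : 𝕜) • s)).symm_apply_apply
      rw [h, h]; rfl
    have h' : LinearMap.det (expEquiv ((t : 𝕜) • s)).toLinearMap = 1 := hdet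
    rw [h', one_pow, one_mul] at h
    rw [← h, hφ.2]
  let _ := InnerProductSpace.rclikeToReal 𝕜 V
  have hder : ∀ x y, HasDerivAt (fun t : ℝ ↦ twist φ ((t : 𝕜) • s) x y) (infAct s φ x y) 0 :=
    fun x y ↦ by
      have h1 : HasDerivAt (fun t : ℝ ↦ (t : 𝕜)) 1 0 := by
        simpa using (RCLike.ofRealCLM (K := 𝕜)).hasDerivAt (x := (0 : ℝ))
      have h2 := hasDerivAt_twist φ s x y
      have h3 : HasDerivAt (fun t : 𝕜 ↦ twist φ (t • s) x y) (infAct s φ x y) ((0 : ℝ) : 𝕜) := by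
        rw [RCLike.ofReal_zero]; exact h2
      simpa [Function.comp_def] using HasDerivAt.scomp (0 : ℝ) h3 h1
  have hderF : HasDerivAt (fun t : ℝ ↦ normSq 𝕜 V (twist φ ((t : 𝕜) • s)))
      (∑ i, ∑ j, 2 * inner ℝ (twist φ (((0 : ℝ) : 𝕜) • s) (b i) (b j)) (infAct s φ (b i) (b j))) 0 :=
    HasDerivAt.fun_sum fun i _ ↦ HasDerivAt.fun_sum fun j _ ↦ (hder (b i) (b j)).norm_sq
  have h0 : twist φ (((0 : ℝ) : 𝕜) • s) = φ := by
    ext x y; simp [twist_apply, exp_zero]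
  have hloc : IsLocalMin (fun t : ℝ ↦ normSq 𝕜 V (twist φ ((t : 𝕜) • s))) 0 := by
    refine Eventually.of_forall fun t ↦ ?_
    simp only [h0]
    exact hmin (hmem t)
  have hz := hloc.hasDerivAt_eq_zero hderF
  simp only [h0, ← Finset.mul_sum] at hz
  rw [ip, map_sum]
  simp only [map_sum]
  have h2 := (mul_eq_zero.1 hz).resolve_left two_ne_zero
  simpa only [real_inner_eq_re_inner 𝕜] using h2

/-- At a minimal vector, the adjoint of a homogeneous derivation is a derivation. -/
theorem infAct_adjoint_eq_zero {E : V →L[𝕜] V} (hE : E.adjoint = E) {φ₀ φ : BilOp 𝕜 V}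
    (hφ : φ ∈ orbitSet E φ₀) (hmin : IsMinOn (normSq 𝕜 V) (orbitSet E φ₀) φ) {D : V →L[𝕜] V}
    {k : ℝ} (hED : E * D = D * E + (k : 𝕜) • D) (hD : infAct D φ = 0) :
    infAct D.adjoint φ = 0 := by
  let T := D.adjoint
  have hET : E * T = T * E - (k : 𝕜) • T := by
    have := congrArg ContinuousLinearMap.adjoint hED
    simp only [ContinuousLinearMap.mul_def, map_add, ContinuousLinearMap.adjoint_comp, hE,
      map_smulₛₗ, RCLike.conj_ofReal] at this
    rw [eq_sub_iff_add_eq]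
    exact (by simpa only [T, ContinuousLinearMap.mul_def] using this.symm)
  -- The commutator `[D, D^*]` is an admissible direction: `D` and `D^*` shift the eigenvalues of
  -- `E` by `k` and `-k`, and the commutator is symmetric with trace zero.
  let s := D * T - T * D
  have hcomm : Commute E s := by
    change E * (D * T - T * D) = (D * T - T * D) * E
    rw [mul_sub, ← mul_assoc, ← mul_assoc, hED, hET]
    simp only [add_mul, sub_mul, mul_assoc, hET, hED, mul_sub, mul_add, smul_mul_assoc,
      mul_smul_comm]
    abel
  have hsym : s.toLinearMap.IsSymmetric := fun x y ↦ by
    change ⟪D (T x) - T (D x), y⟫ = ⟪x, D (T y) - T (D y)⟫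
    simp only [inner_sub_left, inner_sub_right, T, ContinuousLinearMap.adjoint_inner_left,
      ContinuousLinearMap.adjoint_inner_right]
    congr 1
    rw [← ContinuousLinearMap.adjoint_inner_right D, ContinuousLinearMap.adjoint_inner_left D]
  have htr : LinearMap.trace 𝕜 V s.toLinearMap = 0 := by
    change LinearMap.trace 𝕜 V (D.toLinearMap * T.toLinearMap - T.toLinearMap * D.toLinearMap) = 0
    rw [map_sub, LinearMap.trace_mul_comm, sub_self]
  have h1 := re_ip_infAct_eq_zero hφ hmin hcomm hsym htr
  -- Since `D` kills `φ`, only `D (D^* φ)` survives in `[D, D^*] φ`. The first variation pairs this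
  -- with `φ`, and moving `D` across gives `‖D^* φ‖² = 0`.
  have h2 : infAct D (infAct T φ) = infAct s φ := by
    have hD' : ∀ x y, D (φ x y) = φ (D x) y + φ x (D y) := fun x y ↦ by
      have : infAct D φ x y = 0 := by rw [hD]; rfl
      rw [infAct_apply, sub_sub, sub_eq_zero] at this
      exact this
    ext x y
    simp only [infAct_apply, s, map_sub, map_add, mul_apply_eq_comp, sub_apply, hD']
    abel
  rw [← h2, ← ip_infAct] at h1
  change RCLike.re (ip (infAct T φ) (infAct T φ)) = 0 at h1
  simp only [ip, map_sum, inner_self_eq_norm_sq] at h1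
  have h3 : ∀ i j, infAct T φ (stdOrthonormalBasis 𝕜 V i) (stdOrthonormalBasis 𝕜 V j) = 0 :=
    fun i j ↦ by
      rw [Finset.sum_eq_zero_iff_of_nonneg fun _ _ ↦ Finset.sum_nonneg fun _ _ ↦ by positivity] at h1
      have h4 := h1 i (Finset.mem_univ i)
      rw [Finset.sum_eq_zero_iff_of_nonneg fun _ _ ↦ by positivity] at h4
      exact norm_eq_zero.1 (pow_eq_zero_iff two_ne_zero |>.1 (h4 j (Finset.mem_univ j)))
  have h4 : ∀ i, (infAct T φ (stdOrthonormalBasis 𝕜 V i)).toLinearMap = 0 := fun i ↦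
    (stdOrthonormalBasis 𝕜 V).toBasis.ext fun j ↦ by simpa using h3 i j
  have h5 : ∀ y, ((infAct T φ).flip y).toLinearMap = 0 := fun y ↦
    (stdOrthonormalBasis 𝕜 V).toBasis.ext fun i ↦ by
      simpa using congrArg (fun f : V →ₗ[𝕜] V ↦ f y) (h4 i)
  ext x y
  exact congrArg (fun f : V →ₗ[𝕜] V ↦ f x) (h5 y)

end Minimal

/-! ### Conjugate-linear transpositions of semisimple Lie algebras -/

section Transposition

variable {𝕜 : Type*} [RCLike 𝕜] {𝔤 : Type*} [LieRing 𝔤] [LieAlgebra 𝕜 𝔤]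

/-! ### Adjoints of endomorphisms of `𝔤` through an identification with an inner product space -/

section Dagger

variable {V : Type*} [NormedAddCommGroup V] [InnerProductSpace 𝕜 V]
  [FiniteDimensional 𝕜 V] [CompleteSpace V]

/-- An endomorphism of `𝔤` read in an inner product space. -/
def opOf (T : 𝔤 ≃ₗ[𝕜] V) (f : 𝔤 →ₗ[𝕜] 𝔤) : V →L[𝕜] V :=
  LinearMap.toContinuousLinearMap (T.conj f)

lemma opOf_apply (T : 𝔤 ≃ₗ[𝕜] V) (f : 𝔤 →ₗ[𝕜] 𝔤) (x : 𝔤) : opOf T f (T x) = T (f x) := by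
  simp [opOf, LinearEquiv.conj_apply]

/-- The adjoint of an endomorphism of `𝔤` for the inner product pulled back from `V`. -/
def dagger (T : 𝔤 ≃ₗ[𝕜] V) (f : 𝔤 →ₗ[𝕜] 𝔤) : 𝔤 →ₗ[𝕜] 𝔤 :=
  T.symm.conj (opOf T f).adjoint.toLinearMap

lemma apply_dagger (T : 𝔤 ≃ₗ[𝕜] V) (f : 𝔤 →ₗ[𝕜] 𝔤) (x : 𝔤) :
    T (dagger T f x) = (opOf T f).adjoint (T x) := by
  simp [dagger, LinearEquiv.conj_apply]

lemma opOf_dagger (T : 𝔤 ≃ₗ[𝕜] V) (f : 𝔤 →ₗ[𝕜] 𝔤) :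
    opOf T (dagger T f) = (opOf T f).adjoint := by
  ext x
  obtain ⟨x, rfl⟩ := T.surjective x
  rw [opOf_apply, apply_dagger]

lemma opOf_injective (T : 𝔤 ≃ₗ[𝕜] V) : Function.Injective (opOf T : (𝔤 →ₗ[𝕜] 𝔤) → _) :=
  fun f g h ↦ by
    ext x
    apply T.injective
    rw [← opOf_apply, ← opOf_apply, h]

lemma opOf_add (T : 𝔤 ≃ₗ[𝕜] V) (f g : 𝔤 →ₗ[𝕜] 𝔤) : opOf T (f + g) = opOf T f + opOf T g := by
  ext x
  obtain ⟨x, rfl⟩ := T.surjective x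
  simp [opOf_apply]

lemma opOf_sub (T : 𝔤 ≃ₗ[𝕜] V) (f g : 𝔤 →ₗ[𝕜] 𝔤) : opOf T (f - g) = opOf T f - opOf T g := by
  ext x
  obtain ⟨x, rfl⟩ := T.surjective x
  simp [opOf_apply]

lemma opOf_smul (T : 𝔤 ≃ₗ[𝕜] V) (c : 𝕜) (f : 𝔤 →ₗ[𝕜] 𝔤) : opOf T (c • f) = c • opOf T f := by
  ext x
  obtain ⟨x, rfl⟩ := T.surjective x
  simp [opOf_apply]

lemma opOf_mul (T : 𝔤 ≃ₗ[𝕜] V) (f g : 𝔤 →ₗ[𝕜] 𝔤) : opOf T (f * g) = opOf T f * opOf T g := by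
  ext x
  obtain ⟨x, rfl⟩ := T.surjective x
  simp [opOf_apply]

lemma trace_opOf (T : 𝔤 ≃ₗ[𝕜] V) (f : 𝔤 →ₗ[𝕜] 𝔤) :
    LinearMap.trace 𝕜 V (opOf T f).toLinearMap = LinearMap.trace 𝕜 𝔤 f :=
  LinearMap.trace_conj' f T

lemma dagger_dagger (T : 𝔤 ≃ₗ[𝕜] V) (f : 𝔤 →ₗ[𝕜] 𝔤) : dagger T (dagger T f) = f :=
  opOf_injective T (by rw [opOf_dagger, opOf_dagger, ContinuousLinearMap.adjoint_adjoint])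

lemma dagger_add (T : 𝔤 ≃ₗ[𝕜] V) (f g : 𝔤 →ₗ[𝕜] 𝔤) :
    dagger T (f + g) = dagger T f + dagger T g :=
  opOf_injective T (by simp only [opOf_dagger, opOf_add, map_add])

lemma dagger_sub (T : 𝔤 ≃ₗ[𝕜] V) (f g : 𝔤 →ₗ[𝕜] 𝔤) :
    dagger T (f - g) = dagger T f - dagger T g :=
  opOf_injective T (by simp only [opOf_dagger, opOf_sub, map_sub])

lemma dagger_smul (T : 𝔤 ≃ₗ[𝕜] V) (c : 𝕜) (f : 𝔤 →ₗ[𝕜] 𝔤) :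
    dagger T (c • f) = starRingEnd 𝕜 c • dagger T f :=
  opOf_injective T (by simp only [opOf_dagger, opOf_smul, map_smulₛₗ])

lemma dagger_mul (T : 𝔤 ≃ₗ[𝕜] V) (f g : 𝔤 →ₗ[𝕜] 𝔤) :
    dagger T (f * g) = dagger T g * dagger T f :=
  opOf_injective T (by
    simp only [opOf_dagger, opOf_mul]
    exact ContinuousLinearMap.adjoint_comp _ _)

lemma trace_dagger (T : 𝔤 ≃ₗ[𝕜] V) (f : 𝔤 →ₗ[𝕜] 𝔤) :
    LinearMap.trace 𝕜 𝔤 (dagger T f) = starRingEnd 𝕜 (LinearMap.trace 𝕜 𝔤 f) := by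
  rw [← trace_opOf T, ← trace_opOf T f, opOf_dagger,
    LinearMap.trace_eq_sum_inner _ (stdOrthonormalBasis 𝕜 V),
    LinearMap.trace_eq_sum_inner _ (stdOrthonormalBasis 𝕜 V), map_sum]
  refine Finset.sum_congr rfl fun i _ ↦ ?_
  rw [inner_conj_symm, ContinuousLinearMap.coe_coe, ContinuousLinearMap.adjoint_inner_right]
  rfl

/-- The trace is the squared Hilbert–Schmidt norm of `opOf T f`. -/
lemma re_trace_mul_dagger_pos (T : 𝔤 ≃ₗ[𝕜] V) {f : 𝔤 →ₗ[𝕜] 𝔤} (hf : f ≠ 0) :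
    0 < RCLike.re (LinearMap.trace 𝕜 𝔤 (f * dagger T f)) := by
  let b := stdOrthonormalBasis 𝕜 V
  rw [LinearMap.trace_mul_comm, ← trace_opOf T, opOf_mul, opOf_dagger,
    LinearMap.trace_eq_sum_inner _ b, map_sum]
  have h : ∀ i, RCLike.re (inner 𝕜 (b i) (((opOf T f).adjoint * opOf T f).toLinearMap (b i))) =
      ‖opOf T f (b i)‖ ^ 2 := fun i ↦ by
    rw [← inner_self_eq_norm_sq (𝕜 := 𝕜), ← ContinuousLinearMap.adjoint_inner_right]
    rfl
  simp only [h]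
  refine lt_of_le_of_ne (Finset.sum_nonneg fun _ _ ↦ by positivity) fun h0 ↦ hf ?_
  have h1 := (Finset.sum_eq_zero_iff_of_nonneg fun _ _ ↦ by positivity).1 h0.symm
  have h2 : (opOf T f).toLinearMap = 0 := b.toBasis.ext fun i ↦ by
    have := h1 i (Finset.mem_univ i)
    simpa using this
  ext x
  apply T.injective
  rw [← opOf_apply]
  simpa using congrArg (fun g : V →ₗ[𝕜] V ↦ g (T x)) h2

end Dagger

variable [FiniteDimensional 𝕜 𝔤] [LieAlgebra.IsKilling 𝕜 𝔤]

/-- An element of the kernel of `ad` is in the radical of the Killing form, which is zero. -/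
lemma ad_injective {x y : 𝔤} (h : LieAlgebra.ad 𝕜 𝔤 x = LieAlgebra.ad 𝕜 𝔤 y) : x = y := by
  refine sub_eq_zero.1 ((LieAlgebra.IsKilling.killingForm_nondegenerate 𝕜 𝔤).1 _ fun z ↦ ?_)
  rw [killingForm_apply_apply, map_sub, h, sub_self]
  simp

/-- An inner product adapted to a semisimple Lie algebra with a diagonalisable derivation `E`: the
adjoint operators of inner derivations are inner. -/
lemma exists_adapted_equiv {ι : Type*} [Fintype ι] (b : Module.Basis ι 𝕜 𝔤) (d : ι → ℝ)
    (E : 𝔤 →ₗ[𝕜] 𝔤) (hE : ∀ i, E (b i) = (d i : 𝕜) • b i)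
    (hder : ∀ x y, E ⁅x, y⁆ = ⁅E x, y⁆ + ⁅x, E y⁆) :
    ∃ T : 𝔤 ≃ₗ[𝕜] EuclideanSpace 𝕜 ι, dagger T E = E ∧
      ∀ x, ∃ y, LieAlgebra.ad 𝕜 𝔤 y = dagger T (LieAlgebra.ad 𝕜 𝔤 x) := by
  let T₀ : 𝔤 ≃ₗ[𝕜] EuclideanSpace 𝕜 ι := b.equivFun.trans (WithLp.linearEquiv 2 𝕜 (ι → 𝕜)).symm
  let φ₀ : BilOp 𝕜 (EuclideanSpace 𝕜 ι) := LinearMap.toContinuousLinearMap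
    (LinearMap.toContinuousLinearMap.toLinearMap ∘ₗ
      LinearMap.mk₂ 𝕜 (fun x y ↦ T₀ ⁅T₀.symm x, T₀.symm y⁆) (by simp) (by simp) (by simp) (by simp))
  have hφ₀ : ∀ x y, φ₀ (T₀ x) (T₀ y) = T₀ ⁅x, y⁆ := fun x y ↦ by
    change T₀ ⁅T₀.symm (T₀ x), T₀.symm (T₀ y)⁆ = _
    simp
  let E' := opOf T₀ E
  have hE'T : ∀ x, E' (T₀ x) = T₀ (E x) := opOf_apply T₀ E
  have hcoord : ∀ x i, E' x i = (d i : 𝕜) * x i := fun x i ↦ by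
    obtain ⟨x, rfl⟩ := T₀.surjective x
    rw [hE'T]
    have h1 : b.coord i ∘ₗ E = (d i : 𝕜) • b.coord i := b.ext fun j ↦ by
      by_cases h : j = i
      · subst h
        simp [hE, RCLike.real_smul_eq_coe_mul]
      · simp [hE, h]
    exact congrArg (fun g : 𝔤 →ₗ[𝕜] 𝕜 ↦ g x) h1
  -- In the coordinates of an eigenbasis `E` is diagonal with real entries, hence self-adjoint.
  have hE' : E'.adjoint = E' := by
    refine ((ContinuousLinearMap.eq_adjoint_iff E' E').2 fun x y ↦ ?_).symm
    simp only [PiLp.inner_apply, hcoord]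
    refine Finset.sum_congr rfl fun i _ ↦ ?_
    simp
    ring
  have hbr : IsBracket E' φ₀ := by
    refine ⟨fun x ↦ ?_, fun x y z ↦ ?_, fun x y ↦ ?_⟩
    · obtain ⟨x, rfl⟩ := T₀.surjective x
      rw [hφ₀, lie_self, map_zero]
    · obtain ⟨x, rfl⟩ := T₀.surjective x
      obtain ⟨y, rfl⟩ := T₀.surjective y
      obtain ⟨z, rfl⟩ := T₀.surjective z
      simp only [hφ₀, ← map_add, leibniz_lie x y z]
    · obtain ⟨x, rfl⟩ := T₀.surjective x
      obtain ⟨y, rfl⟩ := T₀.surjective y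
      simp only [hφ₀, hE'T, ← map_add, hder]
  have htr : ∀ x y, trForm φ₀.toLinearMap₁₂ (T₀ x) (T₀ y) = killingForm 𝕜 𝔤 x y := fun x y ↦ by
    rw [trForm_apply, killingForm_apply_apply, ← LinearMap.trace_conj' _ T₀]
    congr 1
    ext z
    simp [LinearEquiv.conj_apply, ← hφ₀]
  have hd : disc φ₀ ≠ 0 := disc_ne_zero fun x hx ↦ by
    obtain ⟨x, rfl⟩ := T₀.surjective x
    rw [(LieAlgebra.IsKilling.killingForm_nondegenerate 𝕜 𝔤).1 x fun y ↦ by rw [← htr, hx],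
      map_zero]
  obtain ⟨φ, hφ, hmin⟩ := exists_isMinOn_normSq hbr hd
  obtain ⟨A, hA1, hA2⟩ := hφ.1
  let T : 𝔤 ≃ₗ[𝕜] EuclideanSpace 𝕜 ι := T₀.trans A
  have hT : ∀ x y, φ (T x) (T y) = T ⁅x, y⁆ := fun x y ↦ by
    change φ (A (T₀ x)) (A (T₀ y)) = A (T₀ ⁅x, y⁆)
    rw [← hA2, hφ₀]
  have hTE : opOf T E = E' := by
    ext1 x
    obtain ⟨x, rfl⟩ := T.surjective x
    rw [opOf_apply]
    change A (T₀ (E x)) = E' (A (T₀ x))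
    rw [← hA1, hE'T]
  refine ⟨T, opOf_injective T (by rw [opOf_dagger, hTE, hE']), ?_⟩
  -- The elements whose `ad` has an inner adjoint form a subspace, so it suffices to treat the
  -- eigenvectors `b i`, whose `ad` is homogeneous for `E`.
  let S : Submodule 𝕜 𝔤 :=
    { carrier := {x | ∃ y, LieAlgebra.ad 𝕜 𝔤 y = dagger T (LieAlgebra.ad 𝕜 𝔤 x)}
      add_mem' := by
        rintro x x' ⟨y, hy⟩ ⟨y', hy'⟩
        exact ⟨y + y', by rw [map_add, map_add, dagger_add, hy, hy']⟩
      zero_mem' := ⟨0, by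
        rw [map_zero, ← zero_smul 𝕜 (0 : 𝔤 →ₗ[𝕜] 𝔤), dagger_smul, map_zero, zero_smul, zero_smul]⟩
      smul_mem' := by
        rintro c x ⟨y, hy⟩
        exact ⟨starRingEnd 𝕜 c • y, by rw [map_smul, map_smul, dagger_smul, hy]⟩ }
  suffices S = ⊤ from fun x ↦ (this ▸ Submodule.mem_top : x ∈ S)
  rw [eq_top_iff, ← b.span_eq, Submodule.span_le]
  rintro _ ⟨i, rfl⟩
  let D := opOf T (LieAlgebra.ad 𝕜 𝔤 (b i))
  have hD : infAct D φ = 0 := by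
    ext1 x; ext1 y
    obtain ⟨x, rfl⟩ := T.surjective x
    obtain ⟨y, rfl⟩ := T.surjective y
    rw [infAct_apply, hT, opOf_apply, opOf_apply, opOf_apply, hT, hT]
    simp only [LieAlgebra.ad_apply, ← map_sub]
    rw [leibniz_lie (b i) x y]
    simp
  have hED : E' * D = D * E' + (d i : 𝕜) • D := by
    rw [← hTE, ← opOf_mul, ← opOf_mul, ← opOf_smul, ← opOf_add]
    congr 1
    ext x
    simp [hder, hE, add_comm]
  have hD' := infAct_adjoint_eq_zero hE' hφ hmin hED hD
  -- At the minimal bracket the adjoint of `ad (b i)` is a derivation, and all derivations of a Lie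
  -- algebra with nondegenerate Killing form are inner.
  let δ : LieDerivation 𝕜 𝔤 𝔤 :=
    { toLinearMap := dagger T (LieAlgebra.ad 𝕜 𝔤 (b i))
      leibniz' := fun x y ↦ by
        apply T.injective
        have h : infAct D.adjoint φ (T x) (T y) = 0 := by rw [hD']; rfl
        rw [infAct_apply, hT, sub_sub, sub_eq_zero] at h
        rw [apply_dagger, h, ← apply_dagger, ← apply_dagger, hT, hT, ← map_add]
        congr 1
        rw [← lie_skew y]
        abel }
  obtain ⟨y, hy⟩ := LieDerivation.IsKilling.exists_eq_ad δ
  exact ⟨y, by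
    ext z
    have h : LieDerivation.ad 𝕜 𝔤 y z = δ z := congrArg (fun g : LieDerivation 𝕜 𝔤 𝔤 ↦ g z) hy
    rw [LieDerivation.ad_apply_apply] at h
    exact h⟩

/-- A semisimple real or complex Lie algebra with a derivation `E` that is diagonalisable with real
eigenvalues has a conjugate-linear involutive anti-automorphism `σ` which is positive for the Killing
form and changes the sign of the eigenvalues of `E`. -/
theorem exists_transposition {ι : Type*} [Fintype ι] (b : Module.Basis ι 𝕜 𝔤) (d : ι → ℝ)
    (E : 𝔤 →ₗ[𝕜] 𝔤) (hE : ∀ i, E (b i) = (d i : 𝕜) • b i)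
    (hder : ∀ x y, E ⁅x, y⁆ = ⁅E x, y⁆ + ⁅x, E y⁆) :
    ∃ σ : 𝔤 →ₛₗ[starRingEnd 𝕜] 𝔤, (∀ x y, σ ⁅x, y⁆ = ⁅σ y, σ x⁆) ∧ (∀ x, σ (σ x) = x) ∧
      (∀ x y, killingForm 𝕜 𝔤 (σ x) (σ y) = starRingEnd 𝕜 (killingForm 𝕜 𝔤 x y)) ∧
      (∀ x, x ≠ 0 → 0 < RCLike.re (killingForm 𝕜 𝔤 x (σ x))) ∧
      ∀ (k : ℝ) (x : 𝔤), E x = (k : 𝕜) • x → E (σ x) = -((k : 𝕜) • σ x) := by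
  obtain ⟨T, hTE, hT⟩ := exists_adapted_equiv b d E hE hder
  -- The map `σ` is characterised by `ad (σ x) = (ad x)^†`. As `ad` is injective, each property of
  -- `σ` reduces to one of the adjoint operation on endomorphisms.
  choose s hs using hT
  refine ⟨{ toFun := s, map_add' := fun x y ↦ ?_, map_smul' := fun c x ↦ ?_ }, fun x y ↦ ?_,
    fun x ↦ ?_, fun x y ↦ ?_, fun x hx ↦ ?_, fun k x hx ↦ ?_⟩
  · apply ad_injective (𝕜 := 𝕜)
    rw [map_add, hs, hs, hs, map_add, dagger_add]
  · apply ad_injective (𝕜 := 𝕜)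
    rw [map_smul, hs, hs, map_smul, dagger_smul]
  · apply ad_injective (𝕜 := 𝕜)
    change LieAlgebra.ad 𝕜 𝔤 (s ⁅x, y⁆) = LieAlgebra.ad 𝕜 𝔤 ⁅s y, s x⁆
    have h : ∀ x y, LieAlgebra.ad 𝕜 𝔤 ⁅x, y⁆ =
        LieAlgebra.ad 𝕜 𝔤 x * LieAlgebra.ad 𝕜 𝔤 y - LieAlgebra.ad 𝕜 𝔤 y * LieAlgebra.ad 𝕜 𝔤 x :=
      fun x y ↦ by ext z; simp
    rw [hs, h, h, hs, hs, dagger_sub, dagger_mul, dagger_mul]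
  · apply ad_injective (𝕜 := 𝕜)
    change LieAlgebra.ad 𝕜 𝔤 (s (s x)) = _
    rw [hs, hs, dagger_dagger]
  · change killingForm 𝕜 𝔤 (s x) (s y) = _
    rw [killingForm_apply_apply, killingForm_apply_apply, hs, hs, ← Module.End.mul_eq_comp,
      ← Module.End.mul_eq_comp, ← trace_dagger T, dagger_mul, LinearMap.trace_mul_comm]
  · change 0 < RCLike.re (killingForm 𝕜 𝔤 x (s x))
    rw [killingForm_apply_apply, hs]
    exact re_trace_mul_dagger_pos T fun h ↦ hx (ad_injective (𝕜 := 𝕜) (by rw [h, map_zero]))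
  · apply ad_injective (𝕜 := 𝕜)
    change LieAlgebra.ad 𝕜 𝔤 (E (s x)) = LieAlgebra.ad 𝕜 𝔤 (-((k : 𝕜) • s x))
    have h : ∀ x, LieAlgebra.ad 𝕜 𝔤 (E x) = E * LieAlgebra.ad 𝕜 𝔤 x - LieAlgebra.ad 𝕜 𝔤 x * E :=
      fun x ↦ by ext y; simp [hder]
    -- Taking adjoints in `ad (E x) = [E, ad x]` with `E^† = E` reverses the commutator, hence the
    -- sign of the eigenvalue.
    have h1 := congrArg (dagger T) (h x)
    rw [dagger_sub, dagger_mul, dagger_mul, hTE, ← hs, ← hs, hx, ← neg_sub, ← h] at h1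
    rw [← neg_eq_iff_eq_neg.2 h1, hs, map_smul, dagger_smul, ← hs, RCLike.conj_ofReal, map_neg,
      map_smul]

end Transposition

/-! ### Graded Lie algebras -/

namespace TwoGrading

section Grading

variable {𝕜 : Type*} [Field 𝕜] {𝔤 : Type*} [LieRing 𝔤] [LieAlgebra 𝕜 𝔤] (gr : TwoGrading 𝕜 𝔤)

lemma proj_apply_of_mem {i : ℤ} {x : 𝔤} (hx : x ∈ gr.piece i) (j : ℤ) :
    gr.proj j x = if i = j then x else 0 := by
  classical
  have h : (LinearEquiv.ofBijective (DirectSum.coeLinearMap gr.piece) gr.isInternal).symm x =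
      DirectSum.lof 𝕜 ℤ (fun j ↦ gr.piece j) i ⟨x, hx⟩ := by
    rw [LinearEquiv.symm_apply_eq]
    exact (DirectSum.coeLinearMap_lof gr.piece i ⟨x, hx⟩).symm
  simp only [proj, LinearMap.comp_apply, LinearEquiv.coe_coe, h, Submodule.subtype_apply]
  split_ifs with hij
  · subst hij
    rw [DirectSum.component.lof_self]
  · rw [DirectSum.component.of, dif_neg hij]
    rfl

lemma proj_self {i : ℤ} {x : 𝔤} (hx : x ∈ gr.piece i) : gr.proj i x = x := by
  rw [gr.proj_apply_of_mem hx, if_pos rfl]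

lemma proj_of_ne {i j : ℤ} {x : 𝔤} (hx : x ∈ gr.piece i) (h : i ≠ j) : gr.proj j x = 0 := by
  rw [gr.proj_apply_of_mem hx, if_neg h]

lemma eq_zero_of_mem {i : ℤ} {x : 𝔤} (hx : x ∈ gr.piece i) (h : 2 < |i|) : x = 0 := by
  rw [gr.piece_eq_bot i h] at hx
  exact hx

@[elab_as_elim]
lemma homogeneous_induction {p : 𝔤 → Prop} (x : 𝔤) (mem : ∀ i, ∀ x ∈ gr.piece i, p x)
    (add : ∀ x y, p x → p y → p (x + y)) : p x := by
  have hx : x ∈ ⨆ i, gr.piece i := by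
    rw [gr.isInternal.submodule_iSup_eq_top]
    trivial
  exact Submodule.iSup_induction (motive := p) gr.piece hx mem (mem 0 0 (zero_mem _)) add

lemma sum_proj (x : 𝔤) : ∑ i ∈ Finset.Icc (-2 : ℤ) 2, gr.proj i x = x := by
  induction x using gr.homogeneous_induction with
  | mem i x hx =>
    simp only [gr.proj_apply_of_mem hx]
    rw [Finset.sum_ite_eq]
    split_ifs with h
    · rfl
    · refine (gr.eq_zero_of_mem hx ?_).symm
      rw [Finset.mem_Icc] at h
      rw [lt_abs]
      omega
  | add x y hx hy => simp only [map_add, Finset.sum_add_distrib, hx, hy]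

lemma proj_eq_zero {i : ℤ} (h : 2 < |i|) (x : 𝔤) : gr.proj i x = 0 :=
  gr.eq_zero_of_mem (gr.proj_mem i x) h

lemma eq_of_forall_proj {x y : 𝔤} (h : ∀ i, gr.proj i x = gr.proj i y) : x = y := by
  rw [← gr.sum_proj x, ← gr.sum_proj y]
  simp only [h]

lemma eq_zero_of_forall_proj {x : 𝔤} (h : ∀ i, gr.proj i x = 0) : x = 0 :=
  gr.eq_of_forall_proj fun i ↦ by rw [h, map_zero]

lemma mem_piece_of_forall_proj {i : ℤ} {x : 𝔤} (h : ∀ j, j ≠ i → gr.proj j x = 0) :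
    x ∈ gr.piece i := by
  have : x = gr.proj i x := gr.eq_of_forall_proj fun j ↦ by
    rw [gr.proj_apply_of_mem (gr.proj_mem i x)]
    split_ifs with hj
    · rw [hj]
    · exact h j fun e ↦ hj e.symm
  rw [this]
  exact gr.proj_mem i x

/-- Turns membership in the filtration into vanishing of projections, the form used in all later
degree arguments. -/
lemma mem_filt_iff {i : ℤ} {x : 𝔤} : x ∈ gr.filt i ↔ ∀ j < i, gr.proj j x = 0 := by
  constructor
  · intro hx j hj
    have : gr.filt i ≤ LinearMap.ker (gr.proj j) := iSup₂_le fun k hk y hy ↦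
      gr.proj_of_ne hy (by omega)
    exact this hx
  · intro h
    rw [← gr.sum_proj x]
    refine sum_mem fun j _ ↦ ?_
    by_cases hj : j < i
    · rw [h j hj]
      exact zero_mem _
    · exact Submodule.mem_iSup_of_mem j (Submodule.mem_iSup_of_mem (not_lt.1 hj) (gr.proj_mem j x))

lemma piece_le_filt {i j : ℤ} (h : i ≤ j) : gr.piece j ≤ gr.filt i := fun x hx ↦
  gr.mem_filt_iff.2 fun _ hk ↦ gr.proj_of_ne hx (by omega)

lemma filt_anti {i j : ℤ} (h : i ≤ j) : gr.filt j ≤ gr.filt i := fun x hx ↦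
  gr.mem_filt_iff.2 fun _ hk ↦ gr.mem_filt_iff.1 hx _ (by omega)

lemma lie_mem_filt {i j : ℤ} {x y : 𝔤} (hx : x ∈ gr.filt i) (hy : y ∈ gr.filt j) :
    ⁅x, y⁆ ∈ gr.filt (i + j) := by
  rw [← gr.sum_proj x, ← gr.sum_proj y, sum_lie]
  refine sum_mem fun k _ ↦ ?_
  rw [lie_sum]
  refine sum_mem fun m _ ↦ ?_
  by_cases hk : k < i
  · rw [gr.mem_filt_iff.1 hx k hk, zero_lie]; exact zero_mem _
  by_cases hm : m < j
  · rw [gr.mem_filt_iff.1 hy m hm, lie_zero]; exact zero_mem _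
  exact gr.piece_le_filt (by omega) (gr.lie_mem (gr.proj_mem k x) (gr.proj_mem m y))

lemma proj_lie {i : ℤ} {x : 𝔤} (hx : x ∈ gr.piece i) (y : 𝔤) (j : ℤ) :
    gr.proj j ⁅x, y⁆ = ⁅x, gr.proj (j - i) y⁆ := by
  induction y using gr.homogeneous_induction with
  | mem k y hy =>
    rw [gr.proj_apply_of_mem (gr.lie_mem hx hy), gr.proj_apply_of_mem hy]
    split_ifs with h1 h2 h2
    · rfl
    · omega
    · omega
    · rw [lie_zero]
  | add y z hy hz => rw [lie_add, map_add, map_add, lie_add, hy, hz]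

lemma coe_negProj (x : 𝔤) : (gr.negProj x : 𝔤) = gr.proj (-2) x + gr.proj (-1) x := rfl

lemma mem_neg_iff {x : 𝔤} : x ∈ gr.neg ↔ ∀ j, 0 ≤ j → gr.proj j x = 0 := by
  constructor
  · intro hx j hj
    have : (⨆ j : {j : ℤ // j < 0}, gr.piece j) ≤ LinearMap.ker (gr.proj j) :=
      iSup_le fun k y hy ↦ gr.proj_of_ne hy (by have := k.2; omega)
    exact this hx
  · intro h
    rw [← gr.sum_proj x]
    refine Submodule.sum_mem gr.neg.toSubmodule fun j _ ↦ ?_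
    by_cases hj : j < 0
    · exact gr.piece_le_neg hj (gr.proj_mem j x)
    · rw [h j (not_lt.1 hj)]
      exact zero_mem _

lemma proj_negProj {i : ℤ} (hi : i < 0) (x : 𝔤) : gr.proj i (gr.negProj x : 𝔤) = gr.proj i x := by
  rw [coe_negProj, map_add, gr.proj_apply_of_mem (gr.proj_mem (-2) x),
    gr.proj_apply_of_mem (gr.proj_mem (-1) x)]
  rcases eq_or_ne i (-2) with rfl | h2
  · simp
  rcases eq_or_ne i (-1) with rfl | h1
  · simp
  rw [if_neg h2.symm, if_neg h1.symm, gr.proj_eq_zero (by rw [lt_abs]; omega), add_zero]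

lemma negProj_eq_iff {x : 𝔤} {y : gr.neg} :
    gr.negProj x = y ↔ ∀ i < 0, gr.proj i x = gr.proj i (y : 𝔤) := by
  constructor
  · rintro rfl i hi
    rw [gr.proj_negProj hi]
  · intro h
    refine Subtype.ext (gr.eq_of_forall_proj fun i ↦ ?_)
    by_cases hi : i < 0
    · rw [gr.proj_negProj hi, h i hi]
    · rw [gr.mem_neg_iff.1 (gr.negProj x).2 i (not_lt.1 hi),
        gr.mem_neg_iff.1 y.2 i (not_lt.1 hi)]

@[simp] lemma negProj_coe (x : gr.neg) : gr.negProj (x : 𝔤) = x :=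
  gr.negProj_eq_iff.2 fun _ _ ↦ rfl

lemma negProj_eq_zero_iff {x : 𝔤} : gr.negProj x = 0 ↔ x ∈ gr.filt 0 := by
  rw [gr.negProj_eq_iff, gr.mem_filt_iff]
  simp

lemma sub_negProj_mem (x : 𝔤) : x - gr.negProj x ∈ gr.filt 0 := by
  rw [← gr.negProj_eq_zero_iff, map_sub, negProj_coe, sub_self]

lemma coe_negProj_mem {i : ℤ} {x : 𝔤} (hx : x ∈ gr.piece i) : (gr.negProj x : 𝔤) ∈ gr.piece i := by
  rw [coe_negProj]
  refine add_mem ?_ ?_ <;> rw [gr.proj_apply_of_mem hx] <;> split_ifs <;>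
    first | exact hx | exact zero_mem _

@[elab_as_elim]
lemma neg_induction {p : gr.neg → Prop} (x : gr.neg)
    (mem : ∀ i, i = -2 ∨ i = -1 → ∀ x : gr.neg, (x : 𝔤) ∈ gr.piece i → p x)
    (add : ∀ x y, p x → p y → p (x + y)) : p x := by
  have h : x = gr.negProj (gr.proj (-2) x) + gr.negProj (gr.proj (-1) x) := by
    rw [← map_add]
    refine (gr.negProj_eq_iff.2 fun i hi ↦ ?_).symm
    rw [← coe_negProj, negProj_coe]
  rw [h]
  exact add _ _ (mem _ (Or.inl rfl) _ (gr.coe_negProj_mem (gr.proj_mem _ _)))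
    (mem _ (Or.inr rfl) _ (gr.coe_negProj_mem (gr.proj_mem _ _)))

/-! ### Homogeneous components of cochains -/

lemma homComp_apply {i j l : ℤ} (ψ : gr.C2) {x y : gr.neg} (hx : (x : 𝔤) ∈ gr.piece i)
    (hy : (y : 𝔤) ∈ gr.piece j) (hi : i = -2 ∨ i = -1) (hj : j = -2 ∨ j = -1) :
    gr.homComp l ψ x y = gr.proj (i + j + l) (ψ x y) := by
  have h : Finset.Icc (-2 : ℤ) (-1) = {-2, -1} := by decide
  have hn : ∀ (x : gr.neg) (i : ℤ), (x : 𝔤) ∈ gr.piece i → ∀ k,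
      (gr.negProj ∘ₗ gr.proj k ∘ₗ gr.neg.toSubmodule.subtype) x = if i = k then x else 0 :=
    fun x i hx k ↦ by
    change gr.negProj (gr.proj k (x : 𝔤)) = _
    rw [gr.proj_apply_of_mem hx]
    split_ifs
    · simp
    · simp
  change (∑ i ∈ Finset.Icc (-2 : ℤ) (-1), ∑ j ∈ Finset.Icc (-2 : ℤ) (-1),
    gr.transport (gr.negProj ∘ₗ gr.proj i ∘ₗ gr.neg.toSubmodule.subtype)
      (gr.negProj ∘ₗ gr.proj j ∘ₗ gr.neg.toSubmodule.subtype) (gr.proj (i + j + l)) ψ.1) x y = _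
  simp only [h, LinearMap.sum_apply, transport, LinearMap.compr₂_apply, LinearMap.compl₁₂_apply]
  rw [Finset.sum_pair (by norm_num), Finset.sum_pair (by norm_num), Finset.sum_pair (by norm_num)]
  simp only [hn x i hx, hn y j hy]
  rcases hi with rfl | rfl <;> rcases hj with rfl | rfl <;> simp

lemma homComp_apply_mem {i j : ℤ} (l : ℤ) (ψ : gr.C2) {x y : gr.neg} (hx : (x : 𝔤) ∈ gr.piece i)
    (hy : (y : 𝔤) ∈ gr.piece j) (hi : i = -2 ∨ i = -1) (hj : j = -2 ∨ j = -1) :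
    gr.homComp l ψ x y ∈ gr.piece (i + j + l) := by
  rw [gr.homComp_apply ψ hx hy hi hj]
  exact gr.proj_mem _ _

lemma cochain_ext {ψ φ : gr.C2} (h : ∀ i j, (i = -2 ∨ i = -1) → (j = -2 ∨ j = -1) →
    ∀ x y : gr.neg, (x : 𝔤) ∈ gr.piece i → (y : 𝔤) ∈ gr.piece j → ψ x y = φ x y) : ψ = φ := by
  ext x y
  change ψ x y = φ x y
  induction x using gr.neg_induction with
  | mem i hi x hx =>
    induction y using gr.neg_induction with
    | mem j hj y hy => exact h i j hi hj x y hx hy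
    | add y z hy hz => rw [map_add, map_add, hy, hz]
  | add x z hx hz => rw [map_add, map_add, LinearMap.add_apply, LinearMap.add_apply, hx, hz]

/-- Arguments of degrees `i, j ≤ -1` land in degree `i + j + l < -2`, where `𝔤` is zero. -/
lemma homComp_of_neg {l : ℤ} (hl : l < 0) (ψ : gr.C2) : gr.homComp l ψ = 0 :=
  gr.cochain_ext fun i j hi hj x y hx hy ↦
    gr.eq_zero_of_mem (gr.homComp_apply_mem l ψ hx hy hi hj) (by rw [lt_abs]; omega)

lemma eq_zero_of_forall_homComp {ψ : gr.C2} (h : ∀ l, gr.homComp l ψ = 0) : ψ = 0 :=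
  gr.cochain_ext fun i j hi hj x y hx hy ↦ gr.eq_zero_of_forall_proj fun k ↦ by
    have := gr.homComp_apply (l := k - i - j) ψ hx hy hi hj
    rw [h, show i + j + (k - i - j) = k by ring] at this
    exact this.symm

/-- If the components of `ψ` of homogeneity `< l` vanish, then `ψ` raises degrees by `l`. -/
lemma apply_mem_filt {l : ℤ} {ψ : gr.C2} (h : ∀ j < l, gr.homComp j ψ = 0) {i j : ℤ} {x y : gr.neg}
    (hx : (x : 𝔤) ∈ gr.filt i) (hy : (y : 𝔤) ∈ gr.filt j) : ψ x y ∈ gr.filt (i + j + l) := by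
  have key : ∀ i j, (i = -2 ∨ i = -1) → (j = -2 ∨ j = -1) →
      ∀ x y : gr.neg, (x : 𝔤) ∈ gr.piece i → (y : 𝔤) ∈ gr.piece j →
      ψ x y ∈ gr.filt (i + j + l) := fun i j hi hj x y hx hy ↦ gr.mem_filt_iff.2 fun k hk ↦ by
    have := gr.homComp_apply (l := k - i - j) ψ hx hy hi hj
    rw [h _ (by omega), show i + j + (k - i - j) = k by ring] at this
    exact this.symm
  have hdec : ∀ x : gr.neg, x = gr.negProj (gr.proj (-2) x) + gr.negProj (gr.proj (-1) x) :=
    fun x ↦ by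
      rw [← map_add]
      refine (gr.negProj_eq_iff.2 fun i hi ↦ ?_).symm
      rw [← coe_negProj, negProj_coe]
  have hz : ∀ (k : ℤ) (x : gr.neg) (i : ℤ), (x : 𝔤) ∈ gr.filt i → k < i →
      gr.negProj (gr.proj k (x : 𝔤)) = 0 := fun k x i hx hk ↦ by
    rw [gr.mem_filt_iff.1 hx k hk, map_zero]
  have hm : ∀ (k : ℤ) (x : gr.neg), ((gr.negProj (gr.proj k (x : 𝔤)) : gr.neg) : 𝔤) ∈ gr.piece k :=
    fun k x ↦ gr.coe_negProj_mem (gr.proj_mem _ _)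
  have key' : ∀ k m, (k = -2 ∨ k = -1) → (m = -2 ∨ m = -1) →
      ψ (gr.negProj (gr.proj k (x : 𝔤))) (gr.negProj (gr.proj m (y : 𝔤))) ∈ gr.filt (i + j + l) := by
    intro k m hk hm'
    by_cases h1 : k < i
    · rw [hz k x i hx h1, map_zero]
      exact zero_mem _
    by_cases h2 : m < j
    · rw [hz m y j hy h2, map_zero]
      exact zero_mem _
    exact gr.filt_anti (by omega) (key k m hk hm' _ _ (hm k x) (hm m y))
  rw [hdec x, hdec y]
  simp only [map_add, LinearMap.add_apply]
  exact add_mem (add_mem (key' _ _ (by simp) (by simp)) (key' _ _ (by simp) (by simp)))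
    (add_mem (key' _ _ (by simp) (by simp)) (key' _ _ (by simp) (by simp)))

lemma trilinear_ext {φ φ' : gr.neg →ₗ[𝕜] gr.neg →ₗ[𝕜] gr.neg →ₗ[𝕜] 𝔤}
    (h : ∀ i j k, (i = -2 ∨ i = -1) → (j = -2 ∨ j = -1) → (k = -2 ∨ k = -1) →
      ∀ x y z : gr.neg, (x : 𝔤) ∈ gr.piece i → (y : 𝔤) ∈ gr.piece j → (z : 𝔤) ∈ gr.piece k →
      φ x y z = φ' x y z) : φ = φ' := by
  ext x y z
  induction x using gr.neg_induction with
  | mem i hi x hx =>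
    induction y using gr.neg_induction with
    | mem j hj y hy =>
      induction z using gr.neg_induction with
      | mem k hk z hz => exact h i j k hi hj hk x y z hx hy hz
      | add z w hz hw => rw [map_add, map_add, hz, hw]
    | add y w hy hw => simp only [map_add, LinearMap.add_apply, hy, hw]
  | add x w hx hw => simp only [map_add, LinearMap.add_apply, hx, hw]

lemma homComp_apply_lie_mem {i j k : ℤ} (l : ℤ) (ψ : gr.C2) {x y z : gr.neg}
    (hx : (x : 𝔤) ∈ gr.piece i) (hy : (y : 𝔤) ∈ gr.piece j) (hz : (z : 𝔤) ∈ gr.piece k)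
    (hi : i = -2 ∨ i = -1) (hj : j = -2 ∨ j = -1) (hk : k = -2 ∨ k = -1) :
    gr.homComp l ψ ⁅x, y⁆ z ∈ gr.piece (i + j + k + l) := by
  have hxy : ((⁅x, y⁆ : gr.neg) : 𝔤) ∈ gr.piece (i + j) := gr.lie_mem hx hy
  by_cases h : i + j = -2
  · exact gr.homComp_apply_mem l ψ hxy hz (Or.inl h) hk
  · have : ⁅x, y⁆ = 0 := Subtype.ext (gr.eq_zero_of_mem hxy (by rw [lt_abs]; omega))
    rw [this, map_zero]
    exact zero_mem _

lemma diff_homComp_mem {i j k : ℤ} (l : ℤ) (ψ : gr.C2) {x y z : gr.neg}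
    (hx : (x : 𝔤) ∈ gr.piece i) (hy : (y : 𝔤) ∈ gr.piece j) (hz : (z : 𝔤) ∈ gr.piece k)
    (hi : i = -2 ∨ i = -1) (hj : j = -2 ∨ j = -1) (hk : k = -2 ∨ k = -1) :
    gr.diff (gr.homComp l ψ) x y z ∈ gr.piece (i + j + k + l) := by
  have h1 : ∀ {i j k : ℤ} {x y z : gr.neg}, (x : 𝔤) ∈ gr.piece i → (y : 𝔤) ∈ gr.piece j →
      (z : 𝔤) ∈ gr.piece k → (i = -2 ∨ i = -1) → (j = -2 ∨ j = -1) → (k = -2 ∨ k = -1) →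
      ⁅x, gr.homComp l ψ y z⁆ ∈ gr.piece (i + j + k + l) := by
    intro i j k x y z hx hy hz hi hj hk
    rw [show i + j + k + l = i + (j + k + l) by ring]
    exact gr.lie_mem hx (gr.homComp_apply_mem l ψ hy hz hj hk)
  rw [LieModule.Cohomology.d₂₃_apply]
  have h2 := h1 hy hx hz hj hi hk
  have h3 := h1 hz hx hy hk hi hj
  have h4 := gr.homComp_apply_lie_mem l ψ hx hz hy hi hk hj
  have h5 := gr.homComp_apply_lie_mem l ψ hy hz hx hj hk hi
  rw [show j + i + k = i + j + k by ring] at h2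
  rw [show k + i + j = i + j + k by ring] at h3
  rw [show i + k + j = i + j + k by ring] at h4
  rw [show j + k + i = i + j + k by ring] at h5
  exact sub_mem (add_mem (sub_mem (add_mem (sub_mem (h1 hx hy hz hi hj hk) h2) h3)
    (gr.homComp_apply_lie_mem l ψ hx hy hz hi hj hk)) h4) h5

/-- Three arguments from `𝔤₋` have total degree at most `-3`, so for `l ≤ 0` the values lie below
degree `-2`. -/
lemma diff_homComp_of_nonpos {l : ℤ} (hl : l ≤ 0) (ψ : gr.C2) : gr.diff (gr.homComp l ψ) = 0 :=
  gr.trilinear_ext fun i j k hi hj hk _ _ _ hx hy hz ↦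
    gr.eq_zero_of_mem (gr.diff_homComp_mem l ψ hx hy hz hi hj hk) (by rw [lt_abs]; omega)

end Grading
end TwoGrading
namespace TwoGrading

/-! ### The Killing form and the codifferential -/

section Codifferential

variable {𝕜 : Type*} [Field 𝕜] {𝔤 : Type*} [LieRing 𝔤] [LieAlgebra 𝕜 𝔤] (gr : TwoGrading 𝕜 𝔤)

/-- The grading derivation, equal to `i` on `𝔤ᵢ`. -/
def degree : 𝔤 →ₗ[𝕜] 𝔤 := ∑ i ∈ Finset.Icc (-2 : ℤ) 2, (i : 𝕜) • gr.proj i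

lemma degree_apply {i : ℤ} {x : 𝔤} (hx : x ∈ gr.piece i) : gr.degree x = (i : 𝕜) • x := by
  have h : ∀ j : ℤ, (j : 𝕜) • gr.proj j x = (i : 𝕜) • gr.proj j x := fun j ↦ by
    rw [gr.proj_apply_of_mem hx]
    split_ifs with h
    · rw [h]
    · rw [smul_zero, smul_zero]
  simp only [degree, LinearMap.sum_apply, LinearMap.smul_apply, h]
  rw [← Finset.smul_sum, gr.sum_proj]

lemma degree_lie (x y : 𝔤) : gr.degree ⁅x, y⁆ = ⁅gr.degree x, y⁆ + ⁅x, gr.degree y⁆ := by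
  induction x using gr.homogeneous_induction with
  | mem i x hx =>
    induction y using gr.homogeneous_induction with
    | mem j y hy =>
      rw [gr.degree_apply hx, gr.degree_apply hy, gr.degree_apply (gr.lie_mem hx hy), smul_lie,
        lie_smul, ← add_smul, Int.cast_add]
    | add y z hy hz => rw [lie_add, map_add, hy, hz, map_add, lie_add, lie_add]; abel
  | add x z hx hz => rw [add_lie, map_add, hx, hz, map_add, add_lie, add_lie]; abel

lemma proj_degree (j : ℤ) (x : 𝔤) : gr.proj j (gr.degree x) = (j : 𝕜) • gr.proj j x := by
  induction x using gr.homogeneous_induction with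
  | mem i x hx =>
    rw [gr.degree_apply hx, map_smul, gr.proj_apply_of_mem hx]
    split_ifs with hij
    · rw [hij]
    · rw [smul_zero, smul_zero]
  | add x y hx hy => rw [map_add, map_add, map_add, smul_add, hx, hy]

/-- In characteristic zero the integers `j` are distinct eigenvalues of the grading derivation, so
an eigenvector has only one nonzero homogeneous component. -/
lemma mem_piece_of_degree_apply [CharZero 𝕜] {μ : 𝕜} {x : 𝔤} (hx : x ≠ 0)
    (h : gr.degree x = μ • x) : ∃ i : ℤ, (i : 𝕜) = μ ∧ x ∈ gr.piece i := by
  have hp : ∀ j : ℤ, (j : 𝕜) • gr.proj j x = μ • gr.proj j x := fun j ↦ by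
    rw [← gr.proj_degree, h, map_smul]
  obtain ⟨i, hi⟩ : ∃ i, gr.proj i x ≠ 0 := by
    by_contra! h0
    exact hx (gr.eq_zero_of_forall_proj h0)
  have hiμ : (i : 𝕜) = μ := smul_left_injective 𝕜 hi (hp i)
  refine ⟨i, hiμ, gr.mem_piece_of_forall_proj fun j hj ↦ ?_⟩
  by_contra h0
  exact hj (Int.cast_injective ((smul_left_injective 𝕜 h0 (hp j)).trans hiμ.symm))

variable [CharZero 𝕜] [FiniteDimensional 𝕜 𝔤]

/-- The commutator of the grading derivation with `ad x ∘ ad y` is `i + j` times that operator, and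
commutators have trace zero. -/
lemma killingForm_eq_zero {i j : ℤ} {x y : 𝔤} (hx : x ∈ gr.piece i) (hy : y ∈ gr.piece j)
    (h : i + j ≠ 0) : killingForm 𝕜 𝔤 x y = 0 := by
  have h1 : ∀ {i : ℤ} {x : 𝔤}, x ∈ gr.piece i → gr.degree * LieAlgebra.ad 𝕜 𝔤 x -
      LieAlgebra.ad 𝕜 𝔤 x * gr.degree = (i : 𝕜) • LieAlgebra.ad 𝕜 𝔤 x := fun {i x} hx ↦ by
    ext z
    simp [degree_lie, gr.degree_apply hx]
  have h2 : ((i + j : ℤ) : 𝕜) • (LieAlgebra.ad 𝕜 𝔤 x * LieAlgebra.ad 𝕜 𝔤 y) =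
      gr.degree * (LieAlgebra.ad 𝕜 𝔤 x * LieAlgebra.ad 𝕜 𝔤 y) -
        (LieAlgebra.ad 𝕜 𝔤 x * LieAlgebra.ad 𝕜 𝔤 y) * gr.degree := by
    rw [Int.cast_add, add_smul, ← smul_mul_assoc, ← mul_smul_comm, ← h1 hx, ← h1 hy]
    noncomm_ring
  have h3 := congrArg (LinearMap.trace 𝕜 𝔤) h2
  rw [map_smul, map_sub, LinearMap.trace_mul_comm 𝕜 gr.degree, sub_self, smul_eq_zero] at h3
  rw [killingForm_apply_apply]
  exact h3.resolve_left (Int.cast_ne_zero.2 h)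

variable [LieAlgebra.IsSemisimple 𝕜 𝔤]

/-- The element of `𝔤¹` representing a linear form on `𝔤₋` for the Killing form. -/
def sharp : (gr.neg →ₗ[𝕜] 𝕜) →ₗ[𝕜] 𝔤 :=
  ((killingForm 𝕜 𝔤).toDual
    (LieAlgebra.IsKilling.killingForm_nondegenerate 𝕜 𝔤)).symm.toLinearMap ∘ₗ
    LinearMap.lcomp 𝕜 𝕜 gr.negProj

lemma killingForm_sharp (α : gr.neg →ₗ[𝕜] 𝕜) (y : 𝔤) :
    killingForm 𝕜 𝔤 (gr.sharp α) y = α (gr.negProj y) :=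
  LinearMap.BilinForm.apply_toDual_symm_apply
    (hB := LieAlgebra.IsKilling.killingForm_nondegenerate 𝕜 𝔤) _ _

lemma killingForm_ext {x y : 𝔤} (h : ∀ z, killingForm 𝕜 𝔤 x z = killingForm 𝕜 𝔤 y z) : x = y :=
  sub_eq_zero.1 ((LieAlgebra.IsKilling.killingForm_nondegenerate 𝕜 𝔤).1 _ fun z ↦ by
    rw [map_sub, LinearMap.sub_apply, h, sub_self])

/-- The Killing form pairs degree `k` only with degree `-k`, so a form supported in degree `d` is
represented in degree `-d`. -/
lemma sharp_mem_piece {d : ℤ} (α : gr.neg →ₗ[𝕜] 𝕜)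
    (hα : ∀ j, j ≠ d → ∀ z : gr.neg, (z : 𝔤) ∈ gr.piece j → α z = 0) :
    gr.sharp α ∈ gr.piece (-d) := by
  have hk : ∀ (k j : ℤ) (w w' : 𝔤), w ∈ gr.piece k →
      killingForm 𝕜 𝔤 (gr.proj j w') w = if k + j = 0 then killingForm 𝕜 𝔤 w' w else 0 := by
    intro k j w w' hw
    split_ifs with h
    · conv_rhs => rw [← gr.sum_proj w', map_sum, LinearMap.sum_apply]
      by_cases hj : j ∈ Finset.Icc (-2 : ℤ) 2
      · refine (Finset.sum_eq_single_of_mem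
          (f := fun m ↦ killingForm 𝕜 𝔤 (gr.proj m w') w) j hj fun m _ hm ↦ ?_).symm
        exact gr.killingForm_eq_zero (gr.proj_mem m w') hw (by omega)
      · rw [Finset.mem_Icc] at hj
        rw [gr.eq_zero_of_mem hw (by rw [lt_abs]; omega)]
        simp
    · exact gr.killingForm_eq_zero (gr.proj_mem j w') hw (by omega)
  refine gr.mem_piece_of_forall_proj fun j hj ↦ killingForm_ext (𝕜 := 𝕜) fun w ↦ ?_
  rw [map_zero, LinearMap.zero_apply]
  induction w using gr.homogeneous_induction with
  | mem k w hw =>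
    rw [hk k j w _ hw]
    split_ifs with h
    · rw [gr.killingForm_sharp]
      exact hα k (by omega) _ (gr.coe_negProj_mem hw)
    · rfl
  | add x y hx hy => rw [map_add, hx, hy, add_zero]

variable {ι : Type*} [Fintype ι]

/-- The summand is bilinear in the pair (dual form, basis vector), so the sum is a contraction of
the canonical tensor and any basis may replace the chosen one. -/
lemma codiff2_apply (b : Module.Basis ι 𝕜 gr.neg) (ψ : gr.C2) (x : gr.neg) :
    gr.codiff2 ψ x = ∑ i, (⁅gr.sharp (b.coord i), ψ x (b i)⁆ -
      (2⁻¹ : 𝕜) • ψ (gr.negProj ⁅gr.sharp (b.coord i), (x : 𝔤)⁆) (b i)) :=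
  sum_coord_apply_eq (Module.finBasis 𝕜 gr.neg) b LinearMap.id
    (LinearMap.mk₂ 𝕜 (fun α z ↦ ⁅gr.sharp α, ψ x z⁆ -
      (2⁻¹ : 𝕜) • ψ (gr.negProj ⁅gr.sharp α, (x : 𝔤)⁆) z)
      (fun α β z ↦ by
        simp only [map_add, add_lie, LinearMap.add_apply, smul_add]
        abel)
      (fun c α z ↦ by
        simp only [map_smul, smul_lie, LinearMap.smul_apply, smul_sub, smul_comm c (2⁻¹ : 𝕜)])
      (fun α z w ↦ by
        simp only [map_add, lie_add, smul_add]
        abel)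
      (fun c α z ↦ by
        simp only [map_smul, lie_smul, smul_sub, smul_comm c (2⁻¹ : 𝕜)]))

lemma codiff3_apply (b : Module.Basis ι 𝕜 gr.neg) (φ : gr.C3) (x y : gr.neg) :
    gr.codiff3 φ x y = ∑ i, (⁅gr.sharp (b.coord i), φ.1 x y (b i)⁆ -
      (2⁻¹ : 𝕜) • φ.1 (gr.negProj ⁅gr.sharp (b.coord i), (x : 𝔤)⁆) y (b i) -
      (2⁻¹ : 𝕜) • φ.1 x (gr.negProj ⁅gr.sharp (b.coord i), (y : 𝔤)⁆) (b i)) :=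
  sum_coord_apply_eq (Module.finBasis 𝕜 gr.neg) b LinearMap.id
    (LinearMap.mk₂ 𝕜 (fun α z ↦ ⁅gr.sharp α, φ.1 x y z⁆ -
      (2⁻¹ : 𝕜) • φ.1 (gr.negProj ⁅gr.sharp α, (x : 𝔤)⁆) y z -
      (2⁻¹ : 𝕜) • φ.1 x (gr.negProj ⁅gr.sharp α, (y : 𝔤)⁆) z)
      (fun α β z ↦ by
        simp only [map_add, add_lie, LinearMap.add_apply, smul_add]
        abel)
      (fun c α z ↦ by
        simp only [map_smul, smul_lie, LinearMap.smul_apply, smul_sub, smul_comm c (2⁻¹ : 𝕜)])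
      (fun α z w ↦ by
        simp only [map_add, lie_add, smul_add]
        abel)
      (fun c α z ↦ by
        simp only [map_smul, lie_smul, smul_sub, smul_comm c (2⁻¹ : 𝕜)]))

/-- For a homogeneous basis the coordinate form is an eigenvector of the transposed grading
derivation, hence vanishes on all degrees other than `d i`. -/
lemma sharp_coord_mem_piece (b : Module.Basis ι 𝕜 gr.neg) (d : ι → ℤ)
    (hd : ∀ i, (b i : 𝔤) ∈ gr.piece (d i)) (i : ι) : gr.sharp (b.coord i) ∈ gr.piece (-d i) := by
  refine gr.sharp_mem_piece _ fun j hj z hz ↦ ?_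
  have h : b.coord i ∘ₗ gr.negProj ∘ₗ gr.degree ∘ₗ gr.neg.toSubmodule.subtype =
      (d i : 𝕜) • b.coord i := b.ext fun k ↦ by
    change b.coord i (gr.negProj (gr.degree (b k : 𝔤))) = (d i : 𝕜) • b.coord i (b k)
    rw [gr.degree_apply (hd k), map_smul, map_smul, negProj_coe]
    rcases eq_or_ne k i with rfl | h
    · rfl
    · simp [h]
  have h1 : b.coord i (gr.negProj (gr.degree (z : 𝔤))) = (d i : 𝕜) • b.coord i z :=
    congrArg (fun f : gr.neg →ₗ[𝕜] 𝕜 ↦ f z) h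
  rw [gr.degree_apply hz, map_smul, map_smul, negProj_coe] at h1
  by_contra h0
  exact hj (Int.cast_injective (smul_left_injective 𝕜 h0 h1))

lemma degree_basis (b : Module.Basis ι 𝕜 gr.neg) (d : ι → ℤ)
    (hd : ∀ i, (b i : 𝔤) ∈ gr.piece (d i)) (i : ι) : d i = -2 ∨ d i = -1 := by
  by_contra! h
  refine b.ne_zero i (Subtype.ext ?_)
  by_cases h0 : d i < 0
  · exact gr.eq_zero_of_mem (hd i) (by rw [lt_abs]; omega)
  · change (b i : 𝔤) = 0
    rw [← gr.proj_self (hd i)]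
    exact gr.mem_neg_iff.1 (b i).2 _ (not_lt.1 h0)

/-- The codifferential respects homogeneity. -/
lemma codiff2_homComp (b : Module.Basis ι 𝕜 gr.neg) (d : ι → ℤ)
    (hd : ∀ i, (b i : 𝔤) ∈ gr.piece (d i)) (l : ℤ) (ψ : gr.C2) {i : ℤ} (hi : i = -2 ∨ i = -1)
    {x : gr.neg} (hx : (x : 𝔤) ∈ gr.piece i) :
    gr.codiff2 (gr.homComp l ψ) x = gr.proj (i + l) (gr.codiff2 ψ x) := by
  rw [gr.codiff2_apply b, gr.codiff2_apply b, map_sum]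
  refine Finset.sum_congr rfl fun k _ ↦ ?_
  have hs := gr.sharp_coord_mem_piece b d hd k
  have hk := gr.degree_basis b d hd k
  rw [map_sub, map_smul, gr.homComp_apply ψ hx (hd k) hi hk, gr.proj_lie hs,
    show i + l - -d k = i + d k + l by ring]
  congr 2
  have hz := gr.coe_negProj_mem (gr.lie_mem hs hx)
  -- The bracket of an element of degree `-d k` with `x` may leave `𝔤₋`. It then has degree `≥ 0`,
  -- and `negProj` removes it.
  by_cases h : -d k + i = -2 ∨ -d k + i = -1
  · rw [gr.homComp_apply ψ hz (hd k) h hk, show -d k + i + d k + l = i + l by ring]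
  · have : gr.negProj ⁅gr.sharp (b.coord k), (x : 𝔤)⁆ = 0 := by
      rw [gr.negProj_eq_zero_iff]
      refine gr.piece_le_filt ?_ (gr.lie_mem hs hx)
      omega
    rw [this]
    simp

lemma codiff2_homComp_eq_zero (b : Module.Basis ι 𝕜 gr.neg) (d : ι → ℤ)
    (hd : ∀ i, (b i : 𝔤) ∈ gr.piece (d i)) (l : ℤ) {ψ : gr.C2} (h : gr.codiff2 ψ = 0) :
    gr.codiff2 (gr.homComp l ψ) = 0 := by
  ext x
  change gr.codiff2 (gr.homComp l ψ) x = 0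
  induction x using gr.neg_induction with
  | mem i hi x hx =>
    rw [gr.codiff2_homComp b d hd l ψ hi hx, h]
    exact map_zero _
  | add x y hx hy => rw [map_add, hx, hy, add_zero]

/-! ### Equivariance under graded automorphisms -/

variable (θ : 𝔤 ≃ₗ⁅𝕜⁆ 𝔤) (hθ : ∀ i, ∀ x ∈ gr.piece i, θ x ∈ gr.piece i)

include hθ

lemma proj_equiv (i : ℤ) (x : 𝔤) : gr.proj i (θ x) = θ (gr.proj i x) := by
  induction x using gr.homogeneous_induction with
  | mem j x hx =>
    rw [gr.proj_apply_of_mem hx, gr.proj_apply_of_mem (hθ j x hx)]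
    split_ifs
    · rfl
    · exact (map_zero θ).symm
  | add x y hx hy => simp only [map_add, hx, hy]

lemma symm_mem_piece (i : ℤ) (x : 𝔤) (hx : x ∈ gr.piece i) : θ.symm x ∈ gr.piece i := by
  refine gr.mem_piece_of_forall_proj fun j hj ↦ (show Function.Injective θ from θ.injective) ?_
  rw [← gr.proj_equiv θ hθ, θ.apply_symm_apply, map_zero, gr.proj_of_ne hx hj.symm]

/-- The automorphism of `𝔤₋` induced by a graded automorphism of `𝔤`. -/
def negEquiv : gr.neg ≃ₗ[𝕜] gr.neg where
  toFun x := ⟨θ x, gr.mem_neg_iff.2 fun j hj ↦ by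
    rw [gr.proj_equiv θ hθ, gr.mem_neg_iff.1 x.2 j hj, map_zero]⟩
  map_add' x y := Subtype.ext (map_add θ _ _)
  map_smul' c x := Subtype.ext (map_smul θ c _)
  invFun x := ⟨θ.symm x, gr.mem_neg_iff.2 fun j hj ↦ by
    rw [gr.proj_equiv θ.symm (gr.symm_mem_piece θ hθ), gr.mem_neg_iff.1 x.2 j hj, map_zero]⟩
  left_inv x := Subtype.ext (θ.symm_apply_apply _)
  right_inv x := Subtype.ext (θ.apply_symm_apply _)

lemma coe_negEquiv (x : gr.neg) : (gr.negEquiv θ hθ x : 𝔤) = θ x := rfl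

lemma negProj_equiv (x : 𝔤) : gr.negProj (θ x) = gr.negEquiv θ hθ (gr.negProj x) :=
  Subtype.ext (by
    rw [coe_negEquiv, coe_negProj, coe_negProj, gr.proj_equiv θ hθ, gr.proj_equiv θ hθ, map_add])

/-- Lie algebra automorphisms preserve the Killing form, so the dual basis of the image basis is the
image of the dual basis. -/
lemma sharp_map_coord (b : Module.Basis ι 𝕜 gr.neg) (i : ι) :
    gr.sharp ((b.map (gr.negEquiv θ hθ)).coord i) = θ (gr.sharp (b.coord i)) := by
  refine killingForm_ext (𝕜 := 𝕜) fun z ↦ ?_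
  obtain ⟨z, rfl⟩ : ∃ z', θ z' = z := θ.surjective z
  rw [LieAlgebra.killingForm_of_equiv_apply, killingForm_sharp, killingForm_sharp,
    gr.negProj_equiv θ hθ]
  simp

lemma codiff2_equiv {ψ ψ' : gr.C2}
    (h : ∀ x y, ψ' (gr.negEquiv θ hθ x) (gr.negEquiv θ hθ y) = θ (ψ x y)) (x : gr.neg) :
    gr.codiff2 ψ' (gr.negEquiv θ hθ x) = θ (gr.codiff2 ψ x) := by
  let b := Module.finBasis 𝕜 gr.neg
  rw [gr.codiff2_apply b ψ, gr.codiff2_apply (b.map (gr.negEquiv θ hθ)) ψ', map_sum]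
  refine Finset.sum_congr rfl fun i _ ↦ ?_
  rw [gr.sharp_map_coord θ hθ, Module.Basis.map_apply, h, coe_negEquiv, ← LieEquiv.map_lie,
    ← LieEquiv.map_lie, gr.negProj_equiv θ hθ, h, map_sub, map_smul]

lemma codiff3_equiv {φ φ' : gr.C3}
    (h : ∀ x y z, φ'.1 (gr.negEquiv θ hθ x) (gr.negEquiv θ hθ y) (gr.negEquiv θ hθ z) =
      θ (φ.1 x y z)) (x y : gr.neg) :
    gr.codiff3 φ' (gr.negEquiv θ hθ x) (gr.negEquiv θ hθ y) = θ (gr.codiff3 φ x y) := by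
  let b := Module.finBasis 𝕜 gr.neg
  rw [gr.codiff3_apply b φ, gr.codiff3_apply (b.map (gr.negEquiv θ hθ)) φ', map_sum]
  refine Finset.sum_congr rfl fun i _ ↦ ?_
  simp only [gr.sharp_map_coord θ hθ, Module.Basis.map_apply, h, coe_negEquiv, ← LieEquiv.map_lie,
    gr.negProj_equiv θ hθ, map_sub, map_smul]

lemma exists_equiv_cochain₃ (φ : gr.C3) : ∃ φ' : gr.C3, ∀ x y z,
    φ'.1 (gr.negEquiv θ hθ x) (gr.negEquiv θ hθ y) (gr.negEquiv θ hθ z) = θ (φ.1 x y z) := by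
  let e := (gr.negEquiv θ hθ).symm
  refine ⟨⟨LinearMap.mk₂ 𝕜 (fun x y ↦ θ.toLinearEquiv.toLinearMap ∘ₗ φ.1 (e x) (e y) ∘ₗ
    e.toLinearMap) ?_ ?_ ?_ ?_, fun x y ↦ ?_⟩, fun x y z ↦ ?_⟩
  · intros; ext; simp
  · intros; ext; simp
  · intros; ext; simp
  · intros; ext; simp
  · change θ (φ.1 (e x) (e x) (e y)) = 0 ∧ θ (φ.1 (e x) (e y) (e y)) = 0
    rw [(φ.2 _ _).1, (φ.2 _ _).2, map_zero]
    exact ⟨rfl, rfl⟩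
  · change θ (φ.1 (e _) (e _) (e _)) = _
    simp [e]

end Codifferential
end TwoGrading
namespace TwoGrading

/-! ### Adjointness of the differential and the codifferential -/

section Hodge

variable {𝕜 : Type*} [RCLike 𝕜] {𝔤 : Type*} [LieRing 𝔤] [LieAlgebra 𝕜 𝔤] (gr : TwoGrading 𝕜 𝔤)
  [FiniteDimensional 𝕜 𝔤] [LieAlgebra.IsSemisimple 𝕜 𝔤]

/-- A graded transposition of a graded semisimple Lie algebra: a conjugate-linear involutive
anti-automorphism that is positive for the Killing form and reverses the grading. -/
structure Transposition where
  toMap : 𝔤 →ₛₗ[starRingEnd 𝕜] 𝔤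
  map_lie : ∀ x y, toMap ⁅x, y⁆ = ⁅toMap y, toMap x⁆
  involutive : ∀ x, toMap (toMap x) = x
  killingForm_map : ∀ x y,
    killingForm 𝕜 𝔤 (toMap x) (toMap y) = starRingEnd 𝕜 (killingForm 𝕜 𝔤 x y)
  pos : ∀ x, x ≠ 0 → 0 < RCLike.re (killingForm 𝕜 𝔤 (toMap x) x)
  map_mem : ∀ i, ∀ x ∈ gr.piece i, toMap x ∈ gr.piece (-i)

/-- The general transposition is applied to the grading derivation and a basis of homogeneous
elements. It negates the eigenvalues of that derivation, so it reverses the grading. -/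
lemma exists_transposition : Nonempty gr.Transposition := by
  classical
  let b := gr.isInternal.collectedBasis fun i ↦ Module.finBasis 𝕜 (gr.piece i)
  have : Finite (Σ i, Fin (Module.finrank 𝕜 (gr.piece i))) := Module.Finite.finite_basis b
  have := Fintype.ofFinite (Σ i, Fin (Module.finrank 𝕜 (gr.piece i)))
  obtain ⟨σ, h1, h2, h3, h4, h5⟩ := CartanGeom.exists_transposition b (fun i ↦ (i.1 : ℝ)) gr.degree
    (fun i ↦ by
      rw [gr.degree_apply (gr.isInternal.collectedBasis_mem _ i)]
      push_cast
      rfl) gr.degree_lie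
  refine ⟨⟨σ, h1, h2, h3, fun x hx ↦ ?_, fun i x hx ↦ ?_⟩⟩
  · rw [killingForm, LieModule.traceForm_comm]
    exact h4 x hx
  · rcases eq_or_ne x 0 with rfl | hx0
    · rw [map_zero]
      exact zero_mem _
    have h6 := h5 i x (by rw [gr.degree_apply hx]; push_cast; rfl)
    have h7 : σ x ≠ 0 := fun h ↦ hx0 (by rw [← h2 x, h, map_zero])
    obtain ⟨k, hk, hm⟩ := gr.mem_piece_of_degree_apply (μ := ((-i : ℤ) : 𝕜)) h7 (by
      rw [h6]; push_cast; rw [neg_smul])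
    rwa [Int.cast_injective hk] at hm

variable {gr} (σ : gr.Transposition)

namespace Transposition

lemma conj_killingForm (x y : 𝔤) : starRingEnd 𝕜 (killingForm 𝕜 𝔤 (σ.toMap x) y) =
    killingForm 𝕜 𝔤 (σ.toMap y) x := by
  rw [← σ.killingForm_map, σ.involutive, killingForm, LieModule.traceForm_comm]

lemma killingForm_map_eq_zero {i j : ℤ} {x y : 𝔤} (hx : x ∈ gr.piece i) (hy : y ∈ gr.piece j)
    (h : i ≠ j) : killingForm 𝕜 𝔤 (σ.toMap x) y = 0 :=
  gr.killingForm_eq_zero (σ.map_mem i x hx) hy (by omega)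

lemma killingForm_map_proj (x y : 𝔤) (i : ℤ) :
    killingForm 𝕜 𝔤 (σ.toMap x) (gr.proj i y) =
      killingForm 𝕜 𝔤 (σ.toMap (gr.proj i x)) (gr.proj i y) := by
  induction x using gr.homogeneous_induction with
  | mem j x hx =>
    rw [gr.proj_apply_of_mem hx]
    split_ifs with h
    · rfl
    · rw [σ.killingForm_map_eq_zero hx (gr.proj_mem i y) h, map_zero, map_zero]
      rfl
  | add x z hx hz => simp only [map_add, LinearMap.add_apply, hx, hz]

lemma killingForm_map_degree (x y : 𝔤) :
    killingForm 𝕜 𝔤 (σ.toMap (gr.degree x)) y = killingForm 𝕜 𝔤 (σ.toMap x) (gr.degree y) := by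
  induction x using gr.homogeneous_induction with
  | mem i x hx =>
    induction y using gr.homogeneous_induction with
    | mem j y hy =>
      rw [gr.degree_apply hx, gr.degree_apply hy, map_smulₛₗ, map_smul, map_smul,
        LinearMap.smul_apply, map_intCast]
      rcases eq_or_ne i j with rfl | h
      · rfl
      · rw [σ.killingForm_map_eq_zero hx hy h, smul_zero, smul_zero]
    | add y z hy hz => rw [map_add, hy, hz, map_add, map_add]
  | add x z hx hz => simp only [map_add, LinearMap.add_apply, hx, hz]

/-- The Hermitian inner product on `𝔤₋` given by a graded transposition. -/
@[reducible] def innerCore : InnerProductSpace.Core 𝕜 gr.neg where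
  inner x y := killingForm 𝕜 𝔤 (σ.toMap (x : 𝔤)) y
  conj_inner_symm x y := σ.conj_killingForm _ _
  re_inner_nonneg x := by
    rcases eq_or_ne (x : 𝔤) 0 with h | h
    · simp [h]
    · exact (σ.pos _ h).le
  add_left x y z := by simp
  smul_left x y r := by simp
  definite x h := by
    by_contra h0
    have := σ.pos (x : 𝔤) fun h ↦ h0 (Subtype.ext h)
    rw [h] at this
    simp at this

/-- The grading derivation is symmetric for the Hermitian form on `𝔤₋`, so the spectral theorem
gives an orthonormal eigenbasis, and eigenvectors are homogeneous. -/
lemma exists_orthonormal_basis : ∃ (n : ℕ) (b : Module.Basis (Fin n) 𝕜 gr.neg) (d : Fin n → ℤ),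
    (∀ i, (b i : 𝔤) ∈ gr.piece (d i)) ∧
    ∀ i j, killingForm 𝕜 𝔤 (σ.toMap (b i : 𝔤)) (b j : 𝔤) = if i = j then 1 else 0 := by
  let : NormedAddCommGroup gr.neg := σ.innerCore.toNormedAddCommGroup
  let : InnerProductSpace 𝕜 gr.neg := InnerProductSpace.ofCore σ.innerCore.toCore
  let T : gr.neg →ₗ[𝕜] gr.neg := gr.negProj ∘ₗ gr.degree ∘ₗ gr.neg.toSubmodule.subtype
  have hTc : ∀ x : gr.neg, (T x : 𝔤) = gr.degree (x : 𝔤) := fun x ↦ by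
    refine congrArg Subtype.val (gr.negProj_eq_iff (y := ⟨gr.degree (x : 𝔤), ?_⟩).2 fun i _ ↦ rfl)
    exact gr.mem_neg_iff.2 fun j hj ↦ by
      rw [gr.proj_degree, gr.mem_neg_iff.1 x.2 j hj, smul_zero]
  have hT : T.IsSymmetric := fun x y ↦ by
    change killingForm 𝕜 𝔤 (σ.toMap (T x : 𝔤)) (y : 𝔤) = killingForm 𝕜 𝔤 (σ.toMap (x : 𝔤)) (T y : 𝔤)
    rw [hTc, hTc, σ.killingForm_map_degree]
  let b := hT.eigenvectorBasis rfl
  have hb : ∀ i, ∃ d : ℤ, (b i : 𝔤) ∈ gr.piece d := fun i ↦ by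
    have h1 : (T (b i) : 𝔤) = (hT.eigenvalues rfl i : 𝕜) • (b i : 𝔤) :=
      congrArg Subtype.val (hT.apply_eigenvectorBasis rfl i)
    rw [hTc] at h1
    obtain ⟨d, -, hd⟩ := gr.mem_piece_of_degree_apply (fun h ↦ b.toBasis.ne_zero i (by
      rw [b.coe_toBasis]
      exact Subtype.ext h)) h1
    exact ⟨d, hd⟩
  choose d hd using hb
  refine ⟨_, b.toBasis, d, fun i ↦ by rw [b.coe_toBasis]; exact hd i, fun i j ↦ ?_⟩
  rw [b.coe_toBasis]
  exact orthonormal_iff_ite.1 b.orthonormal i j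

variable {ι : Type*} [Fintype ι] [DecidableEq ι] (b : Module.Basis ι 𝕜 gr.neg) (d : ι → ℤ)
  (hd : ∀ i, (b i : 𝔤) ∈ gr.piece (d i))
  (hb : ∀ i j, killingForm 𝕜 𝔤 (σ.toMap (b i : 𝔤)) (b j : 𝔤) = if i = j then 1 else 0)

include hb in
lemma sum_killingForm_smul (z : gr.neg) :
    ∑ i, killingForm 𝕜 𝔤 (σ.toMap (b i : 𝔤)) z • b i = z := by
  have h : ∑ i, (killingForm 𝕜 𝔤 (σ.toMap (b i : 𝔤)) ∘ₗ gr.neg.toSubmodule.subtype).smulRight (b i) =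
      (LinearMap.id : gr.neg →ₗ[𝕜] gr.neg) := b.ext fun j ↦ by
    rw [LinearMap.sum_apply]
    change ∑ i, killingForm 𝕜 𝔤 (σ.toMap (b i : 𝔤)) (b j) • b i = b j
    simp [hb]
  have := congrArg (fun f : gr.neg →ₗ[𝕜] gr.neg ↦ f z) h
  rw [LinearMap.sum_apply] at this
  exact this

-- For an orthonormal homogeneous basis the Killing-dual basis is its image under `σ`. This turns
-- brackets with `z^l` into adjoints of brackets with `z_l`.
include hd hb in
lemma sharp_coord (i : ι) : gr.sharp (b.coord i) = σ.toMap (b i : 𝔤) := by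
  refine killingForm_ext (𝕜 := 𝕜) fun z ↦ ?_
  rw [gr.killingForm_sharp]
  have h0 : killingForm 𝕜 𝔤 (σ.toMap (b i : 𝔤)) (z - gr.negProj z) = 0 := by
    rw [← gr.sum_proj (z - gr.negProj z), map_sum]
    refine Finset.sum_eq_zero fun j _ ↦ ?_
    have := gr.degree_basis b d hd i
    by_cases hj : j < 0
    · rw [gr.mem_filt_iff.1 (gr.sub_negProj_mem z) j hj, map_zero]
    · exact σ.killingForm_map_eq_zero (hd i) (gr.proj_mem j _) (by omega)
  rw [map_sub, sub_eq_zero] at h0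
  rw [h0, ← σ.sum_killingForm_smul b hb (gr.negProj z), map_sum]
  simp only [map_smul, Module.Basis.coord_apply, Module.Basis.repr_self, smul_eq_mul]
  rw [σ.sum_killingForm_smul b hb]
  simp [Finsupp.single_apply]

end Transposition

lemma C3.swap₁₂ (φ : gr.C3) (x y z : gr.neg) : φ.1 y x z = -φ.1 x y z := by
  have := (φ.2 (x + y) z).1
  simp only [map_add, LinearMap.add_apply, (φ.2 x z).1, (φ.2 y z).1, zero_add, add_zero] at this
  exact eq_neg_of_add_eq_zero_left this

lemma C3.swap₂₃ (φ : gr.C3) (x y z : gr.neg) : φ.1 x z y = -φ.1 x y z := by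
  have := (φ.2 x (y + z)).2
  simp only [map_add, LinearMap.add_apply, (φ.2 x z).2, (φ.2 x y).2, zero_add, add_zero] at this
  exact eq_neg_of_add_eq_zero_left this

lemma C3.rotate (φ : gr.C3) (x y z : gr.neg) : φ.1 y z x = φ.1 x y z := by
  rw [C3.swap₂₃, C3.swap₁₂, neg_neg]

namespace Transposition

variable {ι : Type*} [Fintype ι] [DecidableEq ι] (b : Module.Basis ι 𝕜 gr.neg) (d : ι → ℤ)
  (hd : ∀ i, (b i : 𝔤) ∈ gr.piece (d i))
  (hb : ∀ i j, killingForm 𝕜 𝔤 (σ.toMap (b i : 𝔤)) (b j : 𝔤) = if i = j then 1 else 0)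

include hd hb

/-- Images of the codifferential are orthogonal to cocycles. -/
lemma sum_codiff3_eq_zero (φ : gr.C3) {ψ : gr.C2} (hψ : gr.diff ψ = 0) :
    ∑ i, ∑ j, killingForm 𝕜 𝔤 (σ.toMap (gr.codiff3 φ (b i) (b j))) (ψ (b i) (b j)) = 0 := by
  let a : ι → ι → ι → 𝕜 := fun i j l ↦
    killingForm 𝕜 𝔤 (σ.toMap (φ.1 (b i) (b j) (b l))) ⁅(b l : 𝔤), ψ (b i) (b j)⁆
  let t : ι → ι → ι → 𝕜 := fun i j l ↦
    killingForm 𝕜 𝔤 (σ.toMap (φ.1 (b i) (b j) (b l))) (ψ ⁅b i, b j⁆ (b l))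
  have rot : ∀ f : ι → ι → ι → 𝕜, ∑ i, ∑ j, ∑ l, f j l i = ∑ i, ∑ j, ∑ l, f i j l := fun f ↦ by
    rw [Finset.sum_comm]
    exact Finset.sum_congr rfl fun i _ ↦ Finset.sum_comm
  have swap : ∀ f : ι → ι → ι → 𝕜, ∑ i, ∑ j, ∑ l, f i l j = ∑ i, ∑ j, ∑ l, f i j l := fun f ↦
    Finset.sum_congr rfl fun i _ ↦ Finset.sum_comm
  -- Pairing `φ` with `∂ψ = 0` gives six sums. Permuting indices and using that `φ` is alternating
  -- makes each equal to `± ∑ a` or `± ∑ t`, so `3 ∑ a - 3 ∑ t = 0`.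
  have h1 : ∑ i, ∑ j, ∑ l, a i j l = ∑ i, ∑ j, ∑ l, t i j l := by
    have h0 : ∑ i, ∑ j, ∑ l, killingForm 𝕜 𝔤 (σ.toMap (φ.1 (b i) (b j) (b l)))
        (gr.diff ψ (b i) (b j) (b l)) = 0 := by
      simp [hψ]
    have h2 : ∀ i j l, killingForm 𝕜 𝔤 (σ.toMap (φ.1 (b i) (b j) (b l)))
        (gr.diff ψ (b i) (b j) (b l)) =
        a j l i + a i l j + a i j l - t i j l - t i l j - t j l i := fun i j l ↦ by
      simp only [a, t, LieModule.Cohomology.d₂₃_apply, C3.rotate φ (b i) (b j) (b l),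
        C3.swap₂₃ φ (b i) (b j) (b l), map_neg, map_add, map_sub, LinearMap.neg_apply]
      simp only [LieSubalgebra.coe_bracket_of_module]
      ring
    simp only [h2, Finset.sum_sub_distrib, Finset.sum_add_distrib] at h0
    rw [rot a, swap a, swap t, rot t] at h0
    linear_combination (1 / 3) * h0
  have h3 : ∀ i j, killingForm 𝕜 𝔤 (σ.toMap (gr.codiff3 φ (b i) (b j))) (ψ (b i) (b j)) =
      ∑ l, a i j l - 2⁻¹ * (∑ l, killingForm 𝕜 𝔤 (σ.toMap (φ.1
        (gr.negProj ⁅σ.toMap (b l : 𝔤), (b i : 𝔤)⁆) (b j) (b l))) (ψ (b i) (b j))) -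
      2⁻¹ * (∑ l, killingForm 𝕜 𝔤 (σ.toMap (φ.1 (b i)
        (gr.negProj ⁅σ.toMap (b l : 𝔤), (b j : 𝔤)⁆) (b l))) (ψ (b i) (b j))) := fun i j ↦ by
    rw [gr.codiff3_apply b, map_sum, map_sum, LinearMap.sum_apply, Finset.mul_sum, Finset.mul_sum,
      ← Finset.sum_sub_distrib, ← Finset.sum_sub_distrib]
    refine Finset.sum_congr rfl fun l _ ↦ ?_
    rw [σ.sharp_coord b d hd hb]
    simp only [map_sub, map_smulₛₗ, map_inv₀, map_ofNat, LinearMap.sub_apply, LinearMap.smul_apply,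
      smul_eq_mul, σ.map_lie, σ.involutive, a]
    rw [killingForm, LieModule.traceForm_apply_lie_apply]
  -- In the orthonormal basis, `x ↦ [σ b_l, x]₋` is the adjoint of `ad b_l` on `𝔤₋`, by invariance
  -- of the Killing form.
  have coef : ∀ l i m : ι, starRingEnd 𝕜 (killingForm 𝕜 𝔤 (σ.toMap (b m : 𝔤))
      (gr.negProj ⁅σ.toMap (b l : 𝔤), (b i : 𝔤)⁆)) =
      killingForm 𝕜 𝔤 (σ.toMap (b i : 𝔤)) (⁅b l, b m⁆ : gr.neg) := fun l i m ↦ by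
    rw [← σ.sharp_coord b d hd hb m, killingForm_sharp, negProj_coe, ← killingForm_sharp,
      σ.sharp_coord b d hd hb m, σ.conj_killingForm, σ.map_lie, σ.involutive, killingForm,
      LieModule.traceForm_apply_lie_apply]
    rfl
  have h4 : ∀ (χ : gr.neg →ₗ[𝕜] 𝔤) (j l : ι), ∑ i, killingForm 𝕜 𝔤 (σ.toMap (χ
      (gr.negProj ⁅σ.toMap (b l : 𝔤), (b i : 𝔤)⁆))) (ψ (b i) (b j)) =
      ∑ m, killingForm 𝕜 𝔤 (σ.toMap (χ (b m))) (ψ ⁅b l, b m⁆ (b j)) := fun χ j l ↦ by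
    have h5 : ∀ i, killingForm 𝕜 𝔤 (σ.toMap (χ (gr.negProj ⁅σ.toMap (b l : 𝔤), (b i : 𝔤)⁆)))
        (ψ (b i) (b j)) = ∑ m, killingForm 𝕜 𝔤 (σ.toMap (b i : 𝔤)) (⁅b l, b m⁆ : gr.neg) *
          killingForm 𝕜 𝔤 (σ.toMap (χ (b m))) (ψ (b i) (b j)) := fun i ↦ by
      rw [← σ.sum_killingForm_smul b hb (gr.negProj ⁅σ.toMap (b l : 𝔤), (b i : 𝔤)⁆)]
      simp only [map_sum, map_smul, map_smulₛₗ, coef, LinearMap.sum_apply, LinearMap.smul_apply,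
        smul_eq_mul]
    simp only [h5]
    rw [Finset.sum_comm]
    refine Finset.sum_congr rfl fun m _ ↦ ?_
    conv_rhs => rw [← σ.sum_killingForm_smul b hb ⁅b l, b m⁆]
    simp only [map_sum, map_smul, LinearMap.sum_apply, LinearMap.smul_apply, smul_eq_mul]
  have hX : ∑ i, ∑ j, ∑ l, killingForm 𝕜 𝔤 (σ.toMap (φ.1
      (gr.negProj ⁅σ.toMap (b l : 𝔤), (b i : 𝔤)⁆) (b j) (b l))) (ψ (b i) (b j)) =
      ∑ i, ∑ j, ∑ l, t i j l := by
    rw [← rot t]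
    refine (rot fun p q r ↦ killingForm 𝕜 𝔤 (σ.toMap (φ.1
      (gr.negProj ⁅σ.toMap (b q : 𝔤), (b r : 𝔤)⁆) (b p) (b q))) (ψ (b r) (b p))).trans ?_
    refine Finset.sum_congr rfl fun j _ ↦ Finset.sum_congr rfl fun l _ ↦ ?_
    refine (h4 ((φ.1.flip (b j)).flip (b l)) j l).trans (Finset.sum_congr rfl fun m _ ↦ ?_)
    simp only [LinearMap.flip_apply, t]
    rw [C3.rotate φ (b l) (b m) (b j)]
  have hY : ∑ i, ∑ j, ∑ l, killingForm 𝕜 𝔤 (σ.toMap (φ.1 (b i)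
      (gr.negProj ⁅σ.toMap (b l : 𝔤), (b j : 𝔤)⁆) (b l))) (ψ (b i) (b j)) =
      ∑ i, ∑ j, ∑ l, t i j l := by
    rw [← rot t]
    refine (swap fun p q r ↦ killingForm 𝕜 𝔤 (σ.toMap (φ.1 (b p)
      (gr.negProj ⁅σ.toMap (b q : 𝔤), (b r : 𝔤)⁆) (b q))) (ψ (b p) (b r))).trans ?_
    refine Finset.sum_congr rfl fun i _ ↦ Finset.sum_congr rfl fun l _ ↦ ?_
    rw [← neg_inj, ← Finset.sum_neg_distrib]
    refine Eq.trans (Finset.sum_congr rfl fun j _ ↦ ?_)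
      ((h4 ((φ.1 (b i)).flip (b l)) i l).trans ?_)
    · rw [← map_neg, LieModule.Cohomology.twoCochain_skew, LinearMap.flip_apply]
    · rw [← Finset.sum_neg_distrib]
      refine Finset.sum_congr rfl fun m _ ↦ ?_
      simp only [LinearMap.flip_apply, t]
      rw [← C3.rotate φ (b i) (b m) (b l), C3.swap₁₂ φ (b l) (b m) (b i), map_neg, map_neg,
        LinearMap.neg_apply]
  -- Each of the two terms with factor `½` contributes `½ ∑ t`, so the total is `∑ a - ∑ t = 0`.
  simp only [h3, Finset.sum_sub_distrib, ← Finset.mul_sum]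
  rw [hX, hY, h1]
  ring

/-- A coboundary whose component of homogeneity `l` is a cocycle has no such component. -/
lemma homComp_codiff3_eq_zero (φ : gr.C3) (l : ℤ)
    (h : gr.diff (gr.homComp l (gr.codiff3 φ)) = 0) : gr.homComp l (gr.codiff3 φ) = 0 := by
  have h0 := σ.sum_codiff3_eq_zero b d hd hb φ h
  -- Distinct degrees are orthogonal, so pairing `∂^*φ` with its component of homogeneity `l` leaves
  -- the squared norm of that component.
  have h1 : ∀ i j, killingForm 𝕜 𝔤 (σ.toMap (gr.codiff3 φ (b i) (b j)))
      (gr.homComp l (gr.codiff3 φ) (b i) (b j)) =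
      killingForm 𝕜 𝔤 (σ.toMap (gr.homComp l (gr.codiff3 φ) (b i) (b j)))
        (gr.homComp l (gr.codiff3 φ) (b i) (b j)) := fun i j ↦ by
    rw [gr.homComp_apply _ (hd i) (hd j) (gr.degree_basis b d hd i) (gr.degree_basis b d hd j),
      σ.killingForm_map_proj]
  simp only [h1] at h0
  have hnn : ∀ x, 0 ≤ RCLike.re (killingForm 𝕜 𝔤 (σ.toMap x) x) := fun x ↦ by
    rcases eq_or_ne x 0 with rfl | hx
    · simp
    · exact (σ.pos x hx).le
  have h2 := congrArg RCLike.re h0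
  simp only [map_sum, map_zero] at h2
  have h3 : ∀ i j, gr.homComp l (gr.codiff3 φ) (b i) (b j) = 0 := fun i j ↦ by
    have h4 := (Finset.sum_eq_zero_iff_of_nonneg fun i _ ↦ Finset.sum_nonneg fun j _ ↦ hnn _).1 h2 i
      (Finset.mem_univ i)
    have h5 := (Finset.sum_eq_zero_iff_of_nonneg fun j _ ↦ hnn _).1 h4 j (Finset.mem_univ j)
    by_contra h6
    exact (σ.pos _ h6).ne' h5
  exact Subtype.ext (b.ext fun i ↦ b.ext fun j ↦ h3 i j)

end Transposition
end Hodge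
end TwoGrading

/-! ### Related vector fields and the adjoint representation -/

section Comp

variable {𝕜 : Type*} [RCLike 𝕜] {EX : Type*} [NormedAddCommGroup EX] [NormedSpace 𝕜 EX]
  {X : Type*} [TopologicalSpace X] [ChartedSpace EX X]
  {EY : Type*} [NormedAddCommGroup EY] [NormedSpace 𝕜 EY]
  {Y : Type*} [TopologicalSpace Y] [ChartedSpace EY Y]

/-- The chain rule between model spaces with the intermediate point prescribed separately, for base
points such as `h * 1` and `h` that agree only after rewriting. -/
lemma mfderiv_comp_of_apply_eq {EZ : Type*} [NormedAddCommGroup EZ] [NormedSpace 𝕜 EZ] {Z : Type*}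
    [TopologicalSpace Z] [ChartedSpace EZ Z] {f : X → Y} {g : Y → Z} {x : X} {y : Y}
    (hg : MDifferentiableAt 𝓘(𝕜, EY) 𝓘(𝕜, EZ) g y) (hf : MDifferentiableAt 𝓘(𝕜, EX) 𝓘(𝕜, EY) f x)
    (h : f x = y) : (mfderiv 𝓘(𝕜, EX) 𝓘(𝕜, EZ) (g ∘ f) x : EX →L[𝕜] EZ) =
      (mfderiv 𝓘(𝕜, EY) 𝓘(𝕜, EZ) g y : EY →L[𝕜] EZ).comp
        (mfderiv 𝓘(𝕜, EX) 𝓘(𝕜, EY) f x : EX →L[𝕜] EY) := by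
  subst h
  exact mfderiv_comp x hg hf

end Comp

section Related

variable {𝕜 : Type*} [RCLike 𝕜] {EX : Type*} [NormedAddCommGroup EX] [NormedSpace 𝕜 EX]
  [CompleteSpace EX] {X : Type*} [TopologicalSpace X] [ChartedSpace EX X] [IsManifold 𝓘(𝕜, EX) ∞ X]
  {EY : Type*} [NormedAddCommGroup EY] [NormedSpace 𝕜 EY]
  [CompleteSpace EY] {Y : Type*} [TopologicalSpace Y] [ChartedSpace EY Y] [IsManifold 𝓘(𝕜, EY) ∞ Y]

lemma isInvertible_mfderiv_of_inverse {f : X → Y} {g : Y → X} (hf : ContMDiff 𝓘(𝕜, EX) 𝓘(𝕜, EY) ∞ f)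
    (hg : ContMDiff 𝓘(𝕜, EY) 𝓘(𝕜, EX) ∞ g) (hgf : ∀ x, g (f x) = x) (hfg : ∀ y, f (g y) = y)
    (x : X) : (mfderiv 𝓘(𝕜, EX) 𝓘(𝕜, EY) f x).IsInvertible := by
  have h1 : (mfderiv 𝓘(𝕜, EY) 𝓘(𝕜, EX) g (f x)).comp (mfderiv 𝓘(𝕜, EX) 𝓘(𝕜, EY) f x) =
      ContinuousLinearMap.id 𝕜 _ := by
    rw [← mfderiv_comp (I' := 𝓘(𝕜, EY)) x (hg.mdifferentiable (by simp) _)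
      (hf.mdifferentiable (by simp) _), show g ∘ f = id from funext hgf, mfderiv_id]
  have h2 : (mfderiv 𝓘(𝕜, EX) 𝓘(𝕜, EY) f x).comp (mfderiv 𝓘(𝕜, EY) 𝓘(𝕜, EX) g (f x)) =
      ContinuousLinearMap.id 𝕜 _ := by
    have h3 : (mfderiv 𝓘(𝕜, EX) 𝓘(𝕜, EY) f (g (f x))).comp (mfderiv 𝓘(𝕜, EY) 𝓘(𝕜, EX) g (f x)) =
        ContinuousLinearMap.id 𝕜 _ := by
      rw [← mfderiv_comp (I' := 𝓘(𝕜, EX)) (f x) (hf.mdifferentiable (by simp) _)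
        (hg.mdifferentiable (by simp) _), show f ∘ g = id from funext hfg, mfderiv_id]
    rw [hgf] at h3
    exact h3
  exact ContinuousLinearMap.IsInvertible.of_inverse h2 h1

/-- The Lie bracket is compatible with local diffeomorphisms. -/
lemma mfderiv_mlieBracket {f : X → Y} (hf : ContMDiff 𝓘(𝕜, EX) 𝓘(𝕜, EY) ∞ f)
    (hinv : ∀ x, (mfderiv 𝓘(𝕜, EX) 𝓘(𝕜, EY) f x).IsInvertible)
    {V W : Π x : X, TangentSpace 𝓘(𝕜, EX) x} {V' W' : Π y : Y, TangentSpace 𝓘(𝕜, EY) y}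
    (hV : ∀ x, mfderiv 𝓘(𝕜, EX) 𝓘(𝕜, EY) f x (V x) = V' (f x))
    (hW : ∀ x, mfderiv 𝓘(𝕜, EX) 𝓘(𝕜, EY) f x (W x) = W' (f x)) (x : X)
    (hV' : MDifferentiableAt 𝓘(𝕜, EY) 𝓘(𝕜, EY).tangent
      (fun y ↦ (⟨y, V' y⟩ : TangentBundle 𝓘(𝕜, EY) Y)) (f x))
    (hW' : MDifferentiableAt 𝓘(𝕜, EY) 𝓘(𝕜, EY).tangent
      (fun y ↦ (⟨y, W' y⟩ : TangentBundle 𝓘(𝕜, EY) Y)) (f x)) :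
    mfderiv 𝓘(𝕜, EX) 𝓘(𝕜, EY) f x (VectorField.mlieBracket 𝓘(𝕜, EX) V W x) =
      VectorField.mlieBracket 𝓘(𝕜, EY) V' W' (f x) := by
  have key : ∀ {V : Π x : X, TangentSpace 𝓘(𝕜, EX) x} {V' : Π y : Y, TangentSpace 𝓘(𝕜, EY) y},
      (∀ x, mfderiv 𝓘(𝕜, EX) 𝓘(𝕜, EY) f x (V x) = V' (f x)) →
      VectorField.mpullback 𝓘(𝕜, EX) 𝓘(𝕜, EY) f V' = V := fun {V V'} h ↦ by
    ext1 x
    rw [VectorField.mpullback_apply, ← h]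
    exact (hinv x).inverse_apply_self _
  have h := VectorField.mpullback_mlieBracket (n := ∞) hV' hW' hf.contMDiffAt (by
    rw [minSmoothness_of_isRCLikeNormedField]; exact ENat.LEInfty.out)
  rw [key hV, key hW, VectorField.mpullback_apply] at h
  rw [← h]
  exact (hinv x).self_apply_inverse _

end Related

/-! ### The adjoint action of a Lie group -/

section Adjoint

variable {𝕜 : Type*} [RCLike 𝕜]
  {EG : Type*} [NormedAddCommGroup EG] [NormedSpace 𝕜 EG] [FiniteDimensional 𝕜 EG] [CompleteSpace EG]
  {G : Type*} [TopologicalSpace G] [ChartedSpace EG G] [Group G] [LieGroup 𝓘(𝕜, EG) ∞ G]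

lemma contMDiff_conj (g : G) : ContMDiff 𝓘(𝕜, EG) 𝓘(𝕜, EG) ∞ (fun h : G ↦ g * h * g⁻¹) :=
  contMDiff_mul_right.comp contMDiff_mul_left

lemma mdifferentiableAt_conj (g h : G) :
    MDifferentiableAt 𝓘(𝕜, EG) 𝓘(𝕜, EG) (fun h : G ↦ g * h * g⁻¹) h :=
  (contMDiff_conj g).mdifferentiable (by simp) h

lemma mdifferentiableAt_mul_left (g h : G) :
    MDifferentiableAt 𝓘(𝕜, EG) 𝓘(𝕜, EG) (fun h : G ↦ g * h) h :=
  (contMDiff_mul_left (n := ∞)).mdifferentiable (by simp) h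

lemma mdifferentiableAt_mul_right (g h : G) :
    MDifferentiableAt 𝓘(𝕜, EG) 𝓘(𝕜, EG) (fun h : G ↦ h * g) h :=
  (contMDiff_mul_right (n := ∞)).mdifferentiable (by simp) h

lemma Ad_apply (g : G) (A : GroupLieAlgebra 𝓘(𝕜, EG) G) :
    Ad 𝕜 g A = mfderiv 𝓘(𝕜, EG) 𝓘(𝕜, EG) (fun h : G ↦ g * h * g⁻¹) 1 A := rfl

/-- Differentiate `f ∘ L_h = L_{f h} ∘ f'` at the identity. Conjugations and right translations are
both of this kind, with `f'` a conjugation. -/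
lemma mfderiv_apply_mulInvariantVectorField {f f' : G → G} (hf : MDifferentiable 𝓘(𝕜, EG) 𝓘(𝕜, EG) f)
    (hf' : MDifferentiable 𝓘(𝕜, EG) 𝓘(𝕜, EG) f') (h : G) (h1 : f' 1 = 1)
    (hff' : ∀ x, f (h * x) = f h * f' x) (A : GroupLieAlgebra 𝓘(𝕜, EG) G) :
    (mfderiv 𝓘(𝕜, EG) 𝓘(𝕜, EG) f h (mulInvariantVectorField A h) : EG) =
      mulInvariantVectorField (I := 𝓘(𝕜, EG)) (mfderiv 𝓘(𝕜, EG) 𝓘(𝕜, EG) f' 1 A : EG) (f h) := by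
  have h2 : f ∘ (fun x ↦ h * x) = (fun x ↦ f h * x) ∘ f' := funext hff'
  have h3 : (mfderiv 𝓘(𝕜, EG) 𝓘(𝕜, EG) (f ∘ (fun x ↦ h * x)) 1 : EG →L[𝕜] EG) =
      (mfderiv 𝓘(𝕜, EG) 𝓘(𝕜, EG) f h : EG →L[𝕜] EG).comp
        (mfderiv 𝓘(𝕜, EG) 𝓘(𝕜, EG) (fun x ↦ h * x) 1 : EG →L[𝕜] EG) :=
    mfderiv_comp_of_apply_eq (hf h) (mdifferentiableAt_mul_left h 1) (mul_one h)
  have h4 : (mfderiv 𝓘(𝕜, EG) 𝓘(𝕜, EG) ((fun x ↦ f h * x) ∘ f') 1 : EG →L[𝕜] EG) =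
      (mfderiv 𝓘(𝕜, EG) 𝓘(𝕜, EG) (fun x ↦ f h * x) 1 : EG →L[𝕜] EG).comp
        (mfderiv 𝓘(𝕜, EG) 𝓘(𝕜, EG) f' 1 : EG →L[𝕜] EG) :=
    mfderiv_comp_of_apply_eq (mdifferentiableAt_mul_left (f h) 1) (hf' 1) h1
  rw [h2] at h3
  exact congrArg (fun F : EG →L[𝕜] EG ↦ F A) (h3.symm.trans h4)

lemma mfderiv_conj_mulInvariantVectorField (g h : G) (A : GroupLieAlgebra 𝓘(𝕜, EG) G) :
    mfderiv 𝓘(𝕜, EG) 𝓘(𝕜, EG) (fun h : G ↦ g * h * g⁻¹) h (mulInvariantVectorField A h) =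
      mulInvariantVectorField (Ad 𝕜 g A) (g * h * g⁻¹) :=
  mfderiv_apply_mulInvariantVectorField (mdifferentiableAt_conj g) (mdifferentiableAt_conj g) h
    (by group) (fun x ↦ by group) A

lemma mfderiv_mul_right_mulInvariantVectorField (g h : G) (A : GroupLieAlgebra 𝓘(𝕜, EG) G) :
    mfderiv 𝓘(𝕜, EG) 𝓘(𝕜, EG) (fun h : G ↦ h * g) h (mulInvariantVectorField A h) =
      mulInvariantVectorField (Ad 𝕜 g⁻¹ A) (h * g) :=
  mfderiv_apply_mulInvariantVectorField (f' := fun h : G ↦ g⁻¹ * h * g⁻¹⁻¹)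
    (mdifferentiableAt_mul_right g) (mdifferentiableAt_conj g⁻¹) h
    (by group) (fun x ↦ by group) A

lemma Ad_one : (Ad 𝕜 (1 : G) : GroupLieAlgebra 𝓘(𝕜, EG) G →ₗ[𝕜] _) = LinearMap.id := by
  ext A
  rw [Ad_apply]
  have : (fun h : G ↦ 1 * h * 1⁻¹) = id := by ext; simp
  rw [this, mfderiv_id]
  rfl

lemma Ad_mul (g h : G) :
    (Ad 𝕜 (g * h) : GroupLieAlgebra 𝓘(𝕜, EG) G →ₗ[𝕜] _) = Ad 𝕜 g ∘ₗ Ad 𝕜 h := by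
  ext A
  have h2 : (fun x : G ↦ g * h * x * (g * h)⁻¹) =
      (fun x ↦ g * x * g⁻¹) ∘ (fun x ↦ h * x * h⁻¹) := by
    ext x
    simp [mul_assoc]
  have h3 : (mfderiv 𝓘(𝕜, EG) 𝓘(𝕜, EG) ((fun x : G ↦ g * x * g⁻¹) ∘ (fun x ↦ h * x * h⁻¹)) 1 :
      EG →L[𝕜] EG) = (mfderiv 𝓘(𝕜, EG) 𝓘(𝕜, EG) (fun x : G ↦ g * x * g⁻¹) 1 : EG →L[𝕜] EG).comp
        (mfderiv 𝓘(𝕜, EG) 𝓘(𝕜, EG) (fun x : G ↦ h * x * h⁻¹) 1 : EG →L[𝕜] EG) :=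
    mfderiv_comp_of_apply_eq (mdifferentiableAt_conj g 1) (mdifferentiableAt_conj h 1)
      (by group)
  rw [← h2] at h3
  exact congrArg (fun F : EG →L[𝕜] EG ↦ F A) h3

/-- Conjugation by `g` is a diffeomorphism relating the left-invariant fields of `A` and `Ad g A`,
and brackets of related fields are related. -/
lemma Ad_lie (g : G) (A A' : GroupLieAlgebra 𝓘(𝕜, EG) G) :
    Ad 𝕜 g ⁅A, A'⁆ = ⁅Ad 𝕜 g A, Ad 𝕜 g A'⁆ := by
  have h := mfderiv_mlieBracket (contMDiff_conj (𝕜 := 𝕜) g)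
    (isInvertible_mfderiv_of_inverse (contMDiff_conj (𝕜 := 𝕜) g) (contMDiff_conj (𝕜 := 𝕜) g⁻¹)
      (fun x ↦ by group) (fun x ↦ by group))
    (fun x ↦ mfderiv_conj_mulInvariantVectorField g x A)
    (fun x ↦ mfderiv_conj_mulInvariantVectorField g x A') 1
    (mdifferentiableAt_mulInvariantVectorField _) (mdifferentiableAt_mulInvariantVectorField _)
  have h1 : ∀ y : G, y = 1 → (VectorField.mlieBracket 𝓘(𝕜, EG)
      (mulInvariantVectorField (Ad 𝕜 g A)) (mulInvariantVectorField (Ad 𝕜 g A')) y : EG) =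
      (⁅Ad 𝕜 g A, Ad 𝕜 g A'⁆ : GroupLieAlgebra 𝓘(𝕜, EG) G) := by
    rintro y rfl
    rfl
  exact h.trans (h1 _ (by group))

/-- The adjoint action as an automorphism of the Lie algebra. -/
def AdEquiv (g : G) : GroupLieAlgebra 𝓘(𝕜, EG) G ≃ₗ⁅𝕜⁆ GroupLieAlgebra 𝓘(𝕜, EG) G :=
  { Ad 𝕜 g with
    map_lie' := Ad_lie g _ _
    invFun := Ad 𝕜 g⁻¹
    left_inv := fun A ↦ by
      change (Ad 𝕜 g⁻¹ ∘ₗ Ad 𝕜 g) A = A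
      rw [← Ad_mul, inv_mul_cancel, Ad_one]
      rfl
    right_inv := fun A ↦ by
      change (Ad 𝕜 g ∘ₗ Ad 𝕜 g⁻¹) A = A
      rw [← Ad_mul, mul_inv_cancel, Ad_one]
      rfl }

/-- The derivative of a smooth family of maps is smooth in tangent coordinates. Every conjugation
fixes the identity, so source and target stay in one chart and the coordinate changes are trivial.
-/
lemma contMDiffAt_Ad (A : GroupLieAlgebra 𝓘(𝕜, EG) G) (g : G) :
    ContMDiffAt (M' := EG) 𝓘(𝕜, EG) 𝓘(𝕜, EG) ∞ (fun g : G ↦ (Ad 𝕜 g A : EG)) g := by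
  have h := ContMDiffAt.mfderiv (I := 𝓘(𝕜, EG)) (I' := 𝓘(𝕜, EG)) (J := 𝓘(𝕜, EG)) (n := ∞) (m := ∞)
    (x₀ := g) (fun g h : G ↦ g * h * g⁻¹) (fun _ ↦ 1)
    (((contMDiff_fst.mul contMDiff_snd).mul contMDiff_fst.inv).contMDiffAt)
    contMDiffAt_const (by simp)
  have h1 : (fun g : G ↦ g * 1 * g⁻¹) = fun _ ↦ 1 := by ext; simp
  rw [h1] at h
  have h2 := h.clm_apply (contMDiffAt_const (M' := EG) (c := A))
  refine h2.congr_of_eventuallyEq (Filter.Eventually.of_forall fun x ↦ ?_)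
  have h3 := inTangentCoordinates_eq (I := 𝓘(𝕜, EG)) (I' := 𝓘(𝕜, EG)) (x₀ := g) (x := x)
    (fun _ : G ↦ (1 : G)) (fun _ : G ↦ (1 : G)) (fun x ↦ (mfderiv 𝓘(𝕜, EG) 𝓘(𝕜, EG)
      (fun h : G ↦ x * h * x⁻¹) 1 : EG →L[𝕜] EG)) (mem_chart_source EG 1) (mem_chart_source EG 1)
  have h4 : ∀ v : EG, (tangentBundleCore 𝓘(𝕜, EG) G).coordChange (achart EG 1) (achart EG 1) 1 v =
      v := fun v ↦ (tangentBundleCore 𝓘(𝕜, EG) G).coordChange_self (achart EG 1) 1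
        (mem_achart_source EG 1) v
  exact ((congrArg (fun F : EG →L[𝕜] EG ↦ F A) h3).trans ((h4 _).trans (congrArg
    (mfderiv 𝓘(𝕜, EG) 𝓘(𝕜, EG) (fun h : G ↦ x * h * x⁻¹) 1 : EG →L[𝕜] EG) (h4 A)))).symm

end Adjoint

/-! ### Brackets with the generators of an action -/

section Action

variable {𝕜 : Type*} [RCLike 𝕜]

/-- The mixed second derivative of `R` along `V x₀` and `a` is computed in both orders. One gives
`DW(V x₀)`; the other, through `h1`, gives `∂_q Y · a + DV(W x₀)`. Symmetry leaves `[W, V] = -∂_q Y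
· a` at `x₀`. -/
lemma lieBracket_of_action {E F : Type*} [NormedAddCommGroup E] [NormedSpace 𝕜 E]
    [NormedAddCommGroup F] [NormedSpace 𝕜 F] {R : E × F → E} {x₀ : E} {q₀ a : F} {V W : E → E}
    {Y : F × E → E} (hR : ContDiffAt 𝕜 2 R (x₀, q₀)) (hR₀ : R (x₀, q₀) = x₀)
    (hW : DifferentiableAt 𝕜 W x₀) (hY : DifferentiableAt 𝕜 Y (q₀, x₀))
    (hYV : ∀ᶠ x in nhds x₀, Y (q₀, x) = V x)
    (h1 : ∀ᶠ q in nhds q₀, fderiv 𝕜 (fun x ↦ R (x, q)) x₀ (V x₀) = Y (q, R (x₀, q)))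
    (h2 : ∀ᶠ x in nhds x₀, fderiv 𝕜 (fun q ↦ R (x, q)) q₀ a = W x) :
    VectorField.lieBracket 𝕜 W V x₀ = -fderiv 𝕜 (fun q ↦ Y (q, x₀)) q₀ a := by
  have hD : ContDiffAt 𝕜 1 (fderiv 𝕜 R) (x₀, q₀) := hR.fderiv_right (by norm_num)
  have hD' := hD.differentiableAt (by norm_num)
  have hRd : ∀ᶠ z in nhds (x₀, q₀), DifferentiableAt 𝕜 R z := by
    filter_upwards [hR.eventually (by simp)] with z hz
    exact hz.differentiableAt (by norm_num)
  have i1 : ∀ (x : E) (q : F), HasFDerivAt (fun q : F ↦ (x, q)) (ContinuousLinearMap.inr 𝕜 E F) q :=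
    fun x q ↦ hasFDerivAt_prodMk_right x q
  have i2 : ∀ (x : E) (q : F), HasFDerivAt (fun x : E ↦ (x, q)) (ContinuousLinearMap.inl 𝕜 E F) x :=
    fun x q ↦ hasFDerivAt_prodMk_left x q
  have hsymm : fderiv 𝕜 (fderiv 𝕜 R) (x₀, q₀) (0, a) (V x₀, 0) =
      fderiv 𝕜 (fderiv 𝕜 R) (x₀, q₀) (V x₀, 0) (0, a) :=
    (hR.isSymmSndFDerivAt (by rw [minSmoothness_of_isRCLikeNormedField])) _ _
  have k1 : HasFDerivAt (fun q ↦ fderiv 𝕜 R (x₀, q) (V x₀, 0))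
      (((fderiv 𝕜 (fderiv 𝕜 R) (x₀, q₀)).comp (ContinuousLinearMap.inr 𝕜 E F)).flip (V x₀, 0)) q₀ :=
    by
      have := (hD'.hasFDerivAt.comp q₀ (i1 x₀ q₀)).clm_apply (hasFDerivAt_const (V x₀, (0 : F)) q₀)
      simpa using this
  have k2 : HasFDerivAt (fun x ↦ fderiv 𝕜 R (x, q₀) (0, a))
      (((fderiv 𝕜 (fderiv 𝕜 R) (x₀, q₀)).comp (ContinuousLinearMap.inl 𝕜 E F)).flip (0, a)) x₀ := by
    have := (hD'.hasFDerivAt.comp x₀ (i2 x₀ q₀)).clm_apply (hasFDerivAt_const ((0 : E), a) x₀)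
    simpa using this
  have e1 : ∀ᶠ q in nhds q₀, fderiv 𝕜 R (x₀, q) (V x₀, 0) = Y (q, R (x₀, q)) := by
    have hc : ContinuousAt (fun q : F ↦ (x₀, q)) q₀ := by fun_prop
    filter_upwards [h1, hc.eventually hRd] with q hq hq'
    rw [← hq]
    have := (hq'.hasFDerivAt.comp x₀ (i2 x₀ q)).fderiv
    change fderiv 𝕜 (fun x ↦ R (x, q)) x₀ = _ at this
    rw [this]
    simp
  have e2 : ∀ᶠ x in nhds x₀, fderiv 𝕜 R (x, q₀) (0, a) = W x := by
    have hc : ContinuousAt (fun x : E ↦ (x, q₀)) x₀ := by fun_prop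
    filter_upwards [h2, hc.eventually hRd] with x hx hx'
    rw [← hx]
    have := (hx'.hasFDerivAt.comp q₀ (i1 x q₀)).fderiv
    change fderiv 𝕜 (fun q ↦ R (x, q)) q₀ = _ at this
    rw [this]
    simp
  have hRq : HasFDerivAt (fun q ↦ R (x₀, q))
      ((fderiv 𝕜 R (x₀, q₀)).comp (ContinuousLinearMap.inr 𝕜 E F)) q₀ :=
    hRd.self_of_nhds.hasFDerivAt.comp q₀ (i1 x₀ q₀)
  have hY' : HasFDerivAt Y (fderiv 𝕜 Y (q₀, x₀)) (q₀, R (x₀, q₀)) := by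
    rw [hR₀]
    exact hY.hasFDerivAt
  have k3 := hY'.comp q₀ ((hasFDerivAt_id q₀).prodMk hRq)
  have k4 := (k1.congr_of_eventuallyEq (e1.mono fun _ h ↦ h.symm)).unique k3
  have k5 := (k2.congr_of_eventuallyEq (e2.mono fun _ h ↦ h.symm)).unique hW.hasFDerivAt
  have k6 : fderiv 𝕜 V x₀ = (fderiv 𝕜 Y (q₀, x₀)).comp (ContinuousLinearMap.inr 𝕜 F E) :=
    ((hY.hasFDerivAt.comp x₀ (hasFDerivAt_prodMk_right q₀ x₀)).congr_of_eventuallyEq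
      (hYV.mono fun _ h ↦ h.symm)).fderiv
  have k7 : fderiv 𝕜 (fun q ↦ Y (q, x₀)) q₀ =
      (fderiv 𝕜 Y (q₀, x₀)).comp (ContinuousLinearMap.inl 𝕜 F E) :=
    (hY.hasFDerivAt.comp q₀ (hasFDerivAt_prodMk_left q₀ x₀)).fderiv
  have k8 := congrArg (fun L : F →L[𝕜] E ↦ L a) k4
  have k9 := congrArg (fun L : E →L[𝕜] E ↦ L (V x₀)) k5
  have k10 : fderiv 𝕜 R (x₀, q₀) (0, a) = W x₀ := e2.self_of_nhds
  simp only [ContinuousLinearMap.flip_apply, ContinuousLinearMap.comp_apply,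
    ContinuousLinearMap.inr_apply, ContinuousLinearMap.inl_apply, ContinuousLinearMap.prod_apply,
    ContinuousLinearMap.id_apply, k10] at k8 k9
  rw [VectorField.lieBracket, k7, k6, ← k9, ← hsymm, k8]
  simp only [ContinuousLinearMap.comp_apply, ContinuousLinearMap.inr_apply,
    ContinuousLinearMap.inl_apply]
  rw [← map_sub, ← map_neg]
  simp

/-! ### Vector fields and brackets in a chart -/

section Chart

variable {EB : Type*} [NormedAddCommGroup EB] [NormedSpace 𝕜 EB] [CompleteSpace EB]
  {B : Type*} [TopologicalSpace B] [ChartedSpace EB B] [IsManifold 𝓘(𝕜, EB) ∞ B]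

variable (𝕜) in
/-- A vector field on a manifold read in the chart at `u`. -/
def chartField (u : B) (V : Π x : B, TangentSpace 𝓘(𝕜, EB) x) (x : EB) : EB :=
  (mfderiv 𝓘(𝕜, EB) 𝓘(𝕜, EB) (extChartAt 𝓘(𝕜, EB) u) ((extChartAt 𝓘(𝕜, EB) u).symm x) :
    EB →L[𝕜] EB) (V ((extChartAt 𝓘(𝕜, EB) u).symm x))

lemma chartField_apply (u : B) (V : Π x : B, TangentSpace 𝓘(𝕜, EB) x) {x : B}
    (hx : x ∈ (extChartAt 𝓘(𝕜, EB) u).source) :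
    chartField 𝕜 u V (extChartAt 𝓘(𝕜, EB) u x) =
      (mfderiv 𝓘(𝕜, EB) 𝓘(𝕜, EB) (extChartAt 𝓘(𝕜, EB) u) x : EB →L[𝕜] EB) (V x) := by
  have : ∀ y, y = x → (mfderiv 𝓘(𝕜, EB) 𝓘(𝕜, EB) (extChartAt 𝓘(𝕜, EB) u) y : EB →L[𝕜] EB) (V y) =
    (mfderiv 𝓘(𝕜, EB) 𝓘(𝕜, EB) (extChartAt 𝓘(𝕜, EB) u) x : EB →L[𝕜] EB) (V x) := by
    rintro y rfl
    rfl
  exact this _ ((extChartAt 𝓘(𝕜, EB) u).left_inv hx)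

lemma mpullbackWithin_eq_chartField (u : B) (V : Π x : B, TangentSpace 𝓘(𝕜, EB) x) {x : EB}
    (hx : x ∈ (extChartAt 𝓘(𝕜, EB) u).target) :
    VectorField.mpullbackWithin 𝓘(𝕜, EB) 𝓘(𝕜, EB) (extChartAt 𝓘(𝕜, EB) u).symm V
      (Set.range 𝓘(𝕜, EB)) x = chartField 𝕜 u V x := by
  rw [VectorField.mpullbackWithin_apply, ContinuousLinearMap.inverse_eq
    (mfderivWithin_extChartAt_symm_comp_mfderiv_extChartAt hx)
    (mfderiv_extChartAt_comp_mfderivWithin_extChartAt_symm hx)]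
  rfl

lemma eventually_mpullbackWithin_eq_chartField (u : B) (V : Π x : B, TangentSpace 𝓘(𝕜, EB) x) :
    VectorField.mpullbackWithin 𝓘(𝕜, EB) 𝓘(𝕜, EB) (extChartAt 𝓘(𝕜, EB) u).symm V
      (Set.range 𝓘(𝕜, EB)) =ᶠ[nhds (extChartAt 𝓘(𝕜, EB) u u)] chartField 𝕜 u V := by
  filter_upwards [extChartAt_target_mem_nhds (I := 𝓘(𝕜, EB)) u] with x hx
  exact mpullbackWithin_eq_chartField u V hx

lemma differentiableAt_chartField {u : B} {V : Π x : B, TangentSpace 𝓘(𝕜, EB) x}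
    (hV : MDifferentiableAt 𝓘(𝕜, EB) 𝓘(𝕜, EB).tangent
      (fun y ↦ (⟨y, V y⟩ : TangentBundle 𝓘(𝕜, EB) B)) u) :
    DifferentiableAt 𝕜 (chartField 𝕜 u V) (extChartAt 𝓘(𝕜, EB) u u) := by
  have : IsManifold 𝓘(𝕜, EB) 2 B := IsManifold.of_le (n := ∞) ENat.LEInfty.out
  have h := hV.mdifferentiableWithinAt.differentiableWithinAt_mpullbackWithin_vectorField
    (s := Set.univ)
  have h' : DifferentiableAt 𝕜 (E := EB) (F := EB) (VectorField.mpullbackWithin 𝓘(𝕜, EB) 𝓘(𝕜, EB)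
      (extChartAt 𝓘(𝕜, EB) u).symm V (Set.range 𝓘(𝕜, EB))) (extChartAt 𝓘(𝕜, EB) u u) :=
    h.differentiableAt (by simp)
  exact h'.congr_of_eventuallyEq (eventually_mpullbackWithin_eq_chartField (𝕜 := 𝕜) u V).symm

lemma mfderiv_extChartAt_mlieBracket (u : B) (V W : Π x : B, TangentSpace 𝓘(𝕜, EB) x) :
    (mfderiv 𝓘(𝕜, EB) 𝓘(𝕜, EB) (extChartAt 𝓘(𝕜, EB) u) u : EB →L[𝕜] EB)
      (VectorField.mlieBracket 𝓘(𝕜, EB) V W u) =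
      VectorField.lieBracket 𝕜 (chartField 𝕜 u V) (chartField 𝕜 u W) (extChartAt 𝓘(𝕜, EB) u u) := by
  rw [← VectorField.mlieBracketWithin_univ, VectorField.mlieBracketWithin_apply]
  have hL : (mfderiv 𝓘(𝕜, EB) 𝓘(𝕜, EB) (extChartAt 𝓘(𝕜, EB) u) u : EB →L[𝕜] EB).IsInvertible :=
    isInvertible_mfderiv_extChartAt (mem_extChartAt_source u)
  have hL' : ∀ y : EB, (mfderiv 𝓘(𝕜, EB) 𝓘(𝕜, EB) (extChartAt 𝓘(𝕜, EB) u) u : EB →L[𝕜] EB)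
      ((mfderiv 𝓘(𝕜, EB) 𝓘(𝕜, EB) (extChartAt 𝓘(𝕜, EB) u) u : EB →L[𝕜] EB).inverse y) = y :=
    fun y ↦ (hL.inverse_apply_eq.1 rfl).symm
  refine (hL' _).trans ?_
  rw [Set.preimage_univ, Set.univ_inter]
  have := Filter.EventuallyEq.lieBracket_vectorField_eq (𝕜 := 𝕜) (E := EB)
    (eventually_mpullbackWithin_eq_chartField (𝕜 := 𝕜) u V)
    (eventually_mpullbackWithin_eq_chartField (𝕜 := 𝕜) u W)
  have hr : Set.range 𝓘(𝕜, EB) = Set.univ := by simp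
  have e : ∀ (F H : EB → EB) (s : Set EB), s = Set.univ → ∀ x,
      VectorField.lieBracketWithin 𝕜 F H s x = VectorField.lieBracket 𝕜 F H x := by
    rintro F H s rfl x
    rw [VectorField.lieBracketWithin_univ]
  exact (e _ _ _ hr _).trans this

end Chart

/-! ### The bracket formula for actions on manifolds -/

section Manifold

variable {EB : Type*} [NormedAddCommGroup EB] [NormedSpace 𝕜 EB] [CompleteSpace EB]
  {B : Type*} [TopologicalSpace B] [ChartedSpace EB B] [IsManifold 𝓘(𝕜, EB) ∞ B]
  {EQ : Type*} [NormedAddCommGroup EQ] [NormedSpace 𝕜 EQ]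
  {Q : Type*} [TopologicalSpace Q] [ChartedSpace EQ Q] [IsManifold 𝓘(𝕜, EQ) ∞ Q]
  {𝔞 : Type*} [NormedAddCommGroup 𝔞] [NormedSpace 𝕜 𝔞] [FiniteDimensional 𝕜 𝔞]

/-- If the translations of an action transform a linear family of vector fields `W` by `ρ`, then the
bracket of a generator of the action with a field of the family is given by the derivative of `ρ`. -/
theorem mlieBracket_of_action {act : B → Q → B} {q₀ : Q}
    (hact : ContMDiff (𝓘(𝕜, EB).prod 𝓘(𝕜, EQ)) 𝓘(𝕜, EB) ∞ (fun z : B × Q ↦ act z.1 z.2))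
    (hact₀ : ∀ x, act x q₀ = x) (W : 𝔞 → Π x : B, TangentSpace 𝓘(𝕜, EB) x)
    (hWadd : ∀ A A', W (A + A') = W A + W A') (hWsmul : ∀ (r : 𝕜) A, W (r • A) = r • W A)
    {u : B} (hW : ∀ A, MDifferentiableAt 𝓘(𝕜, EB) 𝓘(𝕜, EB).tangent
      (fun y ↦ (⟨y, W A y⟩ : TangentBundle 𝓘(𝕜, EB) B)) u)
    {ρ : Q → 𝔞} (hρ : MDifferentiableAt 𝓘(𝕜, EQ) 𝓘(𝕜, 𝔞) ρ q₀)
    (h1 : ∀ q, (mfderiv 𝓘(𝕜, EB) 𝓘(𝕜, EB) (fun x ↦ act x q) u : EB →L[𝕜] EB) (W (ρ q₀) u) =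
      W (ρ q) (act u q)) {A : 𝔞} {a : EQ}
    (h2 : ∀ x, (mfderiv 𝓘(𝕜, EQ) 𝓘(𝕜, EB) (fun q ↦ act x q) q₀ : EQ →L[𝕜] EB) a = W A x) :
    VectorField.mlieBracket 𝓘(𝕜, EB) (W A) (W (ρ q₀)) u =
      -W ((mfderiv 𝓘(𝕜, EQ) 𝓘(𝕜, 𝔞) ρ q₀ : EQ →L[𝕜] 𝔞) a) u := by
  let φ := extChartAt 𝓘(𝕜, EB) u
  let χ := extChartAt 𝓘(𝕜, EQ) q₀
  let R : EB × EQ → EB := fun z ↦ φ (act (φ.symm z.1) (χ.symm z.2))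
  let Λ : EB → 𝔞 →ₗ[𝕜] EB := fun x ↦
    { toFun := fun A ↦ chartField 𝕜 u (W A) x
      map_add' := fun A A' ↦ by
        rw [hWadd]
        exact map_add (mfderiv 𝓘(𝕜, EB) 𝓘(𝕜, EB) (extChartAt 𝓘(𝕜, EB) u)
          ((extChartAt 𝓘(𝕜, EB) u).symm x) : EB →L[𝕜] EB) _ _
      map_smul' := fun r A ↦ by
        rw [hWsmul]
        exact map_smul (mfderiv 𝓘(𝕜, EB) 𝓘(𝕜, EB) (extChartAt 𝓘(𝕜, EB) u)
          ((extChartAt 𝓘(𝕜, EB) u).symm x) : EB →L[𝕜] EB) _ _ }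
  let Y : EQ × EB → EB := fun z ↦ Λ z.2 (ρ (χ.symm z.1))
  have hφu : u ∈ φ.source := mem_extChartAt_source u
  have hχq : q₀ ∈ χ.source := mem_extChartAt_source q₀
  have hφs : φ.symm (φ u) = u := φ.left_inv hφu
  have hχs : χ.symm (χ q₀) = q₀ := χ.left_inv hχq
  have hφt : ∀ᶠ x in nhds (φ u), x ∈ φ.target := extChartAt_target_mem_nhds (I := 𝓘(𝕜, EB)) u
  have hχt : ∀ᶠ q in nhds (χ q₀), q ∈ χ.target := extChartAt_target_mem_nhds (I := 𝓘(𝕜, EQ)) q₀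
  have hφd : ∀ x ∈ φ.source, MDifferentiableAt 𝓘(𝕜, EB) 𝓘(𝕜, EB) φ x := fun x hx ↦
    mdifferentiableAt_extChartAt (by simpa [φ] using hx)
  have hχsm : ContMDiffAt 𝓘(𝕜, EQ) 𝓘(𝕜, EQ) ∞ χ.symm (χ q₀) :=
    (contMDiffOn_extChartAt_symm q₀).contMDiffAt hχt
  have hφsm : ContMDiffAt 𝓘(𝕜, EB) 𝓘(𝕜, EB) ∞ φ.symm (φ u) :=
    (contMDiffOn_extChartAt_symm u).contMDiffAt hφt
  have hRs : ContDiffAt 𝕜 2 R (φ u, χ q₀) := by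
    have a1 : ContMDiffAt 𝓘(𝕜, EB × EQ) 𝓘(𝕜, EB) ∞ (fun z : EB × EQ ↦ φ.symm z.1) (φ u, χ q₀) :=
      hφsm.comp (φ u, χ q₀) contDiff_fst.contMDiff.contMDiffAt
    have a2 : ContMDiffAt 𝓘(𝕜, EB × EQ) 𝓘(𝕜, EQ) ∞ (fun z : EB × EQ ↦ χ.symm z.2) (φ u, χ q₀) :=
      hχsm.comp (φ u, χ q₀) contDiff_snd.contMDiff.contMDiffAt
    have a3 := hact.contMDiffAt.comp (φ u, χ q₀) (a1.prodMk a2)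
    have a4 : ContMDiffAt 𝓘(𝕜, EB × EQ) 𝓘(𝕜, EB) ∞ R (φ u, χ q₀) :=
      (contMDiffAt_extChartAt (x := u)).comp_of_eq a3 (by
        change act (φ.symm (φ u)) (χ.symm (χ q₀)) = u
        rw [hφs, hχs, hact₀])
    exact a4.contDiffAt.of_le ENat.LEInfty.out
  have hRd : ∀ᶠ z in nhds (φ u, χ q₀), DifferentiableAt 𝕜 R z := by
    filter_upwards [hRs.eventually (by simp)] with z hz
    exact hz.differentiableAt (by norm_num)
  have hρs : DifferentiableAt 𝕜 (fun q ↦ ρ (χ.symm q)) (χ q₀) :=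
    (hρ.comp_of_eq _ (hχsm.mdifferentiableAt (by simp)) hχs).differentiableAt
  -- Linearity of `W` in `A` makes `Y` a finite sum of products of a function of `q` and a function
  -- of `x`, so separate differentiability suffices.
  have hY : DifferentiableAt 𝕜 Y (χ q₀, φ u) := by
    let b := Module.finBasis 𝕜 𝔞
    have hYs : Y = fun z ↦ ∑ k, LinearMap.toContinuousLinearMap (b.coord k) (ρ (χ.symm z.1)) •
        chartField 𝕜 u (W (b k)) z.2 := by
      ext z
      change Λ z.2 (ρ (χ.symm z.1)) = _
      conv_lhs => rw [← b.sum_repr (ρ (χ.symm z.1)), map_sum]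
      refine Finset.sum_congr rfl fun k _ ↦ ?_
      rw [map_smul]
      rfl
    rw [hYs]
    refine DifferentiableAt.fun_sum fun k _ ↦ DifferentiableAt.fun_smul ?_ ?_
    · exact (ContinuousLinearMap.differentiableAt _).comp (χ q₀, φ u)
        (DifferentiableAt.comp (f := Prod.fst) (g := fun q ↦ ρ (χ.symm q)) (χ q₀, φ u) hρs
          differentiableAt_fst)
    · exact DifferentiableAt.comp (f := Prod.snd) (g := chartField 𝕜 u (W (b k))) (χ q₀, φ u)
        (differentiableAt_chartField (hW (b k))) differentiableAt_snd
  have hactu : ∀ x q, MDifferentiableAt 𝓘(𝕜, EB) 𝓘(𝕜, EB) (fun x ↦ act x q) x := fun x q ↦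
    (hact.comp (contMDiff_id.prodMk contMDiff_const)).mdifferentiable (by simp) x
  have hactq : ∀ x q, MDifferentiableAt 𝓘(𝕜, EQ) 𝓘(𝕜, EB) (fun q ↦ act x q) q := fun x q ↦
    (hact.comp (contMDiff_const.prodMk contMDiff_id)).mdifferentiable (by simp) q
  have hχd : MDifferentiableAt 𝓘(𝕜, EQ) 𝓘(𝕜, EQ) χ q₀ := mdifferentiableAt_extChartAt (by simp)
  have H1 : ∀ᶠ q in nhds (χ q₀), fderiv 𝕜 (fun x ↦ R (x, q)) (φ u)
      (chartField 𝕜 u (W (ρ q₀)) (φ u)) = Y (q, R (φ u, q)) := by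
    have hc : ContinuousAt (fun q : EQ ↦ (φ u, q)) (χ q₀) := by fun_prop
    have hc' : ∀ᶠ q in nhds (χ q₀), act u (χ.symm q) ∈ φ.source := by
      have h3 : ContinuousAt (fun q ↦ act u (χ.symm q)) (χ q₀) :=
        ((hactq u _).comp_of_eq _ (hχsm.mdifferentiableAt (by simp)) hχs).continuousAt
      refine h3.eventually_mem ?_
      rw [hχs, hact₀]
      exact extChartAt_source_mem_nhds u
    filter_upwards [hc.eventually hRd, hc'] with q hq hq'
    have hq1 : DifferentiableAt 𝕜 (fun x ↦ R (x, q)) (φ u) :=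
      DifferentiableAt.comp (g := R) (f := fun x : EB ↦ (x, q)) (φ u) hq (by fun_prop)
    have e1 := mfderiv_comp_of_apply_eq hq1.mdifferentiableAt (hφd u hφu) rfl
    have e2 := mfderiv_comp_of_apply_eq (hφd _ hq') (hactu u (χ.symm q)) rfl
    have e3 : (fun x ↦ R (x, q)) ∘ φ =ᶠ[nhds u] φ ∘ fun x ↦ act x (χ.symm q) := by
      filter_upwards [extChartAt_source_mem_nhds (I := 𝓘(𝕜, EB)) u] with x hx
      change φ (act (φ.symm (φ x)) (χ.symm q)) = φ (act x (χ.symm q))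
      rw [φ.left_inv hx]
    have e4 : (mfderiv 𝓘(𝕜, EB) 𝓘(𝕜, EB) ((fun x ↦ R (x, q)) ∘ φ) u : EB →L[𝕜] EB) =
      mfderiv 𝓘(𝕜, EB) 𝓘(𝕜, EB) (φ ∘ fun x ↦ act x (χ.symm q)) u := e3.mfderiv_eq
    rw [chartField_apply u _ hφu, ← mfderiv_eq_fderiv]
    have e5 := congrArg (fun L : EB →L[𝕜] EB ↦ L (W (ρ q₀) u)) (e1.symm.trans (e4.trans e2))
    refine e5.trans ?_
    change (mfderiv 𝓘(𝕜, EB) 𝓘(𝕜, EB) φ (act u (χ.symm q)) : EB →L[𝕜] EB)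
      ((mfderiv 𝓘(𝕜, EB) 𝓘(𝕜, EB) (fun x ↦ act x (χ.symm q)) u : EB →L[𝕜] EB) (W (ρ q₀) u)) =
      chartField 𝕜 u (W (ρ (χ.symm q))) (φ (act (φ.symm (φ u)) (χ.symm q)))
    rw [h1, hφs, chartField_apply u _ hq']
  have H2 : ∀ᶠ x in nhds (φ u), fderiv 𝕜 (fun q ↦ R (x, q)) (χ q₀)
      ((mfderiv 𝓘(𝕜, EQ) 𝓘(𝕜, EQ) χ q₀ : EQ →L[𝕜] EQ) a) = chartField 𝕜 u (W A) x := by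
    have hc : ContinuousAt (fun x : EB ↦ (x, χ q₀)) (φ u) := by fun_prop
    filter_upwards [hc.eventually hRd, hφt] with x hx hx'
    have hx1 : DifferentiableAt 𝕜 (fun q ↦ R (x, q)) (χ q₀) :=
      DifferentiableAt.comp (g := R) (f := fun q : EQ ↦ (x, q)) (χ q₀) hx (by fun_prop)
    have e1 := mfderiv_comp_of_apply_eq hx1.mdifferentiableAt hχd rfl
    have e2 := mfderiv_comp_of_apply_eq (hφd _ (φ.map_target hx')) (hactq (φ.symm x) q₀) (hact₀ _)
    have e3 : (fun q ↦ R (x, q)) ∘ χ =ᶠ[nhds q₀] φ ∘ fun q ↦ act (φ.symm x) q := by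
      filter_upwards [extChartAt_source_mem_nhds (I := 𝓘(𝕜, EQ)) q₀] with q hq
      change φ (act (φ.symm x) (χ.symm (χ q))) = φ (act (φ.symm x) q)
      rw [χ.left_inv hq]
    have e4 : (mfderiv 𝓘(𝕜, EQ) 𝓘(𝕜, EB) ((fun q ↦ R (x, q)) ∘ χ) q₀ : EQ →L[𝕜] EB) =
      mfderiv 𝓘(𝕜, EQ) 𝓘(𝕜, EB) (φ ∘ fun q ↦ act (φ.symm x) q) q₀ := e3.mfderiv_eq
    rw [← mfderiv_eq_fderiv]
    refine (congrArg (fun L : EQ →L[𝕜] EB ↦ L a) (e1.symm.trans (e4.trans e2))).trans ?_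
    change (mfderiv 𝓘(𝕜, EB) 𝓘(𝕜, EB) φ (φ.symm x) : EB →L[𝕜] EB)
      ((mfderiv 𝓘(𝕜, EQ) 𝓘(𝕜, EB) (fun q ↦ act (φ.symm x) q) q₀ : EQ →L[𝕜] EB) a) = _
    rw [h2]
    rfl
  have key := lieBracket_of_action (Y := Y) hRs
    (by change φ (act (φ.symm (φ u)) (χ.symm (χ q₀))) = φ u; rw [hφs, hχs, hact₀])
    (differentiableAt_chartField (hW A)) hY
    (Filter.Eventually.of_forall fun x ↦ by
      change chartField 𝕜 u (W (ρ (χ.symm (χ q₀)))) x = _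
      rw [hχs]) H1 H2
  have hYd : fderiv 𝕜 (fun q ↦ Y (q, φ u)) (χ q₀)
      ((mfderiv 𝓘(𝕜, EQ) 𝓘(𝕜, EQ) χ q₀ : EQ →L[𝕜] EQ) a) =
      Λ (φ u) ((mfderiv 𝓘(𝕜, EQ) 𝓘(𝕜, 𝔞) ρ q₀ : EQ →L[𝕜] 𝔞) a) := by
    have e1 := mfderiv_comp_of_apply_eq hρs.mdifferentiableAt hχd rfl
    have e3 : (fun q ↦ ρ (χ.symm q)) ∘ χ =ᶠ[nhds q₀] ρ := by
      filter_upwards [extChartAt_source_mem_nhds (I := 𝓘(𝕜, EQ)) q₀] with q hq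
      change ρ (χ.symm (χ q)) = ρ q
      rw [χ.left_inv hq]
    have e4 : (mfderiv 𝓘(𝕜, EQ) 𝓘(𝕜, 𝔞) ((fun q ↦ ρ (χ.symm q)) ∘ χ) q₀ : EQ →L[𝕜] 𝔞) =
      mfderiv 𝓘(𝕜, EQ) 𝓘(𝕜, 𝔞) ρ q₀ := e3.mfderiv_eq
    have e5 := congrArg (fun L : EQ →L[𝕜] 𝔞 ↦ L a) (e1.symm.trans e4)
    have e6 := ((LinearMap.toContinuousLinearMap (Λ (φ u))).hasFDerivAt.comp (χ q₀)
      hρs.hasFDerivAt).fderiv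
    have e0 : (mfderiv 𝓘(𝕜, EQ) 𝓘(𝕜, 𝔞) (fun q ↦ ρ (χ.symm q)) (χ q₀) : EQ →L[𝕜] 𝔞) =
      fderiv 𝕜 (fun q ↦ ρ (χ.symm q)) (χ q₀) := mfderiv_eq_fderiv
    exact (congrArg (fun L : EQ →L[𝕜] EB ↦ L ((mfderiv 𝓘(𝕜, EQ) 𝓘(𝕜, EQ) χ q₀ : EQ →L[𝕜] EQ) a))
      e6).trans (congrArg (Λ (φ u)) ((congrArg (fun L : EQ →L[𝕜] 𝔞 ↦
        L ((mfderiv 𝓘(𝕜, EQ) 𝓘(𝕜, EQ) χ q₀ : EQ →L[𝕜] EQ) a)) e0).symm.trans e5))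
  have hinj : Function.Injective (mfderiv 𝓘(𝕜, EB) 𝓘(𝕜, EB) φ u : EB →L[𝕜] EB) := by
    obtain ⟨e, he⟩ : (mfderiv 𝓘(𝕜, EB) 𝓘(𝕜, EB) φ u : EB →L[𝕜] EB).IsInvertible :=
      isInvertible_mfderiv_extChartAt hφu
    rw [← he]
    exact e.injective
  apply hinj
  rw [hYd] at key
  refine (mfderiv_extChartAt_mlieBracket u _ _).trans (key.trans ?_)
  refine Eq.trans ?_ (map_neg (mfderiv 𝓘(𝕜, EB) 𝓘(𝕜, EB) φ u : EB →L[𝕜] EB) _).symm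
  exact congrArg Neg.neg (chartField_apply u _ hφu)

end Manifold

end Action

/-! ### The curvature of a Cartan connection -/

section Curvature

variable {𝕜 : Type*} [RCLike 𝕜]
  {EG : Type*} [NormedAddCommGroup EG] [NormedSpace 𝕜 EG] [FiniteDimensional 𝕜 EG] [CompleteSpace EG]
  {G : Type*} [TopologicalSpace G] [ChartedSpace EG G] [Group G] [LieGroup 𝓘(𝕜, EG) ∞ G]

lemma mulInvariantVectorField_one (A : GroupLieAlgebra 𝓘(𝕜, EG) G) :
    mulInvariantVectorField A (1 : G) = A := by
  have : (fun x : G ↦ 1 * x) = id := by ext; simp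
  rw [mulInvariantVectorField, this, mfderiv_id]
  rfl

lemma mdifferentiableAt_Ad_inv (A : GroupLieAlgebra 𝓘(𝕜, EG) G) (g : G) :
    MDifferentiableAt (M' := EG) 𝓘(𝕜, EG) 𝓘(𝕜, EG) (fun g : G ↦ (Ad 𝕜 g⁻¹ A : EG)) g :=
  ((contMDiffAt_Ad A g⁻¹).comp g (contMDiff_inv 𝓘(𝕜, EG) ∞).contMDiffAt).mdifferentiableAt (by simp)

/-- The derivative of the adjoint action is the adjoint representation. -/
lemma mfderiv_Ad_inv (a A : GroupLieAlgebra 𝓘(𝕜, EG) G) :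
    (mfderiv (M' := EG) 𝓘(𝕜, EG) 𝓘(𝕜, EG) (fun g : G ↦ (Ad 𝕜 g⁻¹ A : EG)) 1 : EG →L[𝕜] EG) a =
      (-⁅a, A⁆ : GroupLieAlgebra 𝓘(𝕜, EG) G) := by
  have h0 : Ad 𝕜 (1 : G)⁻¹ A = A := by rw [inv_one, Ad_one]; rfl
  -- `G` acts on itself by right multiplication. The generators are the left-invariant fields, and
  -- right translation by `q` transforms that family by `Ad q⁻¹`.
  have h := mlieBracket_of_action (𝔞 := EG) (act := fun x y : G ↦ x * y) (q₀ := 1)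
    (contMDiff_mul 𝓘(𝕜, EG) ∞) (fun x ↦ mul_one x) (fun A : EG ↦ mulInvariantVectorField A)
    mulInvariantVectorField_add mulInvariantVectorField_smul (u := 1)
    (fun A ↦ mdifferentiableAt_mulInvariantVectorField _) (mdifferentiableAt_Ad_inv A 1)
    (fun q ↦ by
      rw [h0]
      exact mfderiv_mul_right_mulInvariantVectorField q 1 A) (A := a) (a := a)
    (fun x ↦ rfl)
  have h1 : (mulInvariantVectorField (I := 𝓘(𝕜, EG)) ((mfderiv (M' := EG) 𝓘(𝕜, EG) 𝓘(𝕜, EG)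
      (fun g : G ↦ (Ad 𝕜 g⁻¹ A : EG)) 1 : EG →L[𝕜] EG) a) (1 : G) : EG) =
      (mfderiv (M' := EG) 𝓘(𝕜, EG) 𝓘(𝕜, EG) (fun g : G ↦ (Ad 𝕜 g⁻¹ A : EG)) 1 : EG →L[𝕜] EG) a :=
    mulInvariantVectorField_one (𝕜 := 𝕜) (G := G) _
  simp only [h0] at h
  rw [← h1]
  exact neg_eq_iff_eq_neg.1 h.symm

variable {EP : Type*} [NormedAddCommGroup EP] [NormedSpace 𝕜 EP]
  {EB : Type*} [NormedAddCommGroup EB] [NormedSpace 𝕜 EB] [FiniteDimensional 𝕜 EB] [CompleteSpace EB]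
  {EM : Type*} [NormedAddCommGroup EM] [NormedSpace 𝕜 EM]
  {P : Subgroup G} [ChartedSpace EP P] [LieGroup 𝓘(𝕜, EP) ∞ P]
  {B : Type*} [TopologicalSpace B] [ChartedSpace EB B] [IsManifold 𝓘(𝕜, EB) ∞ B]
  {M : Type*} [TopologicalSpace M] [ChartedSpace EM M]
  {bdl : PrincipalBundle 𝕜 EP EB EM P B M} (c : CartanConnection EG bdl)

namespace CartanConnection

lemma curvatureForm_apply (u : B) (A A' : GroupLieAlgebra 𝓘(𝕜, EG) G) :
    c.curvatureForm u A A' = ⁅A, A'⁆ -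
      c.form u (VectorField.mlieBracket 𝓘(𝕜, EB) (c.constField A) (c.constField A') u) := rfl

lemma form_mlieBracket (u : B) (A A' : GroupLieAlgebra 𝓘(𝕜, EG) G) :
    c.form u (VectorField.mlieBracket 𝓘(𝕜, EB) (c.constField A) (c.constField A') u) =
      ⁅A, A'⁆ - c.curvatureForm u A A' := by
  rw [curvatureForm_apply, sub_sub_cancel]

lemma form_constField (u : B) (A : GroupLieAlgebra 𝓘(𝕜, EG) G) :
    c.form u (c.constField A u) = A := (c.form u).apply_symm_apply A

lemma curvatureForm_skew (u : B) (A A' : GroupLieAlgebra 𝓘(𝕜, EG) G) :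
    c.curvatureForm u A A' = -c.curvatureForm u A' A := by
  rw [curvatureForm_apply, curvatureForm_apply, VectorField.mlieBracket_swap_apply, map_neg,
    ← lie_skew]
  abel

/-- Equivariance of `ω`, read on the parallelizing fields. Both equivariance and horizontality of
the curvature rest on it. -/
lemma mfderiv_act_constField (u : B) (p : P) (A : GroupLieAlgebra 𝓘(𝕜, EG) G) :
    mfderiv 𝓘(𝕜, EB) 𝓘(𝕜, EB) (fun w ↦ bdl.act w p) u (c.constField A u) =
      c.constField (Ad 𝕜 (p⁻¹ : P).1 A) (bdl.act u p) := by
  apply (c.form (bdl.act u p)).injective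
  rw [c.equivariant, form_constField, form_constField]

lemma contMDiff_act_right (p : P) : ContMDiff 𝓘(𝕜, EB) 𝓘(𝕜, EB) ∞ (fun w ↦ bdl.act w p) :=
  bdl.contMDiff_act.comp (contMDiff_id.prodMk contMDiff_const)

/-- The curvature form is equivariant. -/
lemma curvatureForm_act (u : B) (p : P) (A A' : GroupLieAlgebra 𝓘(𝕜, EG) G) :
    c.curvatureForm (bdl.act u p) (Ad 𝕜 (p⁻¹ : P).1 A) (Ad 𝕜 (p⁻¹ : P).1 A') =
      Ad 𝕜 (p⁻¹ : P).1 (c.curvatureForm u A A') := by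
  have h := mfderiv_mlieBracket (contMDiff_act_right (bdl := bdl) p)
    (isInvertible_mfderiv_of_inverse (contMDiff_act_right (bdl := bdl) p)
      (contMDiff_act_right (bdl := bdl) p⁻¹)
      (fun x ↦ by rw [← bdl.act_mul, mul_inv_cancel, bdl.act_one])
      (fun x ↦ by rw [← bdl.act_mul, inv_mul_cancel, bdl.act_one]))
    (fun x ↦ c.mfderiv_act_constField x p A) (fun x ↦ c.mfderiv_act_constField x p A') u
    (c.mdifferentiableAt_constField _ _) (c.mdifferentiableAt_constField _ _)
  rw [curvatureForm_apply, curvatureForm_apply, ← h, c.equivariant, ← Ad_lie, ← map_sub]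

/-- The curvature form is horizontal. -/
lemma curvatureForm_horizontal {gr : TwoGrading 𝕜 (GroupLieAlgebra 𝓘(𝕜, EG) G)}
    (hP : IsParabolic EP gr P) (u : B) {A : GroupLieAlgebra 𝓘(𝕜, EG) G} (hA : A ∈ gr.filt 0)
    (A' : GroupLieAlgebra 𝓘(𝕜, EG) G) : c.curvatureForm u A A' = 0 := by
  obtain ⟨a, ha⟩ := (hP.range_mfderiv A).1 hA
  let ρ : P → EG := fun p ↦ Ad 𝕜 (p : G)⁻¹ A'
  have hval : MDifferentiableAt 𝓘(𝕜, EP) 𝓘(𝕜, EG) (Subtype.val : P → G) 1 :=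
    hP.contMDiff_val.mdifferentiable (by simp) 1
  have hρ : MDifferentiableAt 𝓘(𝕜, EP) 𝓘(𝕜, EG) ρ 1 :=
    (mdifferentiableAt_Ad_inv A' (1 : G)).comp_of_eq (1 : P) hval rfl
  have hρ1 : ρ 1 = A' := by
    change Ad 𝕜 (1 : G)⁻¹ A' = A'
    rw [inv_one, Ad_one]
    rfl
  have hρd : (mfderiv 𝓘(𝕜, EP) 𝓘(𝕜, EG) ρ 1 : EP →L[𝕜] EG) a =
      (-⁅A, A'⁆ : GroupLieAlgebra 𝓘(𝕜, EG) G) := by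
    have h1 := mfderiv_comp_of_apply_eq (x := (1 : P)) (mdifferentiableAt_Ad_inv A' (1 : G)) hval rfl
    rw [← mfderiv_Ad_inv, ← ha]
    exact congrArg (fun L : EP →L[𝕜] EG ↦ L a) h1
  -- For `A` in `𝔭` the field `ω⁻¹(A)` generates the principal action and `ρ` has derivative `-[A,
  -- A']`. Hence `[ω⁻¹(A), ω⁻¹(A')] = ω⁻¹([A, A'])`, which is vanishing curvature.
  have h := mlieBracket_of_action (𝔞 := EG) (act := bdl.act) (q₀ := 1) bdl.contMDiff_act bdl.act_one
    (fun A : EG ↦ c.constField A) c.constField_add c.constField_smul (u := u)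
    (fun A ↦ c.mdifferentiableAt_constField A u) hρ
    (fun p ↦ by
      rw [hρ1]
      exact c.mfderiv_act_constField u p A') (A := A) (a := a)
    (fun x ↦ by
      have h2 : ∀ y, y = x → (c.form y).symm A = ((c.form x).symm A : EB) := by
        rintro y rfl
        rfl
      refine Eq.trans ?_ (h2 _ (bdl.act_one x))
      apply (c.form (bdl.act x 1)).injective
      refine (c.fundamental x a).trans ?_
      rw [ha]
      exact ((c.form (bdl.act x 1)).apply_symm_apply A).symm)
  simp only [hρ1, hρd] at h
  refine (congrArg (fun v : EB ↦ (⁅A, A'⁆ : GroupLieAlgebra 𝓘(𝕜, EG) G) - (c.form u : EB → GroupLieAlgebra 𝓘(𝕜, EG) G) v) h).trans ?_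
  rw [map_neg, form_constField, neg_neg, sub_self]

lemma contMDiff_curvatureForm (A A' : GroupLieAlgebra 𝓘(𝕜, EG) G) :
    ContMDiff (M' := EG) 𝓘(𝕜, EB) 𝓘(𝕜, EG) ∞ (fun u ↦ (c.curvatureForm u A A' : EG)) := by
  have : IsManifold 𝓘(𝕜, EB) (((⊤ : ℕ∞) : WithTop ℕ∞) + 1) B :=
    inferInstanceAs (IsManifold 𝓘(𝕜, EB) ∞ B)
  have h1 : ContMDiff 𝓘(𝕜, EB) 𝓘(𝕜, EB).tangent ∞ (fun w ↦
      (⟨w, VectorField.mlieBracket 𝓘(𝕜, EB) (c.constField A) (c.constField A') w⟩ :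
        TangentBundle 𝓘(𝕜, EB) B)) :=
    ContDiff.mlieBracket_vectorField (m := ⊤) (n := ⊤) (c.contMDiff_constField A)
      (c.contMDiff_constField A') (by rw [minSmoothness_of_isRCLikeNormedField]; rfl)
  have h2 := c.contMDiff_form.comp h1
  exact (contMDiff_const (M' := EG) (c := (⁅A, A'⁆ : GroupLieAlgebra 𝓘(𝕜, EG) G))).sub h2

end CartanConnection
end Curvature

/-! ### The Bianchi identity -/

section Bianchi

variable {𝕜 : Type*} [RCLike 𝕜]
  {EG : Type*} [NormedAddCommGroup EG] [NormedSpace 𝕜 EG] [FiniteDimensional 𝕜 EG] [CompleteSpace EG]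
  {G : Type*} [TopologicalSpace G] [ChartedSpace EG G] [Group G] [LieGroup 𝓘(𝕜, EG) ∞ G]
  {EP : Type*} [NormedAddCommGroup EP] [NormedSpace 𝕜 EP]
  {EB : Type*} [NormedAddCommGroup EB] [NormedSpace 𝕜 EB] [FiniteDimensional 𝕜 EB] [CompleteSpace EB]
  {EM : Type*} [NormedAddCommGroup EM] [NormedSpace 𝕜 EM]
  {P : Subgroup G} [ChartedSpace EP P] [LieGroup 𝓘(𝕜, EP) ∞ P]
  {B : Type*} [TopologicalSpace B] [ChartedSpace EB B] [IsManifold 𝓘(𝕜, EB) ∞ B]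
  {M : Type*} [TopologicalSpace M] [ChartedSpace EM M]
  {bdl : PrincipalBundle 𝕜 EP EB EM P B M} (c : CartanConnection EG bdl)

namespace CartanConnection

/-- The derivative at `u` of a `𝔤`-valued function in direction of the field `ω⁻¹(X)`. -/
def fieldDeriv (F : B → GroupLieAlgebra 𝓘(𝕜, EG) G) (u : B) (X : GroupLieAlgebra 𝓘(𝕜, EG) G) :
    GroupLieAlgebra 𝓘(𝕜, EG) G :=
  (mfderiv (M' := EG) 𝓘(𝕜, EB) 𝓘(𝕜, EG) F u : EB →L[𝕜] EG) (c.constField X u)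

lemma fieldDeriv_clm {F : B → GroupLieAlgebra 𝓘(𝕜, EG) G} {u : B}
    (hF : MDifferentiableAt (M' := EG) 𝓘(𝕜, EB) 𝓘(𝕜, EG) F u)
    {E : Type*} [NormedAddCommGroup E] [NormedSpace 𝕜 E] (L : EG →L[𝕜] E)
    (X : GroupLieAlgebra 𝓘(𝕜, EG) G) :
    (mfderiv 𝓘(𝕜, EB) 𝓘(𝕜, E) (fun w ↦ L (F w)) u : EB →L[𝕜] E) (c.constField X u) =
      L (c.fieldDeriv F u X) := by
  have h := mfderiv_comp_of_apply_eq (Y := EG) (x := u) (y := F u) L.differentiableAt.mdifferentiableAt hF rfl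
  refine (congrArg (fun T : EB →L[𝕜] E ↦ T (c.constField X u)) h).trans ?_
  exact congrArg (fun T : EG →L[𝕜] E ↦ T (c.fieldDeriv F u X)) ((mfderiv_eq_fderiv).trans L.fderiv)

/-- A function with values in the kernel of a linear map has its derivatives there too. With `L` a
projection, differentiation respects the filtration. -/
lemma fieldDeriv_eq_zero {F : B → GroupLieAlgebra 𝓘(𝕜, EG) G} {u : B}
    (hF : MDifferentiableAt (M' := EG) 𝓘(𝕜, EB) 𝓘(𝕜, EG) F u)
    (L : GroupLieAlgebra 𝓘(𝕜, EG) G →ₗ[𝕜] GroupLieAlgebra 𝓘(𝕜, EG) G) (h : ∀ w, L (F w) = 0)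
    (X : GroupLieAlgebra 𝓘(𝕜, EG) G) : L (c.fieldDeriv F u X) = 0 := by
  let L' : EG →L[𝕜] EG := LinearMap.toContinuousLinearMap (E := EG) (F' := EG) L
  have h2 : (fun w ↦ L' (F w)) = fun _ ↦ 0 := funext h
  have h3 : (mfderiv 𝓘(𝕜, EB) 𝓘(𝕜, EG) (fun w ↦ L' (F w)) u : EB →L[𝕜] EG) = 0 := by
    rw [h2]
    exact mfderiv_const
  exact (c.fieldDeriv_clm hF L' X).symm.trans
    (congrArg (fun T : EB →L[𝕜] EG ↦ T (c.constField X u)) h3)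

/-- Expanding `F` in a basis of `𝔤`, the Leibniz rule adds the derivative of `F` to the bracket
formula for constant fields. -/
lemma form_mlieBracket_symm {F : B → GroupLieAlgebra 𝓘(𝕜, EG) G} {u : B}
    (hF : MDifferentiableAt (M' := EG) 𝓘(𝕜, EB) 𝓘(𝕜, EG) F u) (X : GroupLieAlgebra 𝓘(𝕜, EG) G) :
    c.form u (VectorField.mlieBracket 𝓘(𝕜, EB) (c.constField X)
      (fun w ↦ (c.form w).symm (F w)) u) =
      c.fieldDeriv F u X + (⁅X, F u⁆ - c.curvatureForm u X (F u)) := by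
  let b : Module.Basis _ 𝕜 (GroupLieAlgebra 𝓘(𝕜, EG) G) := Module.finBasis 𝕜 EG
  let lam : Fin (Module.finrank 𝕜 EG) → EG →L[𝕜] 𝕜 := fun i ↦
    LinearMap.toContinuousLinearMap (E := EG) (F' := 𝕜) (b.coord i)
  let f : Fin (Module.finrank 𝕜 EG) → B → 𝕜 := fun i w ↦ lam i (F w)
  have hf : ∀ i, MDifferentiableAt 𝓘(𝕜, EB) 𝓘(𝕜, 𝕜) (f i) u := fun i ↦
    (lam i).differentiableAt.mdifferentiableAt.comp (M' := EG) u hF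
  have hfield : (fun w ↦ (c.form w).symm (F w)) = ∑ i, f i • c.constField (b i) := by
    funext w
    rw [Finset.sum_apply]
    refine (congrArg (c.form w).symm (b.sum_repr (F w)).symm).trans ?_
    rw [map_sum]
    exact Finset.sum_congr rfl fun i _ ↦ map_smul _ _ _
  have key : ∀ s : Finset (Fin (Module.finrank 𝕜 EG)),
      MDifferentiableAt 𝓘(𝕜, EB) 𝓘(𝕜, EB).tangent
        (fun w ↦ (⟨w, (∑ i ∈ s, f i • c.constField (b i)) w⟩ : TangentBundle 𝓘(𝕜, EB) B)) u ∧
      c.form u (VectorField.mlieBracket 𝓘(𝕜, EB) (c.constField X)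
        (∑ i ∈ s, f i • c.constField (b i)) u) =
      ∑ i ∈ s, (lam i (c.fieldDeriv F u X) • b i +
        f i u • (⁅X, b i⁆ - c.curvatureForm u X (b i))) := by
    intro s
    induction s using Finset.induction_on with
    | empty =>
      simp only [Finset.sum_empty, VectorField.mlieBracket_zero_right]
      refine ⟨?_, map_zero _⟩
      exact (Bundle.contMDiff_zeroSection 𝕜 (TangentSpace 𝓘(𝕜, EB) : B → Type _)
          (n := ∞)).mdifferentiableAt (by simp)
    | insert i s hi ih =>
      have h1 := (hf i).smul_section (c.mdifferentiableAt_constField (b i) u)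
      rw [Finset.sum_insert hi, Finset.sum_insert hi]
      refine ⟨mdifferentiableAt_add_section h1 ih.1, ?_⟩
      rw [VectorField.mlieBracket_add_right h1 ih.1, map_add, ih.2,
        VectorField.mlieBracket_smul_right (hf i) (c.mdifferentiableAt_constField (b i) u),
        map_add, map_smul, map_smul, form_constField, form_mlieBracket]
      have h2 := c.fieldDeriv_clm hF (lam i) X
      rw [← h2]
      rfl
  rw [hfield, (key _).2, Finset.sum_add_distrib]
  congr 1
  · exact b.sum_repr _
  · have h : ∀ L : GroupLieAlgebra 𝓘(𝕜, EG) G →ₗ[𝕜] GroupLieAlgebra 𝓘(𝕜, EG) G,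
        L (F u) = ∑ i, f i u • L (b i) := fun L ↦ by
      refine (congrArg L (b.sum_repr (F u)).symm).trans ?_
      rw [map_sum]
      exact Finset.sum_congr rfl fun i _ ↦ map_smul _ _ _
    exact (h (LieAlgebra.ad 𝕜 _ X - c.curvatureForm u X)).symm

lemma mlieBracket_constField (A A' : GroupLieAlgebra 𝓘(𝕜, EG) G) :
    VectorField.mlieBracket 𝓘(𝕜, EB) (c.constField A) (c.constField A') =
      fun w ↦ (c.form w).symm (⁅A, A'⁆ - c.curvatureForm w A A') := by
  funext w
  rw [← form_mlieBracket, ContinuousLinearEquiv.symm_apply_apply]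

lemma fieldDeriv_const_sub {F : B → GroupLieAlgebra 𝓘(𝕜, EG) G} {u : B}
    (hF : MDifferentiableAt (M' := EG) 𝓘(𝕜, EB) 𝓘(𝕜, EG) F u)
    (v X : GroupLieAlgebra 𝓘(𝕜, EG) G) :
    c.fieldDeriv (fun w ↦ v - F w) u X = -c.fieldDeriv F u X := by
  let F' : B → EG := F
  let D : EB →L[𝕜] EG := mfderiv 𝓘(𝕜, EB) 𝓘(𝕜, EG) F' u
  have hF' : HasMFDerivAt 𝓘(𝕜, EB) 𝓘(𝕜, EG) F' u D := hF.hasMFDerivAt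
  let v' : EG := v
  have h : HasMFDerivAt 𝓘(𝕜, EB) 𝓘(𝕜, EG) (fun w ↦ v' - F' w) u ((0 : EB →L[𝕜] EG) - D) :=
    (hasMFDerivAt_const v' u).sub hF'
  refine (congrArg (fun T : EB →L[𝕜] EG ↦ T (c.constField X u)) h.mfderiv).trans ?_
  exact congrArg (fun T : EB →L[𝕜] EG ↦ T (c.constField X u)) (zero_sub D)

lemma mdifferentiableAt_curvatureForm (u : B) (Y Z : GroupLieAlgebra 𝓘(𝕜, EG) G) :
    MDifferentiableAt (M' := EG) 𝓘(𝕜, EB) 𝓘(𝕜, EG) (fun w ↦ c.curvatureForm w Y Z) u :=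
  (c.contMDiff_curvatureForm Y Z).mdifferentiableAt (by simp)

lemma form_mlieBracket_mlieBracket (u : B) (X Y Z : GroupLieAlgebra 𝓘(𝕜, EG) G) :
    c.form u (VectorField.mlieBracket 𝓘(𝕜, EB) (c.constField X)
      (VectorField.mlieBracket 𝓘(𝕜, EB) (c.constField Y) (c.constField Z)) u) =
      -c.fieldDeriv (fun w ↦ c.curvatureForm w Y Z) u X +
        (⁅X, ⁅Y, Z⁆ - c.curvatureForm u Y Z⁆ -
          c.curvatureForm u X (⁅Y, Z⁆ - c.curvatureForm u Y Z)) := by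
  have hK := c.mdifferentiableAt_curvatureForm u Y Z
  have hK' : MDifferentiableAt (M' := EG) 𝓘(𝕜, EB) 𝓘(𝕜, EG)
    (fun w ↦ ⁅Y, Z⁆ - c.curvatureForm w Y Z) u := mdifferentiableAt_const.sub hK
  rw [mlieBracket_constField, form_mlieBracket_symm c hK', fieldDeriv_const_sub c hK]

/-- The Bianchi identity. -/
theorem bianchi (u : B) (X Y Z : GroupLieAlgebra 𝓘(𝕜, EG) G) :
    ⁅X, c.curvatureForm u Y Z⁆ - ⁅Y, c.curvatureForm u X Z⁆ + ⁅Z, c.curvatureForm u X Y⁆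
      - c.curvatureForm u ⁅X, Y⁆ Z + c.curvatureForm u ⁅X, Z⁆ Y - c.curvatureForm u ⁅Y, Z⁆ X =
    c.curvatureForm u X (c.curvatureForm u Y Z) - c.curvatureForm u Y (c.curvatureForm u X Z)
      + c.curvatureForm u Z (c.curvatureForm u X Y)
      - c.fieldDeriv (fun w ↦ c.curvatureForm w Y Z) u X
      + c.fieldDeriv (fun w ↦ c.curvatureForm w X Z) u Y
      - c.fieldDeriv (fun w ↦ c.curvatureForm w X Y) u Z := by
  have hs : ∀ A : GroupLieAlgebra 𝓘(𝕜, EG) G, ContMDiffAt 𝓘(𝕜, EB) 𝓘(𝕜, EB).tangent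
      (minSmoothness 𝕜 2) (fun w ↦ (⟨w, c.constField A w⟩ : TangentBundle 𝓘(𝕜, EB) B)) u :=
    fun A ↦ (c.contMDiff_constField A u).of_le
      (by rw [minSmoothness_of_isRCLikeNormedField]; exact ENat.LEInfty.out)
  -- The Jacobi identity of the three fields, evaluated by `ω`. Its purely algebraic part cancels by
  -- the Jacobi identity of `𝔤`.
  have h := VectorField.leibniz_identity_mlieBracket_apply (hs X) (hs Y) (hs Z)
  rw [VectorField.mlieBracket_swap_apply (V := VectorField.mlieBracket 𝓘(𝕜, EB) _ _)] at h
  have h3 := congrArg (c.form u) h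
  rw [map_add, map_neg, form_mlieBracket_mlieBracket, form_mlieBracket_mlieBracket,
    form_mlieBracket_mlieBracket] at h3
  have hj := leibniz_lie X Y Z
  rw [← lie_skew ⁅X, Y⁆ Z] at hj
  rw [c.curvatureForm_skew u ⁅X, Y⁆ Z, c.curvatureForm_skew u ⁅X, Z⁆ Y,
    c.curvatureForm_skew u ⁅Y, Z⁆ X]
  simp only [lie_sub, map_sub] at h3
  rw [← sub_eq_zero] at h3 hj ⊢
  rw [← neg_eq_zero, ← h3]
  refine Eq.trans ?_ ((sub_eq_self (a := _)).2 hj)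
  abel

end CartanConnection
end Bianchi

/-! ### Filtered automorphisms and their graded parts -/

namespace TwoGrading

section Filtered

variable {𝕜 : Type*} [Field 𝕜] {𝔤 : Type*} [LieRing 𝔤] [LieAlgebra 𝕜 𝔤] (gr : TwoGrading 𝕜 𝔤)

lemma sub_proj_mem_filt {i : ℤ} {x : 𝔤} (hx : x ∈ gr.filt i) :
    x - gr.proj i x ∈ gr.filt (i + 1) := gr.mem_filt_iff.2 fun j hj ↦ by
  rw [map_sub, gr.proj_apply_of_mem (gr.proj_mem i x)]
  split_ifs with h
  · rw [h, sub_self]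
  · rw [gr.mem_filt_iff.1 hx j (by omega), sub_zero]

lemma proj_eq_of_sub_mem {i j : ℤ} (hij : i < j) {x y : 𝔤} (h : x - y ∈ gr.filt j) :
    gr.proj i x = gr.proj i y := by
  rw [← sub_eq_zero, ← map_sub]
  exact gr.mem_filt_iff.1 h i hij

/-- Replacing `x` and `y` by their leading parts changes the bracket only in filtration degree `i +
j + 1`. -/
lemma proj_add_lie {i j : ℤ} {x y : 𝔤} (hx : x ∈ gr.filt i) (hy : y ∈ gr.filt j) :
    gr.proj (i + j) ⁅x, y⁆ = ⁅gr.proj i x, gr.proj j y⁆ := by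
  rw [← gr.proj_self (gr.lie_mem (gr.proj_mem i x) (gr.proj_mem j y))]
  refine gr.proj_eq_of_sub_mem (lt_add_one _) ?_
  have h : ⁅x, y⁆ - ⁅gr.proj i x, gr.proj j y⁆ =
      ⁅x - gr.proj i x, y⁆ + ⁅gr.proj i x, y - gr.proj j y⁆ := by
    rw [sub_lie, lie_sub]
    abel
  rw [h]
  refine add_mem ?_ ?_
  · rw [show i + j + 1 = i + 1 + j by ring]
    exact gr.lie_mem_filt (gr.sub_proj_mem_filt hx) hy
  · rw [add_assoc]
    exact gr.lie_mem_filt (gr.piece_le_filt le_rfl (gr.proj_mem i x)) (gr.sub_proj_mem_filt hy)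

/-- The graded part of a linear endomorphism. -/
def gradedPart (α : 𝔤 →ₗ[𝕜] 𝔤) : 𝔤 →ₗ[𝕜] 𝔤 :=
  ∑ i ∈ Finset.Icc (-2 : ℤ) 2, gr.proj i ∘ₗ α ∘ₗ gr.proj i

lemma gradedPart_of_mem (α : 𝔤 →ₗ[𝕜] 𝔤) {i : ℤ} {x : 𝔤} (hx : x ∈ gr.piece i) :
    gr.gradedPart α x = gr.proj i (α x) := by
  simp only [gradedPart, LinearMap.sum_apply, LinearMap.comp_apply, gr.proj_apply_of_mem hx]
  by_cases h : i ∈ Finset.Icc (-2 : ℤ) 2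
  · rw [Finset.sum_eq_single_of_mem i h fun j _ hj ↦ by rw [if_neg hj.symm, map_zero, map_zero],
      if_pos rfl]
  · have h0 : x = 0 := gr.eq_zero_of_mem hx (by rw [Finset.mem_Icc] at h; rw [lt_abs]; omega)
    simp [h0]

lemma gradedPart_mem (α : 𝔤 →ₗ[𝕜] 𝔤) (i : ℤ) (x : 𝔤) (hx : x ∈ gr.piece i) :
    gr.gradedPart α x ∈ gr.piece i := by
  rw [gr.gradedPart_of_mem α hx]
  exact gr.proj_mem _ _

lemma gradedPart_proj {α : 𝔤 →ₗ[𝕜] 𝔤} (hα : ∀ i, ∀ x ∈ gr.filt i, α x ∈ gr.filt i) {i : ℤ} {x : 𝔤}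
    (hx : x ∈ gr.filt i) : gr.gradedPart α (gr.proj i x) = gr.proj i (α x) := by
  rw [gr.gradedPart_of_mem α (gr.proj_mem i x)]
  refine (gr.proj_eq_of_sub_mem (lt_add_one i) ?_).symm
  rw [← map_sub]
  exact hα _ _ (gr.sub_proj_mem_filt hx)

lemma gradedPart_gradedPart {α β : 𝔤 →ₗ[𝕜] 𝔤} (hα : ∀ i, ∀ x ∈ gr.filt i, α x ∈ gr.filt i)
    (hβ : ∀ i, ∀ x ∈ gr.filt i, β x ∈ gr.filt i) (h : ∀ x, β (α x) = x) (x : 𝔤) :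
    gr.gradedPart β (gr.gradedPart α x) = x := by
  induction x using gr.homogeneous_induction with
  | mem i x hx =>
    rw [gr.gradedPart_of_mem α hx, gr.gradedPart_proj hβ (hα _ _ (gr.piece_le_filt le_rfl hx)), h,
      gr.proj_self hx]
  | add x y hx hy => rw [map_add, map_add, hx, hy]

lemma gradedPart_lie {α : 𝔤 →ₗ[𝕜] 𝔤} (hα : ∀ i, ∀ x ∈ gr.filt i, α x ∈ gr.filt i)
    (h : ∀ x y, α ⁅x, y⁆ = ⁅α x, α y⁆) (x y : 𝔤) :
    gr.gradedPart α ⁅x, y⁆ = ⁅gr.gradedPart α x, gr.gradedPart α y⁆ := by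
  induction x using gr.homogeneous_induction with
  | mem i x hx =>
    induction y using gr.homogeneous_induction with
    | mem j y hy =>
      rw [gr.gradedPart_of_mem α (gr.lie_mem hx hy), h, gr.gradedPart_of_mem α hx,
        gr.gradedPart_of_mem α hy, gr.proj_add_lie (hα _ _ (gr.piece_le_filt le_rfl hx))
        (hα _ _ (gr.piece_le_filt le_rfl hy))]
    | add y y' hy hy' => rw [lie_add, map_add, hy, hy', map_add, lie_add]
  | add x x' hx hx' => rw [add_lie, map_add, hx, hx', map_add, add_lie]

/-- The graded part of a filtered automorphism. -/
def gradedEquiv (α : 𝔤 ≃ₗ⁅𝕜⁆ 𝔤) (hα : ∀ i, ∀ x ∈ gr.filt i, α x ∈ gr.filt i)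
    (hα' : ∀ i, ∀ x ∈ gr.filt i, α.symm x ∈ gr.filt i) : 𝔤 ≃ₗ⁅𝕜⁆ 𝔤 :=
  { gr.gradedPart α.toLinearEquiv.toLinearMap with
    map_lie' := gr.gradedPart_lie hα (fun x y ↦ α.map_lie x y) _ _
    invFun := gr.gradedPart α.symm.toLinearEquiv.toLinearMap
    left_inv := gr.gradedPart_gradedPart hα hα' α.symm_apply_apply
    right_inv := gr.gradedPart_gradedPart hα' hα α.apply_symm_apply }

variable (α : 𝔤 ≃ₗ⁅𝕜⁆ 𝔤) (hα : ∀ i, ∀ x ∈ gr.filt i, α x ∈ gr.filt i)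
    (hα' : ∀ i, ∀ x ∈ gr.filt i, α.symm x ∈ gr.filt i)

lemma gradedEquiv_mem (i : ℤ) (x : 𝔤) (hx : x ∈ gr.piece i) :
    gr.gradedEquiv α hα hα' x ∈ gr.piece i := gr.gradedPart_mem _ i x hx

lemma coe_negProj_mem_filt {i : ℤ} {x : 𝔤} (hx : x ∈ gr.filt i) :
    (gr.negProj x : 𝔤) ∈ gr.filt i := gr.mem_filt_iff.2 fun j hj ↦ by
  by_cases h : j < 0
  · rw [gr.proj_negProj h, gr.mem_filt_iff.1 hx j hj]
  · exact gr.mem_neg_iff.1 (gr.negProj x).2 j (not_lt.1 h)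

lemma apply_sub_apply_mem_filt {l : ℤ} {ψ : gr.C2} (h : ∀ j < l, gr.homComp j ψ = 0) {i j : ℤ}
    {x x' y y' : gr.neg} (hx' : (x' : 𝔤) ∈ gr.filt i) (hy : (y : 𝔤) ∈ gr.filt j)
    (hxx' : (x - x' : 𝔤) ∈ gr.filt (i + 1)) (hyy' : (y - y' : 𝔤) ∈ gr.filt (j + 1)) :
    ψ x y - ψ x' y' ∈ gr.filt (i + j + l + 1) := by
  have e : ψ x y - ψ x' y' = ψ (x - x') y + ψ x' (y - y') := by
    rw [map_sub, map_sub, LinearMap.sub_apply]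
    abel
  have h1 := gr.apply_mem_filt (x := x - x') (y := y) h hxx' hy
  have h2 := gr.apply_mem_filt (x := x') (y := y - y') h hx' hyy'
  rw [e, show i + j + l + 1 = i + 1 + j + l by ring]
  refine add_mem h1 ?_
  rwa [show i + 1 + j + l = i + (j + 1) + l by ring]

variable [CharZero 𝕜] [FiniteDimensional 𝕜 𝔤] [LieAlgebra.IsSemisimple 𝕜 𝔤] in
/-- The lowest homogeneous components of cochains which correspond under a filtered automorphism
correspond under its graded part. -/
lemma homComp_gradedEquiv {ψ ψ' : gr.C2}
    (h : ∀ x y : gr.neg, ψ' (gr.negProj (α x)) (gr.negProj (α y)) = α (ψ x y)) {l : ℤ}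
    (hψ : ∀ j < l, gr.homComp j ψ = 0) (hψ' : ∀ j < l, gr.homComp j ψ' = 0) (x y : gr.neg) :
    gr.homComp l ψ' (gr.negEquiv (gr.gradedEquiv α hα hα') (gr.gradedEquiv_mem α hα hα') x)
      (gr.negEquiv (gr.gradedEquiv α hα hα') (gr.gradedEquiv_mem α hα hα') y) =
      gr.gradedEquiv α hα hα' (gr.homComp l ψ x y) := by
  set θ := gr.gradedEquiv α hα hα'
  set hθ := gr.gradedEquiv_mem α hα hα'
  -- The graded image is the leading part of the filtered image, so they differ one filtration step
  -- higher; a lowest component does not see the difference.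
  have key : ∀ i, i = -2 ∨ i = -1 → ∀ x : gr.neg, (x : 𝔤) ∈ gr.piece i →
      (gr.negEquiv θ hθ x - gr.negProj (α x) : 𝔤) ∈ gr.filt (i + 1) := fun i hi x hx ↦ by
    have h1 := gr.coe_negProj_mem_filt (hα _ _ (gr.piece_le_filt le_rfl hx))
    have h2 : (gr.negEquiv θ hθ x : 𝔤) = gr.proj i (gr.negProj (α x) : 𝔤) := by
      rw [gr.proj_negProj (by omega)]
      exact gr.gradedPart_of_mem _ hx
    rw [h2, ← neg_mem_iff, neg_sub]
    exact gr.sub_proj_mem_filt h1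
  induction x using gr.neg_induction with
  | mem i hi x hx =>
    induction y using gr.neg_induction with
    | mem j hj y hy =>
      rw [gr.homComp_apply ψ' (hθ _ _ hx) (hθ _ _ hy) hi hj, gr.homComp_apply ψ hx hy hi hj]
      have h1 : θ (gr.proj (i + j + l) (ψ x y)) = gr.proj (i + j + l) (α (ψ x y)) :=
        gr.gradedPart_proj hα (gr.apply_mem_filt hψ (gr.piece_le_filt le_rfl hx)
          (gr.piece_le_filt le_rfl hy))
      rw [h1, ← h]
      exact gr.proj_eq_of_sub_mem (lt_add_one _) (gr.apply_sub_apply_mem_filt hψ'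
        (gr.coe_negProj_mem_filt (hα _ _ (gr.piece_le_filt le_rfl hx)))
        (gr.piece_le_filt le_rfl (hθ _ _ hy)) (key i hi x hx) (key j hj y hy))
    | add y y' hy hy' => rw [map_add, map_add, hy, hy', map_add, map_add]
  | add x x' hx hx' =>
    simp only [map_add, LinearMap.add_apply] at hx hx' ⊢
    rw [hx, hx']

/-- The bracket on `𝔤₋` and its action on `𝔤` preserve degree, so `∂` commutes with taking
homogeneous components. -/
lemma proj_diff (ψ : gr.C2) (l : ℤ) {i j k : ℤ} {x y z : gr.neg}
    (hx : (x : 𝔤) ∈ gr.piece i) (hy : (y : 𝔤) ∈ gr.piece j) (hz : (z : 𝔤) ∈ gr.piece k)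
    (hi : i = -2 ∨ i = -1) (hj : j = -2 ∨ j = -1) (hk : k = -2 ∨ k = -1) :
    gr.diff (gr.homComp l ψ) x y z = gr.proj (i + j + k + l) (gr.diff ψ x y z) := by
  have h1 : ∀ {i j k : ℤ} {x y z : gr.neg}, (x : 𝔤) ∈ gr.piece i → (y : 𝔤) ∈ gr.piece j →
      (z : 𝔤) ∈ gr.piece k → (j = -2 ∨ j = -1) → (k = -2 ∨ k = -1) →
      ⁅x, gr.homComp l ψ y z⁆ = gr.proj (i + j + k + l) ⁅x, ψ y z⁆ := by
    intro i j k x y z hx hy hz hj hk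
    rw [gr.homComp_apply ψ hy hz hj hk, LieSubalgebra.coe_bracket_of_module,
      LieSubalgebra.coe_bracket_of_module, gr.proj_lie hx]
    congr 3
    ring
  have h2 : ∀ {i j k : ℤ} {x y z : gr.neg}, (x : 𝔤) ∈ gr.piece i → (y : 𝔤) ∈ gr.piece j →
      (z : 𝔤) ∈ gr.piece k → (i = -2 ∨ i = -1) → (j = -2 ∨ j = -1) → (k = -2 ∨ k = -1) →
      gr.homComp l ψ ⁅x, y⁆ z = gr.proj (i + j + k + l) (ψ ⁅x, y⁆ z) := by
    intro i j k x y z hx hy hz hi hj hk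
    have hxy : ((⁅x, y⁆ : gr.neg) : 𝔤) ∈ gr.piece (i + j) := gr.lie_mem hx hy
    by_cases h : i + j = -2
    · exact gr.homComp_apply ψ hxy hz (Or.inl h) hk
    · have : ⁅x, y⁆ = 0 := Subtype.ext (gr.eq_zero_of_mem hxy (by rw [lt_abs]; omega))
      rw [this, map_zero, map_zero, LinearMap.zero_apply, map_zero]
  simp only [LieModule.Cohomology.d₂₃_apply, map_add, map_sub]
  rw [h1 hx hy hz hj hk, h1 hy hx hz hi hk, h1 hz hx hy hi hj, h2 hx hy hz hi hj hk,
    h2 hx hz hy hi hk hj, h2 hy hz hx hj hk hi, show j + i + k = i + j + k by ring,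
    show k + i + j = i + j + k by ring, show i + k + j = i + j + k by ring,
    show j + k + i = i + j + k by ring]

end Filtered

/-! ### Classes in `H²` and graded automorphisms -/

section Cohomology

variable {𝕜 : Type*} [Field 𝕜] [CharZero 𝕜] {𝔤 : Type*} [LieRing 𝔤] [LieAlgebra 𝕜 𝔤]
  [FiniteDimensional 𝕜 𝔤] [LieAlgebra.IsSemisimple 𝕜 𝔤] (gr : TwoGrading 𝕜 𝔤)

lemma toH2_eq_iff {ψ φ : gr.C2} (hψ : gr.codiff2 ψ = 0) (hφ : gr.codiff2 φ = 0) :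
    gr.toH2 ψ hψ = gr.toH2 φ hφ ↔ ∃ χ, gr.codiff3 χ = ψ - φ :=
  Submodule.Quotient.eq _

lemma toH2_eq_zero_iff {ψ : gr.C2} (hψ : gr.codiff2 ψ = 0) :
    gr.toH2 ψ hψ = 0 ↔ ∃ χ, gr.codiff3 χ = ψ :=
  Submodule.Quotient.mk_eq_zero _

/-- A form on the quotient is pulled back to the kernel of `∂^*` and extended to `C₂`. Smoothness of
a class then follows from that of its representative. -/
lemma exists_linear_toH2 (f : gr.H2 →ₗ[𝕜] 𝕜) :
    ∃ g : gr.C2 →ₗ[𝕜] 𝕜, ∀ ψ hψ, f (gr.toH2 ψ hψ) = g ψ := by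
  let N := (LinearMap.range gr.codiff3).submoduleOf (LinearMap.ker gr.codiff2)
  obtain ⟨g, hg⟩ := LinearMap.exists_extend (f ∘ₗ N.mkQ)
  exact ⟨g, fun ψ hψ ↦ (LinearMap.congr_fun hg ⟨ψ, hψ⟩).symm⟩

variable (θ : 𝔤 ≃ₗ⁅𝕜⁆ 𝔤) (hθ : ∀ i, ∀ x ∈ gr.piece i, θ x ∈ gr.piece i)

lemma codiff2_eq_zero_of_equiv {ψ ψ' : gr.C2}
    (h : ∀ x y, ψ' (gr.negEquiv θ hθ x) (gr.negEquiv θ hθ y) = θ (ψ x y))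
    (hψ : gr.codiff2 ψ = 0) : gr.codiff2 ψ' = 0 := by
  ext x
  obtain ⟨x, rfl⟩ := (gr.negEquiv θ hθ).surjective x
  rw [gr.codiff2_equiv θ hθ h, hψ]
  exact map_zero θ

/-- A graded automorphism commutes with `∂^*`, so it transports a `C₃`-primitive of the difference.
-/
lemma toH2_equiv {ψ ψ' φ φ' : gr.C2}
    (h : ∀ x y, ψ' (gr.negEquiv θ hθ x) (gr.negEquiv θ hθ y) = θ (ψ x y))
    (k : ∀ x y, φ' (gr.negEquiv θ hθ x) (gr.negEquiv θ hθ y) = θ (φ x y))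
    {hψ : gr.codiff2 ψ = 0} {hψ' : gr.codiff2 ψ' = 0} {hφ : gr.codiff2 φ = 0}
    {hφ' : gr.codiff2 φ' = 0} (e : gr.toH2 ψ hψ = gr.toH2 φ hφ) :
    gr.toH2 ψ' hψ' = gr.toH2 φ' hφ' := by
  obtain ⟨χ, hχ⟩ := (gr.toH2_eq_iff hψ hφ).1 e
  obtain ⟨χ', hχ'⟩ := gr.exists_equiv_cochain₃ θ hθ χ
  refine (gr.toH2_eq_iff hψ' hφ').2 ⟨χ', ?_⟩
  ext x y
  obtain ⟨x, rfl⟩ := (gr.negEquiv θ hθ).surjective x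
  obtain ⟨y, rfl⟩ := (gr.negEquiv θ hθ).surjective y
  refine (gr.codiff3_equiv θ hθ hχ' x y).trans ?_
  change _ = ψ' _ _ - φ' _ _
  rw [h, k, hχ, ← map_sub]
  rfl

end Cohomology
end TwoGrading

/-! ### The lowest homogeneous component of the curvature -/

section Lowest

variable {𝕜 : Type*} [RCLike 𝕜]
  {EG : Type*} [NormedAddCommGroup EG] [NormedSpace 𝕜 EG] [FiniteDimensional 𝕜 EG] [CompleteSpace EG]
  {G : Type*} [TopologicalSpace G] [ChartedSpace EG G] [Group G] [LieGroup 𝓘(𝕜, EG) ∞ G]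
  {EP : Type*} [NormedAddCommGroup EP] [NormedSpace 𝕜 EP]
  {EB : Type*} [NormedAddCommGroup EB] [NormedSpace 𝕜 EB] [FiniteDimensional 𝕜 EB] [CompleteSpace EB]
  {EM : Type*} [NormedAddCommGroup EM] [NormedSpace 𝕜 EM]
  {P : Subgroup G} [ChartedSpace EP P] [LieGroup 𝓘(𝕜, EP) ∞ P]
  {B : Type*} [TopologicalSpace B] [ChartedSpace EB B] [IsManifold 𝓘(𝕜, EB) ∞ B]
  {M : Type*} [TopologicalSpace M] [ChartedSpace EM M]
  {bdl : PrincipalBundle 𝕜 EP EB EM P B M} (c : CartanConnection EG bdl)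
  {gr : TwoGrading 𝕜 (GroupLieAlgebra 𝓘(𝕜, EG) G)}

lemma IsParabolic.Ad_mem_filt (hP : IsParabolic EP gr P) {g : G} (hg : g ∈ P) (i : ℤ)
    (x : GroupLieAlgebra 𝓘(𝕜, EG) G) (hx : x ∈ gr.filt i) : Ad 𝕜 g x ∈ gr.filt i := by
  rw [← (hP.mem_iff g).1 hg i]
  exact Submodule.mem_map_of_mem hx

namespace CartanConnection

lemma curvature_apply (u : B) (x y : gr.neg) : c.curvature gr u x y = c.curvatureForm u x y := rfl

lemma curvatureForm_eq (hP : IsParabolic EP gr P) (u : B) (A A' : GroupLieAlgebra 𝓘(𝕜, EG) G) :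
    c.curvatureForm u A A' = c.curvature gr u (gr.negProj A) (gr.negProj A') := by
  have h1 := c.curvatureForm_horizontal hP u (gr.sub_negProj_mem A) A'
  have h2 := c.curvatureForm_horizontal hP u (gr.sub_negProj_mem A') (gr.negProj A)
  rw [map_sub, LinearMap.sub_apply, sub_eq_zero] at h1 h2
  rw [h1, curvatureForm_skew, h2, curvature_apply, ← curvatureForm_skew]

/-- The Bianchi identity on `𝔤₋`. Horizontality allows the inner curvature value to be replaced by
its `𝔤₋`-part. -/
lemma diff_curvature (hP : IsParabolic EP gr P) (u : B) (x y z : gr.neg) :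
    gr.diff (c.curvature gr u) x y z =
      c.curvature gr u x (gr.negProj (c.curvature gr u y z))
      - c.curvature gr u y (gr.negProj (c.curvature gr u x z))
      + c.curvature gr u z (gr.negProj (c.curvature gr u x y))
      - c.fieldDeriv (fun w ↦ c.curvature gr w y z) u x
      + c.fieldDeriv (fun w ↦ c.curvature gr w x z) u y
      - c.fieldDeriv (fun w ↦ c.curvature gr w x y) u z := by
  have h : ∀ (x : gr.neg) (A : GroupLieAlgebra 𝓘(𝕜, EG) G),
      c.curvature gr u x (gr.negProj A) = c.curvatureForm u x A := fun x A ↦ by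
    rw [c.curvatureForm_eq hP, gr.negProj_coe]
  rw [h, h, h]
  exact c.bianchi u x y z

/-- The lowest homogeneous component of the curvature is `∂`-closed. -/
lemma diff_curvatureComp (hP : IsParabolic EP gr P) {l : ℤ}
    (hl : ∀ j < l, ∀ u : B, gr.homComp j (c.curvature gr u) = 0) (u : B) :
    gr.diff (gr.homComp l (c.curvature gr u)) = 0 := by
  rcases le_or_gt l 0 with hl0 | hl0
  · exact gr.diff_homComp_of_nonpos hl0 _
  have hf : ∀ (w : B) {i j : ℤ} {x y : gr.neg}, (x : GroupLieAlgebra 𝓘(𝕜, EG) G) ∈ gr.filt i →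
      (y : GroupLieAlgebra 𝓘(𝕜, EG) G) ∈ gr.filt j → c.curvature gr w x y ∈ gr.filt (i + j + l) :=
    fun w _ _ _ _ hx hy ↦ gr.apply_mem_filt (fun j hj ↦ hl j hj w) hx hy
  refine gr.trilinear_ext fun i j k hi hj hk x y z hx hy hz ↦ ?_
  rw [gr.proj_diff _ l hx hy hz hi hj hk, c.diff_curvature hP]
  -- The quadratic term lies in filtration degree `i + j + k + 2l`, above `i + j + k + l` because `l
  -- > 0`.
  have hq : ∀ {i j k : ℤ} {x y z : gr.neg}, (x : GroupLieAlgebra 𝓘(𝕜, EG) G) ∈ gr.piece i →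
      (y : GroupLieAlgebra 𝓘(𝕜, EG) G) ∈ gr.piece j →
      (z : GroupLieAlgebra 𝓘(𝕜, EG) G) ∈ gr.piece k →
      gr.proj (i + j + k + l) (c.curvature gr u x (gr.negProj (c.curvature gr u y z))) = 0 := by
    intro i j k x y z hx hy hz
    refine gr.mem_filt_iff.1 (hf u (gr.piece_le_filt le_rfl hx) (gr.coe_negProj_mem_filt
      (hf u (gr.piece_le_filt le_rfl hy) (gr.piece_le_filt le_rfl hz)))) _ ?_
    omega
  -- The derivative stays in filtration degree `j + k + l`, above `i + j + k + l` because `i < 0`.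
  have hd : ∀ {i j k : ℤ} {x : GroupLieAlgebra 𝓘(𝕜, EG) G} {y z : gr.neg}, i < 0 →
      (y : GroupLieAlgebra 𝓘(𝕜, EG) G) ∈ gr.piece j →
      (z : GroupLieAlgebra 𝓘(𝕜, EG) G) ∈ gr.piece k →
      gr.proj (i + j + k + l) (c.fieldDeriv (fun w ↦ c.curvature gr w y z) u x) = 0 := by
    intro i j k x y z hi hy hz
    refine c.fieldDeriv_eq_zero (c.mdifferentiableAt_curvatureForm u y z) _ (fun w ↦ ?_) x
    refine gr.mem_filt_iff.1 (hf w (gr.piece_le_filt le_rfl hy) (gr.piece_le_filt le_rfl hz)) _ ?_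
    omega
  have hi' : i < 0 := by omega
  have hj' : j < 0 := by omega
  have hk' : k < 0 := by omega
  have q2 := hq hy hx hz
  have q3 := hq hz hx hy
  have d2 := hd (x := y) hj' hx hz
  have d3 := hd (x := z) hk' hx hy
  rw [show j + i + k = i + j + k by ring] at q2 d2
  rw [show k + i + j = i + j + k by ring] at q3 d3
  simp only [map_add, map_sub, hq hx hy hz, hd (x := x) hi' hy hz, q2, q3, d2, d3, sub_zero,
    add_zero]
  rfl

lemma curvature_act (hP : IsParabolic EP gr P) (u : B) (p : P) (x y : gr.neg) :
    c.curvature gr (bdl.act u p) (gr.negProj (Ad 𝕜 (p⁻¹ : P).1 x))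
      (gr.negProj (Ad 𝕜 (p⁻¹ : P).1 y)) = Ad 𝕜 (p⁻¹ : P).1 (c.curvature gr u x y) := by
  rw [← c.curvatureForm_eq hP, c.curvatureForm_act, curvature_apply]

end CartanConnection

variable [LieAlgebra.IsSemisimple 𝕜 (GroupLieAlgebra 𝓘(𝕜, EG) G)]

/-- The action of an element of `P` on `gr(𝔤)` as an automorphism. -/
def grAdEquiv (hP : IsParabolic EP gr P) {g : G} (hg : g ∈ P) :
    GroupLieAlgebra 𝓘(𝕜, EG) G ≃ₗ⁅𝕜⁆ GroupLieAlgebra 𝓘(𝕜, EG) G :=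
  gr.gradedEquiv (AdEquiv g) (hP.Ad_mem_filt hg) (hP.Ad_mem_filt (inv_mem hg))

lemma grAdEquiv_mem (hP : IsParabolic EP gr P) {g : G} (hg : g ∈ P) (i : ℤ)
    (x : GroupLieAlgebra 𝓘(𝕜, EG) G) (hx : x ∈ gr.piece i) : grAdEquiv hP hg x ∈ gr.piece i :=
  gr.gradedEquiv_mem _ _ _ i x hx

lemma grAct_negEquiv (hP : IsParabolic EP gr P) {g : G} (hg : g ∈ P) (ψ : gr.C2) (x y : gr.neg) :
    grAct gr g ψ (gr.negEquiv (grAdEquiv hP hg) (grAdEquiv_mem hP hg) x)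
      (gr.negEquiv (grAdEquiv hP hg) (grAdEquiv_mem hP hg) y) = grAdEquiv hP hg (ψ x y) := by
  -- By construction the inverse of `grAdEquiv hP hg` is `grAd gr g⁻¹`.
  have h : ∀ x : gr.neg, gr.negProj (grAd gr g⁻¹
      (gr.negEquiv (grAdEquiv hP hg) (grAdEquiv_mem hP hg) x : GroupLieAlgebra 𝓘(𝕜, EG) G)) = x :=
    fun x ↦ (congrArg gr.negProj ((grAdEquiv hP hg).symm_apply_apply _)).trans (gr.negProj_coe x)
  exact congrArg (grAd gr g) (congrArg₂ (fun v w ↦ ψ v w) (h x) (h y))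

namespace CartanConnection

/-- The curvature is equivariant under the filtered map `Ad p⁻¹`. With all lower components zero,
the component of homogeneity `l` only sees its graded part. -/
lemma curvatureComp_act (hP : IsParabolic EP gr P) {l : ℤ}
    (hl : ∀ j < l, ∀ u : B, c.curvatureComp gr j u = 0) (u : B) (p : P) (x y : gr.neg) :
    c.curvatureComp gr l (bdl.act u p)
      (gr.negEquiv (grAdEquiv hP (p⁻¹).2) (grAdEquiv_mem hP (p⁻¹).2) x)
      (gr.negEquiv (grAdEquiv hP (p⁻¹).2) (grAdEquiv_mem hP (p⁻¹).2) y) =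
      grAdEquiv hP (p⁻¹).2 (c.curvatureComp gr l u x y) :=
  gr.homComp_gradedEquiv (AdEquiv (p⁻¹ : P).1) _ _ (c.curvature_act hP u p) (fun j hj ↦ hl j hj u)
    (fun j hj ↦ hl j hj _) x y

lemma contMDiff_linear_curvatureComp (l : ℤ) (f : gr.C2 →ₗ[𝕜] 𝕜) :
    ContMDiff 𝓘(𝕜, EB) 𝓘(𝕜, 𝕜) ∞ (fun u ↦ f (c.curvatureComp gr l u)) := by
  obtain ⟨σ⟩ := gr.exists_transposition
  obtain ⟨n, b, d, hd, -⟩ := σ.exists_orthonormal_basis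
  -- A cochain is determined linearly by its values on pairs of basis vectors, and on a homogeneous
  -- basis these are projections of smooth curvature values.
  let Φ : gr.C2 →ₗ[𝕜] Fin n → Fin n → EG :=
    LinearMap.pi fun i ↦ LinearMap.pi fun j ↦
      { toFun := fun ψ ↦ ψ (b i) (b j)
        map_add' := fun _ _ ↦ rfl
        map_smul' := fun _ _ ↦ rfl }
  have hΦ : LinearMap.ker Φ = ⊥ := by
    refine LinearMap.ker_eq_bot'.2 fun ψ hψ ↦ Subtype.ext (b.ext fun i ↦ b.ext fun j ↦ ?_)
    exact congrFun (congrFun hψ i) j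
  obtain ⟨r, hr⟩ := Φ.exists_leftInverse_of_injective hΦ
  let L : (Fin n → Fin n → EG) →L[𝕜] 𝕜 := LinearMap.toContinuousLinearMap (f ∘ₗ r)
  have e : (fun u ↦ f (c.curvatureComp gr l u)) = fun u ↦ L (Φ (c.curvatureComp gr l u)) := by
    funext u
    exact congrArg f (LinearMap.congr_fun hr (c.curvatureComp gr l u)).symm
  rw [e]
  refine L.contMDiff.comp (contMDiff_pi_space.2 fun i ↦ contMDiff_pi_space.2 fun j ↦ ?_)
  let T : EG →L[𝕜] EG :=
    LinearMap.toContinuousLinearMap (E := EG) (F' := EG) (gr.proj (d i + d j + l))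
  have e2 : (fun u ↦ Φ (c.curvatureComp gr l u) i j) = fun u ↦ T (c.curvatureForm u (b i) (b j)) :=
    funext fun u ↦ gr.homComp_apply (c.curvature gr u) (hd i) (hd j) (gr.degree_basis b d hd i)
      (gr.degree_basis b d hd j)
  rw [e2]
  exact T.contMDiff.comp (c.contMDiff_curvatureForm (b i) (b j))

lemma codiff2_curvatureComp (hc : c.IsNormal gr) (l : ℤ) (u : B) :
    gr.codiff2 (c.curvatureComp gr l u) = 0 := by
  obtain ⟨σ⟩ := gr.exists_transposition
  obtain ⟨n, b, d, hd, -⟩ := σ.exists_orthonormal_basis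
  exact gr.codiff2_homComp_eq_zero b d hd l (hc u)

/-- The class of the lowest homogeneous component of the curvature is a section of the second
cohomology bundle. -/
lemma isSectionH2_curvatureComp (hP : IsParabolic EP gr P) {l : ℤ}
    (hl : ∀ j < l, ∀ u : B, c.curvatureComp gr j u = 0)
    (h : ∀ u : B, gr.codiff2 (c.curvatureComp gr l u) = 0) :
    IsSectionH2 gr bdl (fun u ↦ gr.toH2 (c.curvatureComp gr l u) (h u)) where
  smooth f := by
    have h1 : ∃ g : gr.C2 →ₗ[𝕜] 𝕜, ∀ ψ hψ, f (gr.toH2 ψ hψ) = g ψ := gr.exists_linear_toH2 f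
    obtain ⟨g, hg⟩ := h1
    exact (c.contMDiff_linear_curvatureComp l g).congr fun u ↦ hg _ (h u)
  equivariant u p ψ hψ e := by
    have h1 := grAct_negEquiv hP (p⁻¹).2 ψ
    have h2 := c.curvatureComp_act hP hl u p
    have h3 := gr.codiff2_eq_zero_of_equiv _ _ h1 hψ
    exact ⟨h3, gr.toH2_equiv _ _ h2 h1 (hψ' := h (bdl.act u p)) (hφ' := h3) e⟩

/-- The harmonic curvature of a normal Cartan connection vanishes if and only if it is flat. -/
lemma toH2_curvature_eq_zero_iff (hP : IsParabolic EP gr P) (hc : c.IsNormal gr) :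
    (∀ u : B, gr.toH2 (c.curvature gr u) (hc u) = 0) ↔ c.IsFlat := by
  constructor
  · intro h
    obtain ⟨σ⟩ := gr.exists_transposition
    obtain ⟨n, b, d, hd, hb⟩ := σ.exists_orthonormal_basis
    have key : ∀ m : ℕ, ∀ j < (m : ℤ), ∀ u : B, gr.homComp j (c.curvature gr u) = 0 := by
      intro m
      induction m with
      | zero => exact fun j hj u ↦ gr.homComp_of_neg hj _
      | succ m ih =>
        intro j hj u
        rcases (show j ≤ m by push_cast at hj; omega).lt_or_eq with hj | rfl
        · exact ih j hj u
        -- All components below `m` vanish on the whole bundle, so `κ_m` is a cocycle. It is also a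
        -- component of `∂^*φ`, and orthogonality kills it.
        · have h1 := c.diff_curvatureComp hP ih u
          obtain ⟨φ, hφ⟩ := (gr.toH2_eq_zero_iff (hc u)).1 (h u)
          rw [← hφ] at h1 ⊢
          exact σ.homComp_codiff3_eq_zero b d hd hb φ m h1
    intro u
    have h0 : c.curvature gr u = 0 := gr.eq_zero_of_forall_homComp fun l ↦
      key (l.toNat + 1) l (by omega) u
    ext A A'
    rw [c.curvatureForm_eq hP, h0]
    rfl
  · intro h u
    refine (gr.toH2_eq_zero_iff (hc u)).2 ⟨0, ?_⟩
    rw [map_zero]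
    ext x y
    exact (congrArg (fun K ↦ K (x : GroupLieAlgebra 𝓘(𝕜, EG) G) (y : GroupLieAlgebra 𝓘(𝕜, EG) G))
      (h u)).symm

end CartanConnection
end Lowest
end CartanGeom
end

theorem mainTheorem8 {𝕜 : Type*} [RCLike 𝕜]
    {EG : Type*} [NormedAddCommGroup EG] [NormedSpace 𝕜 EG] [FiniteDimensional 𝕜 EG]
    [CompleteSpace EG]
    {G : Type*} [TopologicalSpace G] [ChartedSpace EG G] [Group G] [LieGroup 𝓘(𝕜, EG) ∞ G]
    [LieAlgebra.IsSemisimple 𝕜 (GroupLieAlgebra 𝓘(𝕜, EG) G)]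
    (gr : CartanGeom.TwoGrading 𝕜 (GroupLieAlgebra 𝓘(𝕜, EG) G))
    {EP : Type*} [NormedAddCommGroup EP] [NormedSpace 𝕜 EP] [FiniteDimensional 𝕜 EP]
    (P : Subgroup G) [ChartedSpace EP P] [LieGroup 𝓘(𝕜, EP) ∞ P]
    (hP : CartanGeom.IsParabolic EP gr P)
    {EB : Type*} [NormedAddCommGroup EB] [NormedSpace 𝕜 EB] [FiniteDimensional 𝕜 EB]
    [CompleteSpace EB]
    {B : Type*} [TopologicalSpace B] [ChartedSpace EB B] [IsManifold 𝓘(𝕜, EB) ∞ B]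
    {EM : Type*} [NormedAddCommGroup EM] [NormedSpace 𝕜 EM] [FiniteDimensional 𝕜 EM]
    {M : Type*} [TopologicalSpace M] [ChartedSpace EM M] [IsManifold 𝓘(𝕜, EM) ∞ M]
    (bdl : CartanGeom.PrincipalBundle 𝕜 EP EB EM P B M)
    (c : CartanGeom.CartanConnection EG bdl) (hc : c.IsNormal gr) :
    -- the curvature has no components of negative homogeneity
    (∀ l : ℤ, l < 0 → ∀ u : B, c.curvatureComp gr l u = 0) ∧
    -- `κ₀` is `∂^*`- and `∂`-closed, and defines a section of the second cohomology bundle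
    (∃ h : ∀ u : B, gr.codiff2 (c.curvatureComp gr 0 u) = 0,
      (∀ u : B, gr.diff (c.curvatureComp gr 0 u) = 0) ∧
      CartanGeom.IsSectionH2 gr bdl (fun u ↦ gr.toH2 (c.curvatureComp gr 0 u) (h u))) ∧
    -- the same holds for the lowest component `κ_l` if the curvature is of homogeneity `≥ l`
    (∀ l : ℤ, (∀ j : ℤ, j < l → ∀ u : B, c.curvatureComp gr j u = 0) →
      ∃ h : ∀ u : B, gr.codiff2 (c.curvatureComp gr l u) = 0,
        (∀ u : B, gr.diff (c.curvatureComp gr l u) = 0) ∧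
        CartanGeom.IsSectionH2 gr bdl (fun u ↦ gr.toH2 (c.curvatureComp gr l u) (h u))) ∧
    -- the harmonic curvature `[κ]` vanishes if and only if the connection is flat
    ((∀ u : B, gr.toH2 (c.curvature gr u) (hc u) = 0) ↔ c.IsFlat) := by
  have neg : ∀ l : ℤ, l < 0 → ∀ u : B, c.curvatureComp gr l u = 0 :=
    fun l hl u ↦ gr.homComp_of_neg hl _
  exact ⟨neg, ⟨c.codiff2_curvatureComp hc 0, c.diff_curvatureComp hP neg,
    c.isSectionH2_curvatureComp hP neg _⟩, fun l hl ↦ ⟨c.codiff2_curvatureComp hc l,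
    c.diff_curvatureComp hP hl, c.isSectionH2_curvatureComp hP hl _⟩,
    c.toH2_curvature_eq_zero_iff hP hc⟩
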